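/- **Setting.** Let $\omega>0$, $\mu>0$, $\lambda+\mu>0$, $\Lambda_1,\Lambda_2>0$, $\theta_1\in[0,\pi/2)$, $\theta_2\in[0,2\pi]$, let $f:\mathbb R^2\to\mathbb R$ be Lipschitz and biperiodic with periods $(\Lambda_1,\Lambda_2)$, $h>\max f$ and $a=\min f$. Write $x=(r,x_3)$, $r=(x_1,x_2)$, $\Omega=\{x: 0<x_1<\Lambda_1,\ 0<x_2<\Lambda_2,\ f(r)<x_3<h\}$, $\Gamma_h=\{0<x_1<\Lambda_1,\ 0<x_2<\Lambda_2,\ x_3=h\}$, $\Gamma_f=\{x_3=f(r)\}$. Put $\kappa_1=\omega(\lambda+2\mu)^{-1/2}$, $\kappa_2=\omega\mu^{-1/2}$, $q=(\sin\theta_1\cos\theta_2,\sin\theta_1\sin\theta_2,-\cos\theta_1)$, $u^{\rm inc}(x)=q\,e^{i\kappa_1x\cdot q}$, $\alpha=\kappa_1(q_1,q_2)$, and for $n\in\mathbb Z^2$: $\alpha^{(n)}=\alpha+2\pi(n_1/\Lambda_1,n_2/\Lambda_2)$, $\Delta_j^{(n)}=|\kappa_j^2-|\alpha^{(n)}|^2|^{1/2}$,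 $U_j=\{n:|\alpha^{(n)}|<\kappa_j\}$, $\beta_j^{(n)}=\Delta_j^{(n)}$ for $n\in U_j$ and $\beta_j^{(n)}=i\Delta_j^{(n)}$ otherwise. Assume $|\alpha^{(n)}|\ne\kappa_j$ for all $n\in\mathbb Z^2$, $j=1,2$. Let $\Delta_j^-=\min_{n\in U_j}\Delta_j^{(n)}$ and $\Delta_j^+=\min_{n\notin U_j}\Delta_j^{(n)}$. Let $H^1_{\rm qp}(\Omega)$ be the space of quasi-biperiodic functions $u$ (that is, $u(x_1+n_1\Lambda_1,x_2+n_2\Lambda_2,x_3)=e^{i(n_1\alpha_1\Lambda_1+n_2\alpha_2\Lambda_2)}u(x)$) of class $H^1$ with $u=0$ on $\Gamma_f$, with the norm of $H^1(\Omega)$. For $w$ on $\Gamma_h$ let $w^{(n)}=\frac1{\Lambda_1\Lambda_2}\int_{\Gamma_h}w\,e^{-i\alpha^{(n)}\cdot r}dr$. Put $\mathscr D u=\mu\partial_{x_3}u+(\lambda+\mu)(\nabla\cdot u)e_3$. **Original problem.** Let $\mathscr T w=\sum_nM^{(n)}w^{(n)}e^{i\alpha^{(n)}\cdot r}$, where,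 with $\chi^{(n)}=|\alpha^{(n)}|^2+\beta_1^{(n)}\beta_2^{(n)}$ and the superscripts $(n)$ omitted on the right, $$M^{(n)}=\frac{i\mu}{\chi}\begin{bmatrix}\alpha_1^2(\beta_1-\beta_2)+\beta_2\chi&\alpha_1\alpha_2(\beta_1-\beta_2)&\alpha_1\beta_2(\beta_1-\beta_2)\\ \alpha_1\alpha_2(\beta_1-\beta_2)&\alpha_2^2(\beta_1-\beta_2)+\beta_2\chi&\alpha_2\beta_2(\beta_1-\beta_2)\\ -\alpha_1\beta_2(\beta_1-\beta_2)&-\alpha_2\beta_2(\beta_1-\beta_2)&\kappa_2^2\beta_2\end{bmatrix},$$ and for $u,v\in H^1_{\rm qp}(\Omega)^3$ $$a(u,v)=\mu\int_\Omega\nabla u:\nabla\bar v\,dx+(\lambda+\mu)\int_\Omega(\nabla\cdot u)(\nabla\cdot\bar v)\,dx-\omega^2\int_\Omega u\cdot\bar v\,dx-\langle\mathscr Tu,v\rangle_{\Gamma_h}.$$ The original problem is to find $u\in H^1_{\rm qp}(\Omega)^3$ with $a(u,v)=\langle g,v\rangle_{\Gamma_h}$ for all $v\in H^1_{\rm qp}(\Omega)^3$,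 where $g=\mathscr Du^{\rm inc}-\mathscr Tu^{\rm inc}$. **PML problem.** Let $\delta>0$ and let $\rho:\mathbb R\to\mathbb C$ be continuous with $\rho=1$ on $(-\infty,h)$, $\operatorname{Re}\rho\ge1$, and $\operatorname{Im}\rho>0$ on $(h,\infty)$. Put $\zeta=\int_h^{h+\delta}\rho(\tau)\,d\tau$ and assume $\operatorname{Re}\zeta\ge1$. Let $\mathscr T^{\rm PML}w=\sum_n\hat M^{(n)}w^{(n)}e^{i\alpha^{(n)}\cdot r}$, where $\hat M^{(n)}$ is obtained by solving the Navier equation in the stretched layer with value $w^{(n)}$ at $x_3=h$ and value $0$ at $x_3=h+\delta$: with $k_j^\pm=(\alpha_1^{(n)},\alpha_2^{(n)},\pm\beta_j^{(n)})$, let $A,B\in\mathbb C$ and $C,D\in\mathbb C^3$ be determined by $$\begin{aligned}&Ak_1^++Bk_1^-+k_2^+\times C+k_2^-\times D=-iw,\\ &e^{i\beta_1^{(n)}\zeta}Ak_1^++e^{-i\beta_1^{(n)}\zeta}Bk_1^-+e^{i\beta_2^{(n)}\zeta}k_2^+\times C+e^{-i\beta_2^{(n)}\zeta}k_2^-\times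 D=0,\\ &k_2^+\cdot C+k_2^-\cdot D=0,\qquad e^{i\beta_2^{(n)}\zeta}k_2^+\cdot C+e^{-i\beta_2^{(n)}\zeta}k_2^-\cdot D=0\end{aligned}$$ ($\cdot$ bilinear), and let $\hat M^{(n)}w$ be the $n$-th mode of $\mathscr D\hat v$ on $\Gamma_h$, namely $$\hat M^{(n)}w=\mu\Big[-A\big(\beta_1^{(n)}\alpha_1^{(n)},\beta_1^{(n)}\alpha_2^{(n)},(\beta_2^{(n)})^2\big)+B\big(\beta_1^{(n)}\alpha_1^{(n)},\beta_1^{(n)}\alpha_2^{(n)},-(\beta_2^{(n)})^2\big)-\beta_2^{(n)}k_2^+\times C+\beta_2^{(n)}k_2^-\times D\Big].$$ (If this system is singular for some $n$, put $\hat M^{(n)}=0$; the smallness condition below excludes this.) Let $a^{\rm PML}$ and $g^{\rm PML}$ be $a$ and $g$ with $\mathscr T$ replaced by $\mathscr T^{\rm PML}$. The PML variational problem is to find $u^{\rm PML}\in H^1_{\rm qp}(\Omega)^3$ with $a^{\rm PML}(u^{\rm PML},v)=\langle g^{\rm PML},v\rangle_{\Gamma_h}$ for all $v\in H^1_{\rm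 qp}(\Omega)^3$. **Constants.** Let $\gamma_1>0$ be a constant with $$\sup_{0\ne v\in H^1_{\rm qp}(\Omega)^3}\frac{|a(u,v)|}{\|v\|_{H^1(\Omega)^3}}\ge\gamma_1\|u\|_{H^1(\Omega)^3}\qquad\text{for all }u\in H^1_{\rm qp}(\Omega)^3,$$ let $\gamma_2=(1+(h-a)^{-1})^{1/2}$ and $\hat K=11\mu K/\kappa_1^4$, where $$\begin{aligned}K=\frac{48(49+\kappa_2^2)^{7/2}}{\kappa_1^2}\max\Big\{&\frac1{e^{\Delta_1^-\operatorname{Im}\zeta}-1},\ \frac1{(e^{\frac12\Delta_1^-\operatorname{Im}\zeta}-1)^2},\ \frac1{(e^{\frac13\Delta_1^-\operatorname{Im}\zeta}-1)^3},\ \frac1{e^{\Delta_2^+\operatorname{Re}\zeta}-1},\ \frac1{(e^{\frac12\Delta_2^+\operatorname{Re}\zeta}-1)^2},\\ &\frac1{(e^{\frac13\Delta_2^+\operatorname{Re}\zeta}-1)^3},\ \frac1{e^{\Delta_2^-\operatorname{Im}\zeta}-1},\ \frac{(e^{-\Delta_1^+\operatorname{Re}\zeta}+e^{-\Delta_2^-\operatorname{Im}\zeta})^2}{(1-e^{-2\Delta_1^+\operatorname{Re}\zeta})(1-e^{-2\Delta_2^-\operatorname{Im}\zeta})^2}\Big\}.\end{aligned}$$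 **Theorem 3.1.** (i) If $\hat K\gamma_2^2<\gamma_1$, then the PML variational problem has a unique weak solution $u^{\rm PML}$, and for every weak solution $u$ of the original problem (it is unique) $$\sup_{0\ne v\in H^1_{\rm qp}(\Omega)^3}\frac{|a(u-u^{\rm PML},v)|}{\|v\|_{H^1(\Omega)^3}}\le\gamma_2\hat K\,\|u^{\rm PML}-u^{\rm inc}\|_{L^2(\Gamma_h)^3}.$$ (ii) $\hat K=\hat K(\zeta)$ decays exponentially in the PML parameters: there is $c>0$, depending only on the scattering data, and for each $s>0$ a constant $C$, depending only on $s$ and the scattering data, such that $|\hat K(\zeta)|\le C\big(e^{-c\operatorname{Re}\zeta}+e^{-c\operatorname{Im}\zeta}\big)$ for all $\zeta\in\mathbb C$ with $\operatorname{Re}\zeta\ge s$ and $\operatorname{Im}\zeta\ge s$. -/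

import Mathlib

open MeasureTheory
open scoped ENNReal ComplexConjugate

noncomputable section

namespace ElasticGrating

/-- Points `x = (r, x₃)` of `ℝ³` with `r = (x₁, x₂)`, carrying Lebesgue measure. -/
abbrev Space : Type := (ℝ × ℝ) × ℝ

/-- The unit coordinate vectors of `ℝ³`. -/
def unitVec (j : Fin 3) : Space :=
  (![((1, 0), 0), ((0, 1), 0), ((0, 0), 1)] : Fin 3 → Space) j

/-- The data of the scattering problem: angular frequency, Lamé constants, periods, incident
angles, the height `h` of the artificial boundary and the Lipschitz biperiodic profile `f`. -/
structure Scattering where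
  ω : ℝ
  lam : ℝ
  μ : ℝ
  Λ₁ : ℝ
  Λ₂ : ℝ
  θ₁ : ℝ
  θ₂ : ℝ
  h : ℝ
  f : ℝ × ℝ → ℝ
  ω_pos : 0 < ω
  μ_pos : 0 < μ
  lam_add_μ_pos : 0 < lam + μ
  Λ₁_pos : 0 < Λ₁
  Λ₂_pos : 0 < Λ₂
  θ₁_nonneg : 0 ≤ θ₁
  θ₁_lt : θ₁ < Real.pi / 2
  θ₂_nonneg : 0 ≤ θ₂
  θ₂_le : θ₂ ≤ 2 * Real.pi
  f_lipschitz : ∃ L : NNReal, LipschitzWith L f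
  f_periodic₁ : ∀ r : ℝ × ℝ, f (r.1 + Λ₁, r.2) = f r
  f_periodic₂ : ∀ r : ℝ × ℝ, f (r.1, r.2 + Λ₂) = f r
  f_lt_h : ∀ r : ℝ × ℝ, f r < h

namespace Scattering

variable (P : Scattering)

/-! ### Wave numbers, incident field, Fourier modes -/

/-- The compressional wave number `κ₁`. -/
def κ₁ : ℝ := P.ω / Real.sqrt (P.lam + 2 * P.μ)

/-- The shear wave number `κ₂`. -/
def κ₂ : ℝ := P.ω / Real.sqrt P.μ

/-- The propagation direction `q` of the incident wave. -/
def q : Fin 3 → ℝ :=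
  ![Real.sin P.θ₁ * Real.cos P.θ₂, Real.sin P.θ₁ * Real.sin P.θ₂, -Real.cos P.θ₁]

/-- The incident compressional plane wave `q exp(i κ₁ x·q)`. -/
def uInc (x : Space) (i : Fin 3) : ℂ :=
  (P.q i : ℂ) * Complex.exp (Complex.I *
    ((P.κ₁ * (x.1.1 * P.q 0 + x.1.2 * P.q 1 + x.2 * P.q 2) : ℝ) : ℂ))

/-- `α₁ = κ₁ sin θ₁ cos θ₂`. -/
def α₁ : ℝ := P.κ₁ * Real.sin P.θ₁ * Real.cos P.θ₂

/-- `α₂ = κ₁ sin θ₁ sin θ₂`. -/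
def α₂ : ℝ := P.κ₁ * Real.sin P.θ₁ * Real.sin P.θ₂

/-- `α₁⁽ⁿ⁾ = α₁ + 2π n₁ / Λ₁`. -/
def αn₁ (n : ℤ × ℤ) : ℝ := P.α₁ + 2 * Real.pi * n.1 / P.Λ₁

/-- `α₂⁽ⁿ⁾ = α₂ + 2π n₂ / Λ₂`. -/
def αn₂ (n : ℤ × ℤ) : ℝ := P.α₂ + 2 * Real.pi * n.2 / P.Λ₂

/-- The Euclidean length `|α⁽ⁿ⁾|`. -/
def αabs (n : ℤ × ℤ) : ℝ := Real.sqrt (P.αn₁ n ^ 2 + P.αn₂ n ^ 2)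

/-- The vertical wave number belonging to a wave number `κ`: `(κ² - |α⁽ⁿ⁾|²)^{1/2}` for
propagating modes and `i (|α⁽ⁿ⁾|² - κ²)^{1/2}` for evanescent ones. -/
def β (κ : ℝ) (n : ℤ × ℤ) : ℂ :=
  if P.αabs n < κ then (Real.sqrt (κ ^ 2 - P.αabs n ^ 2) : ℂ)
  else Complex.I * (Real.sqrt (P.αabs n ^ 2 - κ ^ 2) : ℂ)

/-- `β₁⁽ⁿ⁾`. -/
def β₁ (n : ℤ × ℤ) : ℂ := P.β P.κ₁ n

/-- `β₂⁽ⁿ⁾`. -/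
def β₂ (n : ℤ × ℤ) : ℂ := P.β P.κ₂ n

/-- No resonances: `κⱼ ≠ |α⁽ⁿ⁾|` for `j = 1, 2` and all `n`. -/
def NoResonance : Prop := ∀ n : ℤ × ℤ, P.κ₁ ≠ P.αabs n ∧ P.κ₂ ≠ P.αabs n

/-! ### Domain and function spaces -/

/-- One period cell `(0, Λ₁) × (0, Λ₂)` of the horizontal plane; it parametrizes `Γ_h`. -/
def cell : Set (ℝ × ℝ) := Set.Ioo 0 P.Λ₁ ×ˢ Set.Ioo 0 P.Λ₂

/-- The domain `Ω` between the scattering surface and the plane `x₃ = h`, over one cell. -/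
def Ω : Set Space := {x | x.1 ∈ P.cell ∧ P.f x.1 < x.2 ∧ x.2 < P.h}

/-- `L²(Ω)`. -/
abbrev L2Ω : Type := Lp ℂ 2 (volume.restrict P.Ω)

/-- `L²(Γ_h)`. -/
abbrev L2Γ : Type := Lp ℂ 2 (volume.restrict P.cell)

/-- A scalar function together with candidates for its weak gradient in `Ω` and its trace
on `Γ_h`. -/
abbrev Triple : Type := P.L2Ω × (Fin 3 → P.L2Ω) × P.L2Γ

/-- Smooth quasi-biperiodic functions on `ℝ³`:
`φ(x₁ + n₁ Λ₁, x₂ + n₂ Λ₂, x₃) = φ(x) exp(i (n₁ α₁ Λ₁ + n₂ α₂ Λ₂))`. -/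
def IsTest (φ : Space → ℂ) : Prop :=
  ContDiff ℝ (⊤ : ℕ∞) φ ∧ ∀ (x : Space) (n : ℤ × ℤ),
    φ ((x.1.1 + n.1 * P.Λ₁, x.1.2 + n.2 * P.Λ₂), x.2) =
      φ x * Complex.exp (Complex.I *
        ((n.1 * P.α₁ * P.Λ₁ + n.2 * P.α₂ * P.Λ₂ : ℝ) : ℂ))

/-- The space of the functions in `H¹_qp(Ω)` that vanish on the scattering surface `Γ_f`.
A quasi-biperiodic function is determined by its restriction `u` to the period cell `Ω`.
An element is a triple `(u, G, w)`, where `G` is the weak gradient of `u` and `w` its trace on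
`Γ_h`; both are determined by `u`, through Green's formula
`∫_Ω u ∂ⱼφ̄ = - ∫_Ω Gⱼ φ̄ + δ_{j3} ∫_{Γ_h} w φ̄` for all smooth quasi-biperiodic `φ`.
Test functions with support inside the open strip give the weak gradient of the quasi-biperiodic
extension of `u` (the contributions of opposite lateral faces cancel);
the test functions need not vanish on `Γ_f` or `Γ_h`, so the absence of a boundary term on
`Γ_f` says that the trace of `u` there is zero, and the term on `Γ_h` says that `w` is the
trace there. -/
def H1qp : Set P.Triple :=
  {u | ∀ φ : Space → ℂ, P.IsTest φ → ∀ j : Fin 3,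
    ∫ x in P.Ω, u.1 x * conj (fderiv ℝ φ x (unitVec j)) =
      -(∫ x in P.Ω, u.2.1 j x * conj (φ x)) +
        (if j = 2 then ∫ r in P.cell, u.2.2 r * conj (φ (r, P.h)) else 0)}

/-- Vector fields with their weak Jacobians and traces, componentwise. -/
abbrev VField : Type := Fin 3 → P.Triple

/-- The Cartesian product `H¹_qp(Ω)³` (with vanishing trace on `Γ_f`). -/
def V : Set P.VField := {u | ∀ i, u i ∈ P.H1qp}

variable {P} in
/-- The `i`-th component `uᵢ`. -/
def VField.val (u : P.VField) (i : Fin 3) : Space → ℂ := (u i).1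

variable {P} in
/-- The partial derivative `∂ⱼ uᵢ`. -/
def VField.partialD (u : P.VField) (i j : Fin 3) : Space → ℂ := (u i).2.1 j

variable {P} in
/-- The divergence of `u`. -/
def VField.div (u : P.VField) (x : Space) : ℂ := ∑ i, VField.partialD u i i x

variable {P} in
/-- The trace of `uᵢ` on `Γ_h`. -/
def VField.tr (u : P.VField) (i : Fin 3) : ℝ × ℝ → ℂ := (u i).2.2

variable {P} in
/-- The norm of `H¹(Ω)³`. -/
def VField.H1norm (u : P.VField) : ℝ :=
  Real.sqrt (∑ i, (∫ x in P.Ω, ‖VField.val u i x‖ ^ 2) +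
    ∑ i, ∑ j, (∫ x in P.Ω, ‖VField.partialD u i j x‖ ^ 2))

/-- The norm of `L²(Γ_h)³`. -/
def normΓ (w : Fin 3 → ℝ × ℝ → ℂ) : ℝ :=
  Real.sqrt (∑ i, ∫ r in P.cell, ‖w i r‖ ^ 2)

/-! ### Boundary operators -/

/-- The Fourier coefficient `w⁽ⁿ⁾` of a quasi-biperiodic function on `Γ_h`. -/
def coeff (w : ℝ × ℝ → ℂ) (n : ℤ × ℤ) : ℂ :=
  (1 / (P.Λ₁ * P.Λ₂) : ℝ) * ∫ r in P.cell, w r *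
    Complex.exp (-(Complex.I * ((P.αn₁ n * r.1 + P.αn₂ n * r.2 : ℝ) : ℂ)))

/-- `⟨𝒯 w, z⟩_{Γ_h}` (the duality of `H^{-1/2}` and `H^{1/2}`) for the operator
`𝒯 w = ∑ₙ M⁽ⁿ⁾ w⁽ⁿ⁾ exp(i α⁽ⁿ⁾·r)`. -/
def pairing (M : ℤ × ℤ → Matrix (Fin 3) (Fin 3) ℂ) (w z : Fin 3 → ℝ × ℝ → ℂ) : ℂ :=
  (P.Λ₁ * P.Λ₂ : ℝ) * ∑' n : ℤ × ℤ, ∑ i,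
    (M n).mulVec (fun k => P.coeff (w k) n) i * conj (P.coeff (z i) n)

/-- `χ⁽ⁿ⁾ = |α⁽ⁿ⁾|² + β₁⁽ⁿ⁾ β₂⁽ⁿ⁾`. -/
def χ (n : ℤ × ℤ) : ℂ := (P.αabs n : ℂ) ^ 2 + P.β₁ n * P.β₂ n

/-- The symbol `M⁽ⁿ⁾` of the exact transparent boundary operator `𝒯`. -/
def M (n : ℤ × ℤ) : Matrix (Fin 3) (Fin 3) ℂ :=
  let a₁ : ℂ := P.αn₁ n
  let a₂ : ℂ := P.αn₂ n
  let b₁ := P.β₁ n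
  let b₂ := P.β₂ n
  (Complex.I * P.μ / P.χ n) •
    !![a₁ ^ 2 * (b₁ - b₂) + b₂ * P.χ n, a₁ * a₂ * (b₁ - b₂), a₁ * b₂ * (b₁ - b₂);
       a₁ * a₂ * (b₁ - b₂), a₂ ^ 2 * (b₁ - b₂) + b₂ * P.χ n, a₂ * b₂ * (b₁ - b₂);
       -(a₁ * b₂ * (b₁ - b₂)), -(a₂ * b₂ * (b₁ - b₂)), (P.κ₂ : ℂ) ^ 2 * b₂]

/-- The matrix of the linear system for the coefficients
`X = (A, B, C₁, D₁, C₂, D₂, C₃, D₃)` of the `n`-th mode of the potentials in the layer: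
`φ̂ = A exp(iβ₁ζ(x₃)) + B exp(-iβ₁ζ(x₃))`, `ψ̂ₖ = Cₖ exp(iβ₂ζ(x₃)) + Dₖ exp(-iβ₂ζ(x₃))`.
Rows 1-3: the value of the field at `x₃ = h`; rows 4-6: its value at `x₃ = h + δ`;
rows 7-8: the divergence of `ψ̂` at `x₃ = h` and at `x₃ = h + δ`. -/
def layerMatrix (ζ : ℂ) (n : ℤ × ℤ) : Matrix (Fin 8) (Fin 8) ℂ :=
  let a₁ : ℂ := P.αn₁ n
  let a₂ : ℂ := P.αn₂ n
  let b₁ := P.β₁ n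
  let b₂ := P.β₂ n
  let e₁ := Complex.exp (Complex.I * b₁ * ζ)
  let f₁ := Complex.exp (-(Complex.I * b₁ * ζ))
  let e₂ := Complex.exp (Complex.I * b₂ * ζ)
  let f₂ := Complex.exp (-(Complex.I * b₂ * ζ))
  !![a₁, a₁, 0, 0, -b₂, b₂, a₂, a₂;
     a₂, a₂, b₂, -b₂, 0, 0, -a₁, -a₁;
     b₁, -b₁, -a₂, -a₂, a₁, a₁, 0, 0;
     a₁ * e₁, a₁ * f₁, 0, 0, -b₂ * e₂, b₂ * f₂, a₂ * e₂, a₂ * f₂;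
     a₂ * e₁, a₂ * f₁, b₂ * e₂, -b₂ * f₂, 0, 0, -a₁ * e₂, -a₁ * f₂;
     b₁ * e₁, -b₁ * f₁, -a₂ * e₂, -a₂ * f₂, a₁ * e₂, a₁ * f₂, 0, 0;
     0, 0, a₁, a₁, a₂, a₂, b₂, -b₂;
     0, 0, a₁ * e₂, a₁ * f₂, a₂ * e₂, a₂ * f₂, b₂ * e₂, -b₂ * f₂]

/-- The matrix that maps a value `w` on `Γ_h` to the right-hand side
`-i (w₁, w₂, w₃, 0, 0, 0, 0, 0)` of the linear system. -/
def layerRhs : Matrix (Fin 8) (Fin 3) ℂ :=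
  !![-Complex.I, 0, 0;
     0, -Complex.I, 0;
     0, 0, -Complex.I;
     0, 0, 0;
     0, 0, 0;
     0, 0, 0;
     0, 0, 0;
     0, 0, 0]

/-- The matrix `P⁽ⁿ⁾`: `μ P⁽ⁿ⁾ X` is the `n`-th mode of `𝒟 v̂` on `Γ_h`. -/
def layerTraction (n : ℤ × ℤ) : Matrix (Fin 3) (Fin 8) ℂ :=
  let a₁ : ℂ := P.αn₁ n
  let a₂ : ℂ := P.αn₂ n
  let b₁ := P.β₁ n
  let b₂ := P.β₂ n
  !![-(a₁ * b₁), a₁ * b₁, 0, 0, b₂ ^ 2, b₂ ^ 2, -(a₂ * b₂), a₂ * b₂;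
     -(a₂ * b₁), a₂ * b₁, -b₂ ^ 2, -b₂ ^ 2, 0, 0, a₁ * b₂, -(a₁ * b₂);
     -b₂ ^ 2, -b₂ ^ 2, a₂ * b₂, -(a₂ * b₂), -(a₁ * b₂), a₁ * b₂, 0, 0]

/-- The symbol `M̂⁽ⁿ⁾` of the transparent boundary operator of the PML problem: solve the
linear system in the layer for a given value on `Γ_h`, and evaluate `𝒟` on `Γ_h`. -/
def MPML (ζ : ℂ) (n : ℤ × ℤ) : Matrix (Fin 3) (Fin 3) ℂ :=
  (P.μ : ℂ) • (P.layerTraction n * (P.layerMatrix ζ n)⁻¹ * layerRhs)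

/-- `𝒟u = μ ∂_{x₃} u + (λ + μ) (∇·u) e₃` for a classically differentiable field. -/
def traction (u : Space → Fin 3 → ℂ) (x : Space) (i : Fin 3) : ℂ :=
  P.μ * fderiv ℝ (fun y => u y i) x (unitVec 2) +
    if i = 2 then
      ((P.lam + P.μ : ℝ) : ℂ) * ∑ j, fderiv ℝ (fun y => u y j) x (unitVec j)
    else 0

/-- The trace of the incident field on `Γ_h`. -/
def uIncΓ (i : Fin 3) (r : ℝ × ℝ) : ℂ := P.uInc (r, P.h) i

/-! ### Variational problems -/

/-- The sesquilinear form
`μ ∫ ∇u:∇v̄ + (λ+μ) ∫ (∇·u)(∇·v̄) - ω² ∫ u·v̄ - ⟨𝒯u, v⟩_{Γ_h}` for the boundary operator with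
symbol `S`. -/
def form (S : ℤ × ℤ → Matrix (Fin 3) (Fin 3) ℂ) (u v : P.VField) : ℂ :=
  P.μ * (∫ x in P.Ω, ∑ i, ∑ j, VField.partialD u i j x * conj (VField.partialD v i j x)) +
  ((P.lam + P.μ : ℝ) : ℂ) * (∫ x in P.Ω, VField.div u x * conj (VField.div v x)) -
  (P.ω : ℂ) ^ 2 * (∫ x in P.Ω, ∑ i, VField.val u i x * conj (VField.val v i x)) -
  P.pairing S (VField.tr u) (VField.tr v)

/-- `⟨g, v⟩_{Γ_h}` with `g = 𝒟 u^inc - 𝒯 u^inc`, for the boundary operator with symbol `S`. -/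
def load (S : ℤ × ℤ → Matrix (Fin 3) (Fin 3) ℂ) (v : P.VField) : ℂ :=
  (∫ r in P.cell, ∑ i, P.traction P.uInc (r, P.h) i * conj (VField.tr v i r)) -
    P.pairing S P.uIncΓ (VField.tr v)

/-- Weak solutions of the boundary value problem with the boundary operator of symbol `S`. -/
def IsWeakSolution (S : ℤ × ℤ → Matrix (Fin 3) (Fin 3) ℂ) (u : P.VField) : Prop :=
  u ∈ P.V ∧ ∀ v ∈ P.V, P.form S u v = P.load S v

/-- `sup_{0 ≠ v ∈ H¹_qp(Ω)³} |F(v)| / ‖v‖_{H¹(Ω)³}`. -/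
def dualSup (F : P.VField → ℂ) : ℝ≥0∞ :=
  ⨆ v ∈ P.V, ⨆ _ : v ≠ 0, ENNReal.ofReal (‖F v‖ / VField.H1norm v)

/-- The inf-sup condition with constant `γ₁` for the original sesquilinear form. -/
def InfSup (γ₁ : ℝ) : Prop :=
  ∀ u ∈ P.V, ENNReal.ofReal (γ₁ * VField.H1norm u) ≤ P.dualSup (P.form P.M u)

/-- The trace constant `γ₂ = (1 + (h - a)⁻¹)^{1/2}` with `a = min f`. -/
def γ₂ : ℝ := Real.sqrt (1 + (P.h - ⨅ r, P.f r)⁻¹)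

/-! ### The layer and the constant controlling the modeling error -/

/-- PML profiles: continuous, equal to `1` below the layer, with real part at least `1` and
positive imaginary part above `x₃ = h`. -/
structure IsPMLProfile (ρ : ℝ → ℂ) : Prop where
  continuous : Continuous ρ
  eq_one : ∀ τ, τ < P.h → ρ τ = 1
  one_le_re : ∀ τ, 1 ≤ (ρ τ).re
  im_pos : ∀ τ, P.h < τ → 0 < (ρ τ).im

/-- `ζ = ∫_h^{h+δ} ρ(τ) dτ`. -/
def zeta (ρ : ℝ → ℂ) (δ : ℝ) : ℂ := ∫ τ in P.h..(P.h + δ), ρ τ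

/-- `Δ⁽ⁿ⁾ = |κ² - |α⁽ⁿ⁾|²|^{1/2}`. -/
def Δ (κ : ℝ) (n : ℤ × ℤ) : ℝ := Real.sqrt |κ ^ 2 - P.αabs n ^ 2|

/-- `Δ⁻`, the minimum of `Δ⁽ⁿ⁾` over the propagating modes `|α⁽ⁿ⁾| < κ`. -/
def Δminus (κ : ℝ) : ℝ := sInf (P.Δ κ '' {n | P.αabs n < κ})

/-- `Δ⁺`, the minimum of `Δ⁽ⁿ⁾` over the remaining modes. -/
def Δplus (κ : ℝ) : ℝ := sInf (P.Δ κ '' {n | ¬ P.αabs n < κ})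

/-- The constant `K` as a function of the PML parameter `ζ`. -/
def K (ζ : ℂ) : ℝ :=
  48 * (49 + P.κ₂ ^ 2) ^ (7 / 2 : ℝ) / P.κ₁ ^ 2 *
    (max (1 / (Real.exp (P.Δminus P.κ₁ * ζ.im) - 1)) <|
     max (1 / (Real.exp (1 / 2 * P.Δminus P.κ₁ * ζ.im) - 1) ^ 2) <|
     max (1 / (Real.exp (1 / 3 * P.Δminus P.κ₁ * ζ.im) - 1) ^ 3) <|
     max (1 / (Real.exp (P.Δplus P.κ₂ * ζ.re) - 1)) <|
     max (1 / (Real.exp (1 / 2 * P.Δplus P.κ₂ * ζ.re) - 1) ^ 2) <|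
     max (1 / (Real.exp (1 / 3 * P.Δplus P.κ₂ * ζ.re) - 1) ^ 3) <|
     max (1 / (Real.exp (P.Δminus P.κ₂ * ζ.im) - 1))
      ((Real.exp (-(P.Δplus P.κ₁ * ζ.re)) + Real.exp (-(P.Δminus P.κ₂ * ζ.im))) ^ 2 /
        ((1 - Real.exp (-(2 * P.Δplus P.κ₁ * ζ.re))) *
          (1 - Real.exp (-(2 * P.Δminus P.κ₂ * ζ.im))) ^ 2)))

/-- `K̂ = 11 μ K / κ₁⁴`. -/
def Khat (ζ : ℂ) : ℝ := 11 * P.μ * P.K ζ / P.κ₁ ^ 4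

end Scattering

end ElasticGrating

end

/-!
The two boundary operators are compared one Fourier mode at a time, and the rest is a perturbation
argument for a form that satisfies Gårding's inequality.

*One mode.* For a fixed mode, a field in the layer splits into an up-going and a down-going part.
Propagation through the layer and the traction on `Γ_h` act on the amplitude of each part as rank-one
perturbations of multiples of the identity (`rankOneUpdate`, `Scattering.layer_system`,
`Scattering.M_mulVec`). The condition at the outer boundary expresses the down-going part through the
up-going one, so the reflected wave has passed the layer twice and carries two of the small factors
`exp(iβⱼζ)`. This bounds `M̂⁽ⁿ⁾ - M⁽ⁿ⁾` (`layer_perturbation`,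
`Scattering.ModeBounds.norm_MPML_sub_M_le`), and also shows that the layer system is regular
(`Scattering.ModeBounds.isUnit_det`). Three cases, according to the position of `|α⁽ⁿ⁾|`
relative to `κ₁ < κ₂`, turn the estimate into `‖M̂⁽ⁿ⁾ - M⁽ⁿ⁾‖ ≤ K̂` for all `n`, provided `K̂ ≤ 2μ`
(`Scattering.norm_MPML_sub_M_le_Khat`). The proviso comes for free: testing the inf-sup condition with
divergence-free fields in a high Fourier mode and with zero trace gives `γ₁ ≤ 2μ`
(`Scattering.le_of_infSup`), and `K̂ ≤ K̂ γ₂² < γ₁`.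

*Function spaces.* Green's formula tested with `exp(i α⁽ⁿ⁾·r) g(x₃)` reduces the trace inequality
`H¹ → H^{1/2}` (with constant one, `Scattering.sum_weight_coeff_le`) and the compactness of
`H¹ → L²`, in the form of a bound by finitely many Fourier coefficients plus a small multiple of the
energy (`Scattering.exists_finset_boxCoeff`), to Parseval's identity on the cell and on boxes.
Hence `H¹_qp(Ω)³` is a Hilbert space `Scattering.Field` in which the forms are represented by bounded
operators (`Scattering.exists_formOperator`).

*Solvability.* The exact symbol is dissipative on evanescent modes (`Scattering.re_inner_M_le`), so
each form whose symbol differs from it by a bounded one is coercive after adding an operator of finite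
rank (`Scattering.exists_finiteRank_coercive`), and injectivity implies surjectivity
(`surjective_of_coercive_add_finiteRank`). For the symbol of the layer, injectivity follows from the
inf-sup condition and `K̂ < γ₁`. The error estimate is the identity `Scattering.form_sub_eq` for the
consistency error, combined with Bessel's inequality on `Γ_h`.

*Decay.* The gaps `Δⱼ^±` have a common positive lower bound because the lattice of the `α⁽ⁿ⁾` is
discrete, so every entry of the maximum in `K` is bounded by a multiple of an exponential
(`Scattering.Khat_decay`).
-/

noncomputable section

namespace ElasticGrating

/-! ### Parseval frames -/

lemma memLp_two_iff_lintegral {X : Type*} [MeasurableSpace X] {ν : Measure X} {f : X → ℂ} :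
    MemLp f 2 ν ↔ AEStronglyMeasurable f ν ∧ ∫⁻ x, ‖f x‖ₑ ^ 2 ∂ν < ∞ := by
  unfold MemLp
  refine and_congr_right fun _ => ?_
  rw [eLpNorm_lt_top_iff_lintegral_rpow_enorm_lt_top (by simp) (by simp)]
  simp

/-- A family `e` of functions bounded by one is a Parseval frame with constant `c` if
`∑ᵢ |∫ f ēᵢ|² = c ∫ |f|²` for all `f ∈ L²(ν)`. -/
structure ParsevalFrame {X ι : Type*} [MeasurableSpace X] (ν : Measure X) (e : ι → X → ℂ)
    (c : ℝ≥0∞) : Prop where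
  aesm : ∀ i, AEStronglyMeasurable (e i) ν
  bound : ∀ i x, ‖e i x‖ ≤ 1
  parseval : ∀ f : X → ℂ, MemLp f 2 ν →
    ∑' i, ‖∫ x, f x * conj (e i x) ∂ν‖ₑ ^ 2 = c * ∫⁻ x, ‖f x‖ₑ ^ 2 ∂ν

lemma aesm_conj {X : Type*} [MeasurableSpace X] {ν : Measure X} {g : X → ℂ}
    (hg : AEStronglyMeasurable g ν) : AEStronglyMeasurable (fun x => conj (g x)) ν :=
  Complex.continuous_conj.comp_aestronglyMeasurable hg

/-- Products of Parseval frames are Parseval frames, by Tonelli's theorem. -/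
theorem ParsevalFrame.prod {X Y ι κ : Type*} [MeasurableSpace X] [MeasurableSpace Y]
    [Countable ι] [Countable κ]
    {ν : Measure X} {η : Measure Y} [IsFiniteMeasure ν] [IsFiniteMeasure η]
    {e : ι → X → ℂ} {g : κ → Y → ℂ} {c d : ℝ≥0∞} (he : ParsevalFrame ν e c)
    (hg : ParsevalFrame η g d) (hd : d ≠ ∞) :
    ParsevalFrame (ν.prod η) (fun (i : ι × κ) (x : X × Y) => e i.1 x.1 * g i.2 x.2) (c * d) := by
  refine ⟨fun i => ?_, fun i x => ?_, fun f hf => ?_⟩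
  · exact ((he.aesm i.1).comp_fst).mul ((hg.aesm i.2).comp_snd)
  · rw [norm_mul]
    exact mul_le_one₀ (he.bound _ _) (norm_nonneg _) (hg.bound _ _)
  have hfm := hf.1
  have hsq : AEMeasurable (fun x => ‖f x‖ₑ ^ 2) (ν.prod η) := hfm.enorm.pow_const 2
  have hfin := (memLp_two_iff_lintegral.1 hf).2
  have htot : ∫⁻ x, ‖f x‖ₑ ^ 2 ∂(ν.prod η) = ∫⁻ x, ∫⁻ y, ‖f (x, y)‖ₑ ^ 2 ∂η ∂ν :=
    lintegral_prod _ hsq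
  have hslice : ∀ᵐ x ∂ν, MemLp (fun y => f (x, y)) 2 η := by
    rw [htot] at hfin
    filter_upwards [hfm.prodMk_left, ae_lt_top' hsq.lintegral_prod_right' hfin.ne] with x h1 h2
    exact memLp_two_iff_lintegral.2 ⟨h1, h2⟩
  set F : κ → X → ℂ := fun j x => ∫ y, f (x, y) * conj (g j y) ∂η with hF
  have hFm : ∀ j, AEStronglyMeasurable (F j) ν := fun j =>
    (hfm.mul (aesm_conj (hg.aesm j).comp_snd)).integral_prod_right'
  have hFsum : ∀ᵐ x ∂ν, ∑' j, ‖F j x‖ₑ ^ 2 = d * ∫⁻ y, ‖f (x, y)‖ₑ ^ 2 ∂η := by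
    filter_upwards [hslice] with x hx using hg.parseval _ hx
  have hFL : ∀ j, MemLp (F j) 2 ν := fun j => by
    refine memLp_two_iff_lintegral.2 ⟨hFm j, ?_⟩
    calc ∫⁻ x, ‖F j x‖ₑ ^ 2 ∂ν ≤ ∫⁻ x, d * ∫⁻ y, ‖f (x, y)‖ₑ ^ 2 ∂η ∂ν := by
          refine lintegral_mono_ae ?_
          filter_upwards [hFsum] with x hx
          rw [← hx]
          exact ENNReal.le_tsum j
      _ = d * ∫⁻ x, ∫⁻ y, ‖f (x, y)‖ₑ ^ 2 ∂η ∂ν := lintegral_const_mul' _ _ hd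
      _ < ∞ := by
          rw [← htot]
          exact ENNReal.mul_lt_top hd.lt_top hfin
  have hcoef : ∀ i j, ∫ x, f x * conj (e i x.1 * g j x.2) ∂(ν.prod η)
      = ∫ x, F j x * conj (e i x) ∂ν := by
    intro i j
    have hint : Integrable (fun x : X × Y => f x * conj (e i x.1 * g j x.2)) (ν.prod η) := by
      have h1 : Integrable f (ν.prod η) := hf.integrable (by norm_num)
      refine h1.mul_bdd (c := 1) ?_ ?_
      · exact aesm_conj (((he.aesm i).comp_fst).mul ((hg.aesm j).comp_snd))
      · refine Filter.Eventually.of_forall fun x => ?_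
        rw [RCLike.norm_conj, norm_mul]
        exact mul_le_one₀ (he.bound _ _) (norm_nonneg _) (hg.bound _ _)
    rw [integral_prod _ hint]
    refine integral_congr_ae (Filter.Eventually.of_forall fun x => ?_)
    simp only [hF, map_mul]
    rw [← integral_mul_const]
    congr 1
    ext y
    ring
  calc ∑' i : ι × κ, ‖∫ x, f x * conj (e i.1 x.1 * g i.2 x.2) ∂(ν.prod η)‖ₑ ^ 2
      = ∑' i : ι × κ, ‖∫ x, F i.2 x * conj (e i.1 x) ∂ν‖ₑ ^ 2 := by simp_rw [hcoef]
    _ = ∑' (i : ι) (j : κ), ‖∫ x, F j x * conj (e i x) ∂ν‖ₑ ^ 2 :=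
        ENNReal.tsum_prod (f := fun i j => ‖∫ x, F j x * conj (e i x) ∂ν‖ₑ ^ 2)
    _ = ∑' (j : κ) (i : ι), ‖∫ x, F j x * conj (e i x) ∂ν‖ₑ ^ 2 := ENNReal.tsum_comm
    _ = ∑' j : κ, c * ∫⁻ x, ‖F j x‖ₑ ^ 2 ∂ν := by
        congr 1
        ext j
        exact he.parseval _ (hFL j)
    _ = c * ∫⁻ x, ∑' j : κ, ‖F j x‖ₑ ^ 2 ∂ν := by
        rw [ENNReal.tsum_mul_left, lintegral_tsum fun j => (hFm j).enorm.pow_const 2]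
    _ = c * d * ∫⁻ x, ‖f x‖ₑ ^ 2 ∂(ν.prod η) := by
        rw [lintegral_congr_ae hFsum, lintegral_const_mul' _ _ hd, htot, mul_assoc]

/-- The exponentials `exp(i (θ + 2πk/T) x)` are a Parseval frame on every interval of
length `T`. -/
theorem parsevalFrame_exp (θ a T : ℝ) (hT : 0 < T) :
    ParsevalFrame (volume.restrict (Set.Ioo a (a + T)))
      (fun (k : ℤ) (x : ℝ) => Complex.exp (Complex.I * (((θ + 2 * Real.pi * k / T) * x : ℝ) : ℂ)))
      (ENNReal.ofReal T) := by
  have hcont : ∀ k : ℤ, Continuous (fun (x : ℝ) =>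
      Complex.exp (Complex.I * (((θ + 2 * Real.pi * k / T) * x : ℝ) : ℂ))) := fun k => by fun_prop
  refine ⟨fun k => (hcont k).aestronglyMeasurable, fun k x => ?_, fun f hf => ?_⟩
  · rw [mul_comm, Complex.norm_exp_ofReal_mul_I]
  set F : ℝ → ℂ := fun x => f x * Complex.exp (-(Complex.I * ((θ * x : ℝ) : ℂ))) with hF
  have hn : ∀ x, ‖F x‖ = ‖f x‖ := fun x => by
    have : -(Complex.I * ((θ * x : ℝ) : ℂ)) = ((-(θ * x) : ℝ) : ℂ) * Complex.I := by
      push_cast; ring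
    rw [hF]
    simp only [norm_mul]
    rw [this, Complex.norm_exp_ofReal_mul_I, mul_one]
  rw [Measure.restrict_congr_set (Ioo_ae_eq_Ioc (μ := volume) (a := a) (b := a + T))] at hf ⊢
  have hab : a < a + T := by linarith
  have hFL : MemLp F 2 (volume.restrict (Set.Ioc a (a + T))) := by
    refine hf.of_le ?_ (Filter.Eventually.of_forall fun x => (hn x).le)
    have : Continuous (fun x : ℝ => Complex.exp (-(Complex.I * ((θ * x : ℝ) : ℂ)))) := by fun_prop
    exact hf.1.mul this.aestronglyMeasurable
  have key := hasSum_sq_fourierCoeffOn hab hFL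
  have hcoef : ∀ k : ℤ, ∫ x in Set.Ioc a (a + T), f x * conj (Complex.exp (Complex.I *
      (((θ + 2 * Real.pi * k / T) * x : ℝ) : ℂ))) = (T : ℂ) * fourierCoeffOn hab F k := by
    intro k
    rw [fourierCoeffOn_eq_integral, intervalIntegral.integral_of_le hab.le]
    have hT' : (T : ℂ) ≠ 0 := by exact_mod_cast hT.ne'
    rw [add_sub_cancel_left, Complex.real_smul, ← mul_assoc]
    have : (T : ℂ) * ((1 / T : ℝ) : ℂ) = 1 := by push_cast; field_simp
    rw [this, one_mul]
    refine integral_congr_ae (Filter.Eventually.of_forall fun x => ?_)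
    simp only [fourier_coe_apply, hF, smul_eq_mul]
    rw [← Complex.exp_conj, mul_left_comm, ← Complex.exp_add]
    congr 2
    simp only [map_mul, Complex.conj_I, Complex.conj_ofReal]
    push_cast
    field_simp
    ring
  have hsq : ∫⁻ x in Set.Ioc a (a + T), ‖f x‖ₑ ^ 2 =
      ENNReal.ofReal (∫ x in a..(a + T), ‖F x‖ ^ 2) := by
    rw [intervalIntegral.integral_of_le hab.le, ofReal_integral_eq_lintegral_ofReal]
    · refine lintegral_congr fun x => ?_
      rw [hn, ENNReal.ofReal_pow (norm_nonneg _), ofReal_norm]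
    · simpa using hFL.integrable_norm_pow (by norm_num)
    · exact Filter.Eventually.of_forall fun x => by positivity
  have key2 := key.mul_left (T ^ 2)
  rw [hsq]
  have e1 : ∀ k : ℤ, ‖∫ x in Set.Ioc a (a + T), f x * conj (Complex.exp (Complex.I *
      (((θ + 2 * Real.pi * k / T) * x : ℝ) : ℂ)))‖ₑ ^ 2
      = ENNReal.ofReal (T ^ 2 * ‖fourierCoeffOn hab F k‖ ^ 2) := fun k => by
    rw [hcoef, ← ofReal_norm, ← ENNReal.ofReal_pow (norm_nonneg _), norm_mul, mul_pow,
      Complex.norm_real, Real.norm_of_nonneg hT.le]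
  simp_rw [e1]
  rw [← ENNReal.ofReal_tsum_of_nonneg (fun k => by positivity) key2.summable, key2.tsum_eq,
    ← ENNReal.ofReal_mul hT.le]
  congr 1
  rw [add_sub_cancel_left, smul_eq_mul]
  field_simp

/-- Parseval's identity in terms of real sums and integrals. -/
theorem ParsevalFrame.hasSum {X ι : Type*} [MeasurableSpace X] {ν : Measure X} {e : ι → X → ℂ}
    {c : ℝ} (h : ParsevalFrame ν e (ENNReal.ofReal c)) (hc : 0 ≤ c) {f : X → ℂ}
    (hf : MemLp f 2 ν) :
    HasSum (fun i => ‖∫ x, f x * conj (e i x) ∂ν‖ ^ 2) (c * ∫ x, ‖f x‖ ^ 2 ∂ν) := by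
  have hp := h.parseval f hf
  have hsq : ∫⁻ x, ‖f x‖ₑ ^ 2 ∂ν = ENNReal.ofReal (∫ x, ‖f x‖ ^ 2 ∂ν) := by
    rw [ofReal_integral_eq_lintegral_ofReal]
    · refine lintegral_congr fun x => ?_
      rw [ENNReal.ofReal_pow (norm_nonneg _), ofReal_norm]
    · simpa using hf.integrable_norm_pow (by norm_num)
    · exact Filter.Eventually.of_forall fun x => by positivity
  have e1 : ∀ i, ‖∫ x, f x * conj (e i x) ∂ν‖ₑ ^ 2
      = ENNReal.ofReal (‖∫ x, f x * conj (e i x) ∂ν‖ ^ 2) := fun i => by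
    rw [← ofReal_norm, ← ENNReal.ofReal_pow (norm_nonneg _)]
  have hI : 0 ≤ ∫ x, ‖f x‖ ^ 2 ∂ν := integral_nonneg fun x => by positivity
  simp_rw [e1] at hp
  rw [hsq, ← ENNReal.ofReal_mul hc] at hp
  have hs : Summable (fun i => ‖∫ x, f x * conj (e i x) ∂ν‖ ^ 2) := by
    have := ENNReal.summable_toReal (f := fun i => ENNReal.ofReal (‖∫ x, f x * conj (e i x) ∂ν‖ ^ 2))
      (by rw [hp]; exact ENNReal.ofReal_ne_top)
    refine this.congr fun i => ?_
    rw [ENNReal.toReal_ofReal (by positivity)]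
  rw [← ENNReal.ofReal_tsum_of_nonneg (fun i => by positivity) hs] at hp
  have := (ENNReal.ofReal_eq_ofReal_iff (tsum_nonneg fun i => by positivity) (by positivity)).1 hp
  rw [← this]
  exact hs.hasSum

/-! ### One Fourier mode of the layer problem -/

/-- Amplitude vectors in `ℂ³` with the Hermitian norm. -/
abbrev Amp : Type := EuclideanSpace ℂ (Fin 3)

/-- The vector `(x, y, z) ∈ ℂ³`. -/
def amp (x y z : ℂ) : Amp := WithLp.toLp 2 ![x, y, z]

/-- The bilinear product `k · p` on `ℂ³`. -/
def bdot (k p : Amp) : ℂ := ∑ i, k i * p i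

lemma norm_bdot_le (k p : Amp) : ‖bdot k p‖ ≤ ‖k‖ * ‖p‖ := by
  have h : bdot k p = inner ℂ (WithLp.toLp 2 (fun i => conj (k i)) : Amp) p := by
    simp [bdot, PiLp.inner_apply, mul_comm]
  have h2 : ‖(WithLp.toLp 2 (fun i => conj (k i)) : Amp)‖ = ‖k‖ := by
    simp [EuclideanSpace.norm_eq]
  rw [h, ← h2]
  exact norm_inner_le_norm _ _

lemma norm_amp_sq (x y z : ℂ) : ‖amp x y z‖ ^ 2 = ‖x‖ ^ 2 + ‖y‖ ^ 2 + ‖z‖ ^ 2 := by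
  rw [EuclideanSpace.norm_sq_eq]
  simp [amp, Fin.sum_univ_three]

/-- The map `p ↦ b p + c (k·p) k'`. Both the propagation of a mode through the layer and its
traction have this shape. -/
def rankOneUpdate (b c : ℂ) (k k' : Amp) : Amp →ₗ[ℂ] Amp where
  toFun p := b • p + (c * bdot k p) • k'
  map_add' p p' := by
    have : bdot k (p + p') = bdot k p + bdot k p' := by
      simp [bdot, mul_add, Finset.sum_add_distrib]
    rw [this, smul_add, mul_add, add_smul]
    abel
  map_smul' r p := by
    have : bdot k (r • p) = r * bdot k p := by
      simp only [bdot, PiLp.smul_apply, smul_eq_mul, Finset.mul_sum]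
      exact Finset.sum_congr rfl fun i _ => by ring
    rw [this, RingHom.id_apply, smul_add, smul_smul, smul_smul, smul_smul]
    congr 2 <;> ring

lemma rankOneUpdate_apply (b c : ℂ) (k k' p : Amp) :
    rankOneUpdate b c k k' p = b • p + (c * bdot k p) • k' := rfl

lemma norm_rankOneUpdate_le {b c : ℂ} {k k' : Amp} {B C κ : ℝ} (hb : ‖b‖ ≤ B) (hc : ‖c‖ ≤ C)
    (hk : ‖k‖ ^ 2 ≤ κ) (hk' : ‖k'‖ ^ 2 ≤ κ) (p : Amp) :
    ‖rankOneUpdate b c k k' p‖ ≤ (B + C * κ) * ‖p‖ := by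
  have hC : 0 ≤ C := (norm_nonneg c).trans hc
  have hkk : ‖k‖ * ‖k'‖ ≤ κ := by nlinarith [sq_nonneg (‖k‖ - ‖k'‖)]
  rw [rankOneUpdate_apply]
  calc ‖b • p + (c * bdot k p) • k'‖ ≤ ‖b‖ * ‖p‖ + ‖c‖ * ‖bdot k p‖ * ‖k'‖ := by
        refine (norm_add_le _ _).trans ?_
        rw [norm_smul, norm_smul, norm_mul]
    _ ≤ B * ‖p‖ + C * (‖k‖ * ‖p‖) * ‖k'‖ := by
        gcongr
        exact norm_bdot_le k p
    _ = B * ‖p‖ + C * (‖k‖ * ‖k'‖) * ‖p‖ := by ring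
    _ ≤ B * ‖p‖ + C * κ * ‖p‖ := by gcongr
    _ = (B + C * κ) * ‖p‖ := by ring

/-- Reflection at the bottom of the layer, in abstract form: if the up-going amplitude `p` and the
down-going amplitude `q` satisfy `p + F₋ q = v` and `F₊ p + q = 0` with contractive propagators,
then the traction `T₊ p + T₋ F₋ q` is close to the traction `T₊ v` of the purely up-going wave. -/
lemma layer_perturbation {Fp Fm Tp Tm : Amp →ₗ[ℂ] Amp} {f t : ℝ} (hf0 : 0 ≤ f) (hf1 : f ^ 2 < 1)
    (ht : 0 ≤ t) (hFp : ∀ p, ‖Fp p‖ ≤ f * ‖p‖) (hFm : ∀ p, ‖Fm p‖ ≤ f * ‖p‖)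
    (hTp : ∀ p, ‖Tp p‖ ≤ t * ‖p‖) (hTm : ∀ p, ‖Tm p‖ ≤ t * ‖p‖) {p q v : Amp}
    (h1 : p + Fm q = v) (h2 : Fp p + q = 0) :
    ‖Tp p + Tm (Fm q) - Tp v‖ ≤ 2 * t * f ^ 2 / (1 - f ^ 2) * ‖v‖ ∧
      ‖p‖ ≤ ‖v‖ / (1 - f ^ 2) := by
  have hq : ‖q‖ ≤ f * ‖p‖ := by
    have : q = -Fp p := by rw [eq_neg_iff_add_eq_zero, add_comm]; exact h2
    rw [this, norm_neg]
    exact hFp p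
  have hFq : ‖Fm q‖ ≤ f ^ 2 * ‖p‖ := (hFm q).trans (by
    calc f * ‖q‖ ≤ f * (f * ‖p‖) := by gcongr
      _ = f ^ 2 * ‖p‖ := by ring)
  have hpos : 0 < 1 - f ^ 2 := by linarith
  have hp : ‖p‖ ≤ ‖v‖ / (1 - f ^ 2) := by
    rw [le_div_iff₀ hpos]
    have : p = v - Fm q := by rw [← h1]; abel
    have h3 : ‖p‖ ≤ ‖v‖ + ‖Fm q‖ := by
      conv_lhs => rw [this]
      exact norm_sub_le _ _
    nlinarith
  refine ⟨?_, hp⟩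
  have h4 : Tp p + Tm (Fm q) - Tp v = Tm (Fm q) - Tp (Fm q) := by
    rw [← h1, map_add]; abel
  rw [h4]
  calc ‖Tm (Fm q) - Tp (Fm q)‖ ≤ t * ‖Fm q‖ + t * ‖Fm q‖ :=
        (norm_sub_le _ _).trans (add_le_add (hTm _) (hTp _))
    _ = 2 * t * ‖Fm q‖ := by ring
    _ ≤ 2 * t * (f ^ 2 * (‖v‖ / (1 - f ^ 2))) := by
        gcongr
        exact hFq.trans (by gcongr)
    _ = 2 * t * f ^ 2 / (1 - f ^ 2) * ‖v‖ := by ring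

namespace Scattering

variable (P : Scattering)

/-- Size conditions on one Fourier mode: `A` bounds the wave numbers, `ε` the decay factors
`exp(i βⱼ ζ)` across the layer, and `s` the reflection coefficient. -/
structure ModeBounds (ζ : ℂ) (n : ℤ × ℤ) (A ε s : ℝ) : Prop where
  A_nonneg : 0 ≤ A
  α_le : P.αabs n ^ 2 ≤ A ^ 2
  β₁_le : ‖P.β₁ n‖ ≤ A
  β₂_le : ‖P.β₂ n‖ ≤ A
  χ_pos : 0 < ‖P.χ n‖
  ε_pos : 0 < ε
  e₁_le : ‖Complex.exp (Complex.I * P.β₁ n * ζ)‖ ≤ ε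
  e₂_le : ‖Complex.exp (Complex.I * P.β₂ n * ζ)‖ ≤ ε
  ε_lt : ε < 1
  refl_le : 6 * A ^ 2 * ε / ‖P.χ n‖ ≤ s
  s_lt : s ^ 2 < 1
  κ_ne : (P.αn₁ n : ℂ) ^ 2 + (P.αn₂ n : ℂ) ^ 2 + P.β₂ n ^ 2 ≠ 0

lemma αabs_sq (n : ℤ × ℤ) : P.αabs n ^ 2 = P.αn₁ n ^ 2 + P.αn₂ n ^ 2 :=
  Real.sq_sqrt (by positivity)

/-- The wave vector `(α₁⁽ⁿ⁾, α₂⁽ⁿ⁾, b)`. -/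
def wave (n : ℤ × ℤ) (b : ℂ) : Amp := amp (P.αn₁ n) (P.αn₂ n) b

lemma χ_eq (n : ℤ × ℤ) :
    P.χ n = (P.αn₁ n : ℂ) ^ 2 + (P.αn₂ n : ℂ) ^ 2 + P.β₁ n * P.β₂ n := by
  have := congrArg (fun x : ℝ => (x : ℂ)) (P.αabs_sq n)
  push_cast at this
  rw [χ, this]

/-- Traction of the up-going field with value `p` on `Γ_h`, up to the factor `μ`. -/
def tractionUp (n : ℤ × ℤ) : Amp →ₗ[ℂ] Amp :=
  rankOneUpdate (-P.β₂ n) ((P.β₂ n - P.β₁ n) / P.χ n) (P.wave n (P.β₂ n)) (P.wave n (-P.β₂ n))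

/-- Traction of the down-going field with value `p` on `Γ_h`, up to the factor `μ`. -/
def tractionDown (n : ℤ × ℤ) : Amp →ₗ[ℂ] Amp :=
  rankOneUpdate (P.β₂ n) ((P.β₁ n - P.β₂ n) / P.χ n) (P.wave n (-P.β₂ n)) (P.wave n (P.β₂ n))

/-- The value at the bottom of the layer of the up-going field with value `p` on `Γ_h`. The
compressional part of `p` is its oblique projection `((k₂⁺·p)/χ) k₁⁺`. -/
def propagateUp (ζ : ℂ) (n : ℤ × ℤ) : Amp →ₗ[ℂ] Amp :=
  rankOneUpdate (Complex.exp (Complex.I * P.β₂ n * ζ))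
    ((Complex.exp (Complex.I * P.β₁ n * ζ) - Complex.exp (Complex.I * P.β₂ n * ζ)) / P.χ n)
    (P.wave n (P.β₂ n)) (P.wave n (P.β₁ n))

/-- The value on `Γ_h` of the down-going field with value `p` at the bottom of the layer. -/
def propagateDown (ζ : ℂ) (n : ℤ × ℤ) : Amp →ₗ[ℂ] Amp :=
  rankOneUpdate (Complex.exp (Complex.I * P.β₂ n * ζ))
    ((Complex.exp (Complex.I * P.β₁ n * ζ) - Complex.exp (Complex.I * P.β₂ n * ζ)) / P.χ n)
    (P.wave n (-P.β₂ n)) (P.wave n (-P.β₁ n))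

/-- The up-going amplitude `A k₁⁺ + k₂⁺ × C` on `Γ_h` of a coefficient vector
`X = (A, B, C₁, D₁, C₂, D₂, C₃, D₃)`. -/
def upAmp (n : ℤ × ℤ) (X : Fin 8 → ℂ) : Amp :=
  amp (P.αn₁ n * X 0 - P.β₂ n * X 4 + P.αn₂ n * X 6)
    (P.αn₂ n * X 0 + P.β₂ n * X 2 - P.αn₁ n * X 6)
    (P.β₁ n * X 0 - P.αn₂ n * X 2 + P.αn₁ n * X 4)

/-- The down-going amplitude, `B k₁⁻ + k₂⁻ × D` continued to the bottom of the layer. -/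
def downAmp (ζ : ℂ) (n : ℤ × ℤ) (X : Fin 8 → ℂ) : Amp :=
  amp (P.αn₁ n * (Complex.exp (-(Complex.I * P.β₁ n * ζ)) * X 1)
      + Complex.exp (-(Complex.I * P.β₂ n * ζ)) * (P.β₂ n * X 5 + P.αn₂ n * X 7))
    (P.αn₂ n * (Complex.exp (-(Complex.I * P.β₁ n * ζ)) * X 1)
      + Complex.exp (-(Complex.I * P.β₂ n * ζ)) * (-(P.β₂ n * X 3) - P.αn₁ n * X 7))
    (-(P.β₁ n * (Complex.exp (-(Complex.I * P.β₁ n * ζ)) * X 1))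
      + Complex.exp (-(Complex.I * P.β₂ n * ζ)) * (-(P.αn₂ n * X 3) + P.αn₁ n * X 5))

lemma amp_ext {p : Amp} {x y z : ℂ} (h0 : p 0 = x) (h1 : p 1 = y) (h2 : p 2 = z) :
    p = amp x y z := by
  ext i
  fin_cases i <;> simp [amp, h0, h1, h2]

@[simp] lemma amp_zero (x y z : ℂ) : amp x y z 0 = x := rfl
@[simp] lemma amp_one (x y z : ℂ) : amp x y z 1 = y := rfl
@[simp] lemma amp_two (x y z : ℂ) : amp x y z 2 = z := rfl

lemma bdot_wave_upAmp (n : ℤ × ℤ) (X : Fin 8 → ℂ) :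
    bdot (P.wave n (P.β₂ n)) (P.upAmp n X) = P.χ n * X 0 := by
  simp only [bdot, Fin.sum_univ_three, wave, upAmp, amp_zero, amp_one, amp_two, χ_eq]
  ring

lemma bdot_wave_downAmp (ζ : ℂ) (n : ℤ × ℤ) (X : Fin 8 → ℂ) :
    bdot (P.wave n (-P.β₂ n)) (P.downAmp ζ n X) =
      P.χ n * (Complex.exp (-(Complex.I * P.β₁ n * ζ)) * X 1) := by
  simp only [bdot, Fin.sum_univ_three, wave, downAmp, amp_zero, amp_one, amp_two, χ_eq]
  ring

lemma propagateUp_upAmp {ζ : ℂ} {n : ℤ × ℤ} (hχ : P.χ n ≠ 0) (X : Fin 8 → ℂ) :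
    P.propagateUp ζ n (P.upAmp n X) = amp
      (P.αn₁ n * (Complex.exp (Complex.I * P.β₁ n * ζ) * X 0)
        + Complex.exp (Complex.I * P.β₂ n * ζ) * (-(P.β₂ n * X 4) + P.αn₂ n * X 6))
      (P.αn₂ n * (Complex.exp (Complex.I * P.β₁ n * ζ) * X 0)
        + Complex.exp (Complex.I * P.β₂ n * ζ) * (P.β₂ n * X 2 - P.αn₁ n * X 6))
      (P.β₁ n * (Complex.exp (Complex.I * P.β₁ n * ζ) * X 0)
        + Complex.exp (Complex.I * P.β₂ n * ζ) * (-(P.αn₂ n * X 2) + P.αn₁ n * X 4)) := by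
  rw [propagateUp, rankOneUpdate_apply, bdot_wave_upAmp, ← mul_assoc, div_mul_cancel₀ _ hχ]
  refine amp_ext ?_ ?_ ?_ <;>
    simp only [PiLp.add_apply, PiLp.smul_apply, smul_eq_mul, wave, upAmp, amp_zero, amp_one,
      amp_two] <;> ring

lemma propagateDown_downAmp {ζ : ℂ} {n : ℤ × ℤ} (hχ : P.χ n ≠ 0) (X : Fin 8 → ℂ) :
    P.propagateDown ζ n (P.downAmp ζ n X) = amp
      (P.αn₁ n * X 1 + (P.β₂ n * X 5 + P.αn₂ n * X 7))
      (P.αn₂ n * X 1 + (-(P.β₂ n * X 3) - P.αn₁ n * X 7))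
      (-(P.β₁ n * X 1) + (-(P.αn₂ n * X 3) + P.αn₁ n * X 5)) := by
  have h1 : Complex.exp (Complex.I * P.β₁ n * ζ) * Complex.exp (-(Complex.I * P.β₁ n * ζ)) = 1 := by
    rw [← Complex.exp_add, add_neg_cancel, Complex.exp_zero]
  have h2 : Complex.exp (Complex.I * P.β₂ n * ζ) * Complex.exp (-(Complex.I * P.β₂ n * ζ)) = 1 := by
    rw [← Complex.exp_add, add_neg_cancel, Complex.exp_zero]
  rw [propagateDown, rankOneUpdate_apply, bdot_wave_downAmp, ← mul_assoc, div_mul_cancel₀ _ hχ]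
  refine amp_ext ?_ ?_ ?_ <;>
    simp only [PiLp.add_apply, PiLp.smul_apply, smul_eq_mul, wave, downAmp, amp_zero, amp_one,
      amp_two]
  · linear_combination (P.αn₁ n * X 1) * h1 + (P.β₂ n * X 5 + P.αn₂ n * X 7) * h2
  · linear_combination (P.αn₂ n * X 1) * h1 + (-(P.β₂ n * X 3) - P.αn₁ n * X 7) * h2
  · linear_combination (-(P.β₁ n * X 1)) * h1 + (-(P.αn₂ n * X 3) + P.αn₁ n * X 5) * h2

/-- The layer system in terms of up- and down-going amplitudes. -/
lemma layer_system {ζ : ℂ} {n : ℤ × ℤ} (hχ : P.χ n ≠ 0) {X : Fin 8 → ℂ} {w : Fin 3 → ℂ}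
    (hX : (P.layerMatrix ζ n).mulVec X = layerRhs.mulVec w) :
    P.upAmp n X + P.propagateDown ζ n (P.downAmp ζ n X) = (-Complex.I) • WithLp.toLp 2 w ∧
      P.propagateUp ζ n (P.upAmp n X) + P.downAmp ζ n X = 0 ∧
      (P.αn₁ n * X 2 + P.αn₂ n * X 4 + P.β₂ n * X 6) +
        (P.αn₁ n * X 3 + P.αn₂ n * X 5 - P.β₂ n * X 7) = 0 ∧
      Complex.exp (Complex.I * P.β₂ n * ζ) * (P.αn₁ n * X 2 + P.αn₂ n * X 4 + P.β₂ n * X 6) +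
        Complex.exp (-(Complex.I * P.β₂ n * ζ)) *
          (P.αn₁ n * X 3 + P.αn₂ n * X 5 - P.β₂ n * X 7) = 0 := by
  have E := fun i => congrFun hX i
  have E0 := E 0
  have E1 := E 1
  have E2 := E 2
  have E3 := E 3
  have E4 := E 4
  have E5 := E 5
  have E6 := E 6
  have E7 := E 7
  simp [layerMatrix, layerRhs, Matrix.mulVec, dotProduct, Fin.sum_univ_eight,
    Fin.sum_univ_three] at E0 E1 E2 E3 E4 E5 E6 E7
  rw [propagateUp_upAmp P hχ, propagateDown_downAmp P hχ]
  refine ⟨?_, ?_, ?_, ?_⟩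
  · ext i
    fin_cases i <;>
      simp only [PiLp.add_apply, PiLp.smul_apply, smul_eq_mul, upAmp, amp_zero, amp_one,
        amp_two, Fin.mk_one, Fin.zero_eta, Fin.reduceFinMk]
    · linear_combination E0
    · linear_combination E1
    · linear_combination E2
  · ext i
    fin_cases i <;>
      simp only [PiLp.add_apply, downAmp, amp_zero, amp_one, PiLp.zero_apply,
        amp_two, Fin.mk_one, Fin.zero_eta, Fin.reduceFinMk]
    · linear_combination E3
    · linear_combination E4
    · linear_combination E5
  · linear_combination E6
  · linear_combination E7

lemma layerTraction_mulVec {ζ : ℂ} {n : ℤ × ℤ} (hχ : P.χ n ≠ 0) (X : Fin 8 → ℂ) :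
    WithLp.toLp 2 ((P.layerTraction n).mulVec X) = P.tractionUp n (P.upAmp n X) +
      P.tractionDown n (P.propagateDown ζ n (P.downAmp ζ n X)) := by
  have hb : bdot (P.wave n (-P.β₂ n)) (P.propagateDown ζ n (P.downAmp ζ n X)) = P.χ n * X 1 := by
    rw [propagateDown_downAmp P hχ]
    simp only [bdot, Fin.sum_univ_three, wave, amp_zero, amp_one, amp_two, χ_eq]
    ring
  rw [tractionUp, tractionDown, rankOneUpdate_apply, rankOneUpdate_apply, bdot_wave_upAmp, hb,
    ← mul_assoc, div_mul_cancel₀ _ hχ, ← mul_assoc, div_mul_cancel₀ _ hχ,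
    propagateDown_downAmp P hχ]
  ext i
  fin_cases i <;>
    simp [layerTraction, Matrix.mulVec, dotProduct, Fin.sum_univ_eight, upAmp, wave] <;> ring

lemma κ₁_pos : 0 < P.κ₁ := by
  have := P.μ_pos
  have := P.lam_add_μ_pos
  exact div_pos P.ω_pos (Real.sqrt_pos.2 (by linarith))

lemma κ₂_pos : 0 < P.κ₂ := div_pos P.ω_pos (Real.sqrt_pos.2 P.μ_pos)

lemma αabs_nonneg (n : ℤ × ℤ) : 0 ≤ P.αabs n := Real.sqrt_nonneg _

lemma β_sq {κ : ℝ} (hκ : 0 ≤ κ) (n : ℤ × ℤ) :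
    P.β κ n ^ 2 = (κ : ℂ) ^ 2 - (P.αn₁ n : ℂ) ^ 2 - (P.αn₂ n : ℂ) ^ 2 := by
  have h1 : (P.αabs n : ℂ) ^ 2 = (P.αn₁ n : ℂ) ^ 2 + (P.αn₂ n : ℂ) ^ 2 := by
    exact_mod_cast P.αabs_sq n
  have h0 := P.αabs_nonneg n
  rw [sub_sub, ← h1]
  unfold β
  split_ifs with h
  · have := Real.sq_sqrt (show 0 ≤ κ ^ 2 - P.αabs n ^ 2 by nlinarith)
    exact_mod_cast this
  · have := Real.sq_sqrt (show 0 ≤ P.αabs n ^ 2 - κ ^ 2 by nlinarith [not_lt.1 h])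
    have h2 : (Real.sqrt (P.αabs n ^ 2 - κ ^ 2) : ℂ) ^ 2 = (P.αabs n : ℂ) ^ 2 - (κ : ℂ) ^ 2 := by
      exact_mod_cast this
    rw [mul_pow, Complex.I_sq, h2]
    ring

lemma M_mulVec {n : ℤ × ℤ} (hχ : P.χ n ≠ 0) (w : Fin 3 → ℂ) :
    WithLp.toLp 2 ((P.M n).mulVec w) =
      (P.μ : ℂ) • P.tractionUp n ((-Complex.I) • WithLp.toLp 2 w) := by
  have hx := P.χ_eq n
  have hκ : P.β₂ n ^ 2 = _ := P.β_sq P.κ₂_pos.le n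
  rw [tractionUp, map_smul, rankOneUpdate_apply]
  ext i
  fin_cases i <;>
    simp [M, Matrix.mulVec, dotProduct, Fin.sum_univ_three, wave, bdot] <;> field_simp
  · ring
  · ring
  · linear_combination (-(P.μ : ℂ) * P.β₂ n * w 2) * hκ + (-(P.μ : ℂ) * P.β₂ n * w 2) * hx

variable {P} in
lemma ModeBounds.χ_le {ζ : ℂ} {n : ℤ × ℤ} {A ε s : ℝ} (h : P.ModeBounds ζ n A ε s) :
    ‖P.χ n‖ ≤ 2 * A ^ 2 := by
  have := h.A_nonneg
  unfold χ
  refine (norm_add_le _ _).trans ?_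
  rw [norm_mul, norm_pow, Complex.norm_real, Real.norm_of_nonneg (P.αabs_nonneg n)]
  have := mul_le_mul h.β₁_le h.β₂_le (norm_nonneg _) h.A_nonneg
  nlinarith [h.α_le]

variable {P} in
lemma ModeBounds.wave_le {ζ : ℂ} {n : ℤ × ℤ} {A ε s : ℝ} (h : P.ModeBounds ζ n A ε s) {b : ℂ}
    (hb : ‖b‖ ≤ A) : ‖P.wave n b‖ ^ 2 ≤ 2 * A ^ 2 := by
  rw [wave, norm_amp_sq, Complex.norm_real, Complex.norm_real, Real.norm_eq_abs, Real.norm_eq_abs,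
    sq_abs, sq_abs, ← P.αabs_sq]
  nlinarith [h.α_le, norm_nonneg b]

variable {P} in
/-- Bound for the propagators and the traction operators of one mode. -/
lemma ModeBounds.norm_rankOneUpdate_le {ζ : ℂ} {n : ℤ × ℤ} {A ε s : ℝ}
    (h : P.ModeBounds ζ n A ε s) {b c b' b'' : ℂ} {B : ℝ} (hB : 0 ≤ B) (hb : ‖b‖ ≤ B)
    (hc : ‖c‖ ≤ 2 * B) (hb' : ‖b'‖ ≤ A) (hb'' : ‖b''‖ ≤ A) (p : Amp) :
    ‖rankOneUpdate b (c / P.χ n) (P.wave n b') (P.wave n b'') p‖ ≤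
      6 * A ^ 2 * B / ‖P.χ n‖ * ‖p‖ := by
  have hχ := h.χ_pos
  have hle := h.χ_le
  refine (ElasticGrating.norm_rankOneUpdate_le (B := B) (C := 2 * B / ‖P.χ n‖) hb ?_
    (h.wave_le hb') (h.wave_le hb'') p).trans ?_
  · rw [norm_div]
    gcongr
  · gcongr
    rw [div_mul_eq_mul_div, ← sub_nonneg]
    have : 6 * A ^ 2 * B / ‖P.χ n‖ - (B + 2 * B * (2 * A ^ 2) / ‖P.χ n‖) =
        B * (2 * A ^ 2 - ‖P.χ n‖) / ‖P.χ n‖ := by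
      field_simp
      ring
    rw [this]
    exact div_nonneg (mul_nonneg hB (by linarith)) hχ.le

section Bounds

variable {P} {ζ : ℂ} {n : ℤ × ℤ} {A ε s : ℝ} (h : P.ModeBounds ζ n A ε s)

include h

lemma ModeBounds.s_nonneg : 0 ≤ s := by
  refine le_trans ?_ h.refl_le
  have := h.χ_pos
  have := h.ε_pos
  positivity

lemma ModeBounds.propagateUp_le (p : Amp) : ‖P.propagateUp ζ n p‖ ≤ s * ‖p‖ := by
  refine (h.norm_rankOneUpdate_le h.ε_pos.le h.e₂_le ?_ h.β₂_le h.β₁_le p).trans ?_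
  · exact (norm_sub_le _ _).trans (by linarith [h.e₁_le, h.e₂_le])
  · gcongr
    exact h.refl_le

lemma ModeBounds.propagateDown_le (p : Amp) : ‖P.propagateDown ζ n p‖ ≤ s * ‖p‖ := by
  refine (h.norm_rankOneUpdate_le h.ε_pos.le h.e₂_le ?_ (by rw [norm_neg]; exact h.β₂_le)
    (by rw [norm_neg]; exact h.β₁_le) p).trans ?_
  · exact (norm_sub_le _ _).trans (by linarith [h.e₁_le, h.e₂_le])
  · gcongr
    exact h.refl_le

lemma ModeBounds.tractionUp_le (p : Amp) :
    ‖P.tractionUp n p‖ ≤ 6 * A ^ 2 * A / ‖P.χ n‖ * ‖p‖ := by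
  refine h.norm_rankOneUpdate_le h.A_nonneg (by rw [norm_neg]; exact h.β₂_le) ?_ h.β₂_le
    (by rw [norm_neg]; exact h.β₂_le) p
  exact (norm_sub_le _ _).trans (by linarith [h.β₁_le, h.β₂_le])

lemma ModeBounds.tractionDown_le (p : Amp) :
    ‖P.tractionDown n p‖ ≤ 6 * A ^ 2 * A / ‖P.χ n‖ * ‖p‖ := by
  refine h.norm_rankOneUpdate_le h.A_nonneg h.β₂_le ?_ (by rw [norm_neg]; exact h.β₂_le) h.β₂_le p
  exact (norm_sub_le _ _).trans (by linarith [h.β₁_le, h.β₂_le])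

/-- The linear system of the layer is uniquely solvable once the reflection coefficient is
below `1`. -/
lemma ModeBounds.isUnit_det : IsUnit (P.layerMatrix ζ n).det := by
  have hχ : P.χ n ≠ 0 := norm_pos_iff.1 h.χ_pos
  have ht : 0 ≤ 6 * A ^ 2 * A / ‖P.χ n‖ := by
    have := h.A_nonneg
    positivity
  rw [isUnit_iff_ne_zero]
  intro hdet
  obtain ⟨X, hX0, hX⟩ := Matrix.exists_mulVec_eq_zero_iff.2 hdet
  apply hX0
  obtain ⟨h1, h2, h3, h4⟩ := P.layer_system hχ (w := 0) (X := X) (by rw [hX]; simp)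
  have hp : P.upAmp n X = 0 := by
    have := (layer_perturbation h.s_nonneg h.s_lt ht h.propagateUp_le h.propagateDown_le
      h.tractionUp_le h.tractionDown_le h1 h2).2
    simpa using this
  have hq : P.downAmp ζ n X = 0 := by
    rw [hp, map_zero, zero_add] at h2
    exact h2
  set e₂ := Complex.exp (Complex.I * P.β₂ n * ζ) with he₂
  set f₁ := Complex.exp (-(Complex.I * P.β₁ n * ζ)) with hf₁
  set f₂ := Complex.exp (-(Complex.I * P.β₂ n * ζ)) with hf₂
  have hf₁0 : f₁ ≠ 0 := Complex.exp_ne_zero _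
  have hf₂0 : f₂ ≠ 0 := Complex.exp_ne_zero _
  have hef : e₂ * f₂ = 1 := by rw [he₂, hf₂, ← Complex.exp_add, add_neg_cancel, Complex.exp_zero]
  have hne : e₂ - f₂ ≠ 0 := by
    intro h0
    have h5 : e₂ * e₂ = 1 := by
      have : e₂ = f₂ := sub_eq_zero.1 h0
      nth_rw 2 [this]
      exact hef
    have h6 := congrArg norm h5
    rw [norm_mul, norm_one] at h6
    nlinarith [h.e₂_le, h.ε_lt, norm_nonneg e₂]
  have hS : P.αn₁ n * X 2 + P.αn₂ n * X 4 + P.β₂ n * X 6 = 0 := by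
    refine (mul_eq_zero.1 (?_ : (e₂ - f₂) * _ = 0)).resolve_left hne
    linear_combination h4 - f₂ * h3
  have hS' : P.αn₁ n * X 3 + P.αn₂ n * X 5 - P.β₂ n * X 7 = 0 := by
    linear_combination h3 - hS
  have hX0' : X 0 = 0 := by
    have := P.bdot_wave_upAmp n X
    rw [hp] at this
    simpa [bdot, hχ] using this.symm
  have hX1 : X 1 = 0 := by
    have := P.bdot_wave_downAmp ζ n X
    rw [hq] at this
    simpa [bdot, hχ, hf₁0, ← hf₁] using this.symm
  have c0 := congrArg (fun v : Amp => v 0) hp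
  have c1 := congrArg (fun v : Amp => v 1) hp
  have c2 := congrArg (fun v : Amp => v 2) hp
  have d0 := congrArg (fun v : Amp => v 0) hq
  have d1 := congrArg (fun v : Amp => v 1) hq
  have d2 := congrArg (fun v : Amp => v 2) hq
  simp only [upAmp, downAmp, amp_zero, amp_one, amp_two, PiLp.zero_apply, hX0', hX1, mul_zero,
    zero_add, neg_zero, zero_sub, ← hf₂, mul_eq_zero, hf₂0, false_or] at c0 c1 c2 d0 d1 d2
  -- `κ² C = k (k·C) - k × (k × C)` for `κ² = k·k`, applied to `C` and to `D`
  have hκ := h.κ_ne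
  have k2 : X 2 = 0 := (mul_eq_zero.1 (show ((P.αn₁ n : ℂ) ^ 2 + (P.αn₂ n : ℂ) ^ 2 +
    P.β₂ n ^ 2) * X 2 = 0 by
      linear_combination P.αn₁ n * hS - P.αn₂ n * c2 + P.β₂ n * c1)).resolve_left hκ
  have k4 : X 4 = 0 := (mul_eq_zero.1 (show ((P.αn₁ n : ℂ) ^ 2 + (P.αn₂ n : ℂ) ^ 2 +
    P.β₂ n ^ 2) * X 4 = 0 by
      linear_combination P.αn₂ n * hS - P.β₂ n * c0 + P.αn₁ n * c2)).resolve_left hκ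
  have k6 : X 6 = 0 := (mul_eq_zero.1 (show ((P.αn₁ n : ℂ) ^ 2 + (P.αn₂ n : ℂ) ^ 2 +
    P.β₂ n ^ 2) * X 6 = 0 by
      linear_combination P.β₂ n * hS - P.αn₁ n * c1 + P.αn₂ n * c0)).resolve_left hκ
  have k3 : X 3 = 0 := (mul_eq_zero.1 (show ((P.αn₁ n : ℂ) ^ 2 + (P.αn₂ n : ℂ) ^ 2 +
    P.β₂ n ^ 2) * X 3 = 0 by
      linear_combination P.αn₁ n * hS' - P.αn₂ n * d2 - P.β₂ n * d1)).resolve_left hκ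
  have k5 : X 5 = 0 := (mul_eq_zero.1 (show ((P.αn₁ n : ℂ) ^ 2 + (P.αn₂ n : ℂ) ^ 2 +
    P.β₂ n ^ 2) * X 5 = 0 by
      linear_combination P.αn₂ n * hS' + P.β₂ n * d0 + P.αn₁ n * d2)).resolve_left hκ
  have k7 : X 7 = 0 := (mul_eq_zero.1 (show ((P.αn₁ n : ℂ) ^ 2 + (P.αn₂ n : ℂ) ^ 2 +
    P.β₂ n ^ 2) * X 7 = 0 by
      linear_combination -P.β₂ n * hS' - P.αn₁ n * d1 + P.αn₂ n * d0)).resolve_left hκ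
  ext i
  fin_cases i <;> assumption

/-- The symbols of the exact and of the PML boundary operator differ by the square of the
reflection coefficient. -/
lemma ModeBounds.norm_MPML_sub_M_le (w : Fin 3 → ℂ) :
    ‖(WithLp.toLp 2 ((P.MPML ζ n - P.M n).mulVec w) : Amp)‖ ≤
      P.μ * (2 * (6 * A ^ 2 * A / ‖P.χ n‖) * s ^ 2 / (1 - s ^ 2)) * ‖(WithLp.toLp 2 w : Amp)‖ := by
  have hχ : P.χ n ≠ 0 := norm_pos_iff.1 h.χ_pos
  have ht : 0 ≤ 6 * A ^ 2 * A / ‖P.χ n‖ := by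
    have := h.A_nonneg
    positivity
  set X := ((P.layerMatrix ζ n)⁻¹ * layerRhs).mulVec w with hXdef
  have hX : (P.layerMatrix ζ n).mulVec X = layerRhs.mulVec w := by
    rw [hXdef, Matrix.mulVec_mulVec, ← Matrix.mul_assoc, Matrix.mul_nonsing_inv _ h.isUnit_det,
      Matrix.one_mul]
  obtain ⟨h1, h2, -, -⟩ := P.layer_system hχ hX
  have key := (layer_perturbation h.s_nonneg h.s_lt ht h.propagateUp_le h.propagateDown_le
      h.tractionUp_le h.tractionDown_le h1 h2).1
  have e1 : (P.MPML ζ n).mulVec w = (P.μ : ℂ) • (P.layerTraction n).mulVec X := by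
    rw [MPML, Matrix.smul_mulVec, hXdef, Matrix.mulVec_mulVec, Matrix.mul_assoc]
  rw [Matrix.sub_mulVec, WithLp.toLp_sub, M_mulVec P hχ, e1, WithLp.toLp_smul,
    layerTraction_mulVec P hχ (ζ := ζ), ← smul_sub, norm_smul, Complex.norm_real,
    Real.norm_of_nonneg P.μ_pos.le, mul_assoc]
  refine mul_le_mul_of_nonneg_left (key.trans_eq ?_) P.μ_pos.le
  rw [norm_smul, norm_neg, Complex.norm_I, one_mul]

end Bounds

/-! ### Spectral gaps and the decay of the modeling constant -/

lemma finite_shifted_lattice (a R : ℝ) {T : ℝ} (hT : 0 < T) :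
    {k : ℤ | |a + 2 * Real.pi * k / T| ≤ R}.Finite := by
  set N : ℤ := ⌈(R + |a|) * T / (2 * Real.pi)⌉
  refine (Set.finite_Icc (-N) N).subset fun k hk => ?_
  have hpi := Real.pi_pos
  have h1 : |2 * Real.pi * k / T| ≤ R + |a| := by
    have : (2 * Real.pi * k / T : ℝ) = (a + 2 * Real.pi * k / T) - a := by ring
    rw [this]
    exact (abs_sub _ _).trans (by simpa using hk)
  have h2 : |(k : ℝ)| ≤ (R + |a|) * T / (2 * Real.pi) := by
    rw [le_div_iff₀ (by positivity)]
    rw [abs_div, abs_mul, abs_of_pos hT, abs_of_pos (by positivity : 0 < 2 * Real.pi),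
      div_le_iff₀ hT] at h1
    linarith
  have h3 : |k| ≤ N := by
    have : ((|k| : ℤ) : ℝ) ≤ N := by
      push_cast
      exact h2.trans (Int.le_ceil _)
    exact_mod_cast this
  exact Set.mem_Icc.2 (abs_le.1 h3)

lemma finite_αabs_le (R : ℝ) : {n : ℤ × ℤ | P.αabs n ≤ R}.Finite := by
  refine ((finite_shifted_lattice P.α₁ R P.Λ₁_pos).prod
    (finite_shifted_lattice P.α₂ R P.Λ₂_pos)).subset fun n hn => ?_
  have h0 := P.αabs_nonneg n
  have hn' : P.αabs n ≤ R := hn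
  have hs := P.αabs_sq n
  constructor
  · show |P.αn₁ n| ≤ R
    exact (abs_le_of_sq_le_sq (by nlinarith [sq_nonneg (P.αn₂ n)]) h0).trans hn'
  · show |P.αn₂ n| ≤ R
    exact (abs_le_of_sq_le_sq (by nlinarith [sq_nonneg (P.αn₁ n)]) h0).trans hn'

lemma exists_lt_αabs (R : ℝ) : ∃ n, R < P.αabs n := by
  by_contra! h
  exact Set.infinite_univ ((P.finite_αabs_le R).subset fun n _ => h n)

lemma κ₁_lt_κ₂ : P.κ₁ < P.κ₂ := by
  have := P.μ_pos
  have := P.lam_add_μ_pos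
  exact div_lt_div_of_pos_left P.ω_pos (Real.sqrt_pos.2 P.μ_pos)
    (Real.sqrt_lt_sqrt P.μ_pos.le (by linarith))

lemma αabs_zero_lt : P.αabs 0 < P.κ₁ := by
  have h1 : P.αabs 0 ^ 2 = (P.κ₁ * Real.sin P.θ₁) ^ 2 := by
    rw [αabs_sq]
    simp only [αn₁, αn₂, α₁, α₂, Prod.fst_zero, Prod.snd_zero, Int.cast_zero, mul_zero, zero_div,
      add_zero]
    linear_combination (P.κ₁ * Real.sin P.θ₁) ^ 2 * Real.sin_sq_add_cos_sq P.θ₂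
  have hκ := P.κ₁_pos
  have hc : 0 < Real.cos P.θ₁ :=
    Real.cos_pos_of_mem_Ioo ⟨by linarith [P.θ₁_nonneg, Real.pi_pos], P.θ₁_lt⟩
  refine lt_of_pow_lt_pow_left₀ 2 hκ.le ?_
  rw [h1, mul_pow]
  nlinarith [Real.sin_sq_add_cos_sq P.θ₁, pow_pos hκ 2, pow_pos hc 2]

lemma Δ_sq (κ : ℝ) (n : ℤ × ℤ) : P.Δ κ n ^ 2 = |κ ^ 2 - P.αabs n ^ 2| :=
  Real.sq_sqrt (abs_nonneg _)

lemma Δ_nonneg (κ : ℝ) (n : ℤ × ℤ) : 0 ≤ P.Δ κ n := Real.sqrt_nonneg _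

lemma exists_gap {κ : ℝ} (hκ : 0 < κ) (h : ∀ n, κ ≠ P.αabs n) :
    ∃ δ : ℝ, 0 < δ ∧ ∀ n, δ ≤ P.Δ κ n := by
  have hpos : ∀ n, 0 < P.Δ κ n := fun n => by
    refine Real.sqrt_pos.2 (abs_pos.2 ?_)
    intro h0
    refine h n ((sq_eq_sq₀ hκ.le (P.αabs_nonneg n)).1 (by linarith))
  have hfar : ∀ n, κ + 1 < P.αabs n → 1 ≤ P.Δ κ n := fun n hn => by
    refine Real.le_sqrt_of_sq_le ?_
    rw [abs_sub_comm]
    exact le_trans (by nlinarith) (le_abs_self _)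
  rcases Set.eq_empty_or_nonempty {n : ℤ × ℤ | P.αabs n ≤ κ + 1} with he | hne
  · refine ⟨1, one_pos, fun n => hfar n ?_⟩
    have : n ∉ {n : ℤ × ℤ | P.αabs n ≤ κ + 1} := by rw [he]; simp
    exact not_le.1 this
  · obtain ⟨n₀, -, hn₀⟩ := Set.exists_min_image _ (P.Δ κ) (P.finite_αabs_le (κ + 1)) hne
    refine ⟨min 1 (P.Δ κ n₀), lt_min one_pos (hpos _), fun n => ?_⟩
    rcases le_or_gt (P.αabs n) (κ + 1) with hn | hn
    · exact (min_le_right _ _).trans (hn₀ n hn)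
    · exact (min_le_left _ _).trans (hfar n hn)

lemma Δminus_le {κ : ℝ} {n : ℤ × ℤ} (h : P.αabs n < κ) : P.Δminus κ ≤ P.Δ κ n :=
  csInf_le ⟨0, by rintro _ ⟨n, -, rfl⟩; exact P.Δ_nonneg κ n⟩ ⟨n, h, rfl⟩

lemma Δplus_le {κ : ℝ} {n : ℤ × ℤ} (h : ¬ P.αabs n < κ) : P.Δplus κ ≤ P.Δ κ n :=
  csInf_le ⟨0, by rintro _ ⟨n, -, rfl⟩; exact P.Δ_nonneg κ n⟩ ⟨n, h, rfl⟩

lemma le_Δminus {κ δ : ℝ} (h0 : P.αabs 0 < κ) (h : ∀ n, δ ≤ P.Δ κ n) : δ ≤ P.Δminus κ :=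
  le_csInf ⟨_, 0, h0, rfl⟩ (by rintro _ ⟨n, -, rfl⟩; exact h n)

lemma le_Δplus {κ δ : ℝ} (h : ∀ n, δ ≤ P.Δ κ n) : δ ≤ P.Δplus κ := by
  obtain ⟨n, hn⟩ := P.exists_lt_αabs κ
  exact le_csInf ⟨_, n, hn.le.not_gt, rfl⟩ (by rintro _ ⟨n, -, rfl⟩; exact h n)

/-- A common lower bound for all the gaps `Δⱼ^±`. -/
lemma exists_common_gap (hres : P.NoResonance) :
    ∃ c : ℝ, 0 < c ∧ c ≤ P.Δminus P.κ₁ ∧ c ≤ P.Δminus P.κ₂ ∧ c ≤ P.Δplus P.κ₁ ∧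
      c ≤ P.Δplus P.κ₂ := by
  obtain ⟨δ₁, h₁, h₁'⟩ := P.exists_gap P.κ₁_pos fun n => (hres n).1
  obtain ⟨δ₂, h₂, h₂'⟩ := P.exists_gap P.κ₂_pos fun n => (hres n).2
  have m1 := min_le_left δ₁ δ₂
  have m2 := min_le_right δ₁ δ₂
  exact ⟨min δ₁ δ₂, lt_min h₁ h₂, m1.trans (P.le_Δminus P.αabs_zero_lt h₁'),
    m2.trans (P.le_Δminus (P.αabs_zero_lt.trans P.κ₁_lt_κ₂) h₂'), m1.trans (P.le_Δplus h₁'),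
    m2.trans (P.le_Δplus h₂')⟩

/-- The maximum in the definition of `K`. -/
def layerMax (ζ : ℂ) : ℝ :=
  max (1 / (Real.exp (P.Δminus P.κ₁ * ζ.im) - 1)) <|
  max (1 / (Real.exp (1 / 2 * P.Δminus P.κ₁ * ζ.im) - 1) ^ 2) <|
  max (1 / (Real.exp (1 / 3 * P.Δminus P.κ₁ * ζ.im) - 1) ^ 3) <|
  max (1 / (Real.exp (P.Δplus P.κ₂ * ζ.re) - 1)) <|
  max (1 / (Real.exp (1 / 2 * P.Δplus P.κ₂ * ζ.re) - 1) ^ 2) <|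
  max (1 / (Real.exp (1 / 3 * P.Δplus P.κ₂ * ζ.re) - 1) ^ 3) <|
  max (1 / (Real.exp (P.Δminus P.κ₂ * ζ.im) - 1))
    ((Real.exp (-(P.Δplus P.κ₁ * ζ.re)) + Real.exp (-(P.Δminus P.κ₂ * ζ.im))) ^ 2 /
      ((1 - Real.exp (-(2 * P.Δplus P.κ₁ * ζ.re))) *
        (1 - Real.exp (-(2 * P.Δminus P.κ₂ * ζ.im))) ^ 2))

/-- The number `(49 + κ₂²)^{1/2}`. -/
def cutoff : ℝ := Real.sqrt (49 + P.κ₂ ^ 2)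

lemma cutoff_sq : P.cutoff ^ 2 = 49 + P.κ₂ ^ 2 := Real.sq_sqrt (by positivity)

lemma seven_le_cutoff : 7 ≤ P.cutoff := Real.le_sqrt_of_sq_le (by nlinarith [sq_nonneg P.κ₂])

lemma κ₂_le_cutoff : P.κ₂ ≤ P.cutoff := Real.le_sqrt_of_sq_le (by linarith)

lemma Khat_eq (ζ : ℂ) : P.Khat ζ = 528 * P.μ * P.cutoff ^ 7 * P.layerMax ζ / P.κ₁ ^ 6 := by
  have h : (49 + P.κ₂ ^ 2) ^ (7 / 2 : ℝ) = P.cutoff ^ 7 := by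
    rw [cutoff, Real.sqrt_eq_rpow, ← Real.rpow_mul_natCast (by positivity)]
    norm_num
  have hK : P.K ζ = 48 * P.cutoff ^ 7 / P.κ₁ ^ 2 * P.layerMax ζ := by rw [← h]; rfl
  have := P.κ₁_pos
  rw [Khat, hK]
  field_simp
  ring

lemma one_div_exp_sub_one_pow_le {x₀ x : ℝ} (hx₀ : 0 < x₀) (hx : x₀ ≤ x) (k : ℕ) :
    1 / (Real.exp x - 1) ^ k ≤ (1 / (1 - Real.exp (-x₀))) ^ k * Real.exp (-(k * x)) := by
  have h1 : Real.exp (-x₀) < 1 := Real.exp_lt_one_iff.2 (by linarith)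
  have h2 : Real.exp (-x) ≤ Real.exp (-x₀) := Real.exp_le_exp.2 (by linarith)
  have h3 : Real.exp x - 1 = (1 - Real.exp (-x)) * Real.exp x := by
    rw [sub_mul, ← Real.exp_add, neg_add_cancel, Real.exp_zero, one_mul]
  have h4 : Real.exp (-(k * x)) = (1 / Real.exp x) ^ k := by
    rw [one_div, ← Real.exp_neg, ← Real.exp_nat_mul]
    congr 1
    ring
  rw [h4, ← mul_pow, ← one_div_pow, h3]
  have h5 := Real.exp_pos x
  refine pow_le_pow_left₀ (one_div_nonneg.2 (mul_nonneg (by linarith) h5.le)) ?_ k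
  rw [one_div_mul_one_div]
  exact one_div_le_one_div_of_le (mul_pos (by linarith) h5) (by gcongr)

/-- Exponential decay of the constant `K̂` in the PML parameters. -/
theorem Khat_decay (hres : P.NoResonance) :
    ∃ c : ℝ, 0 < c ∧ ∀ s : ℝ, 0 < s → ∃ C : ℝ, ∀ ζ : ℂ, s ≤ ζ.re → s ≤ ζ.im →
      |P.Khat ζ| ≤ C * (Real.exp (-(c * ζ.re)) + Real.exp (-(c * ζ.im))) := by
  obtain ⟨c, hc, h1m, h2m, h1p, h2p⟩ := P.exists_common_gap hres
  refine ⟨c, hc, fun s hs => ?_⟩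
  set x₀ := c * s / 3 with hx₀
  have hx₀pos : 0 < x₀ := by positivity
  set C := 1 / (1 - Real.exp (-x₀)) with hC
  have hexp : Real.exp (-x₀) < 1 := Real.exp_lt_one_iff.2 (by linarith)
  have hC1 : 1 ≤ C := by
    rw [hC, le_div_iff₀ (by linarith)]
    linarith [Real.exp_pos (-x₀)]
  refine ⟨528 * P.μ * P.cutoff ^ 7 * (2 * C ^ 3) / P.κ₁ ^ 6, fun ζ hre him => ?_⟩
  have hre0 : 0 < ζ.re := hs.trans_le hre
  have him0 : 0 < ζ.im := hs.trans_le him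
  set E := Real.exp (-(c * ζ.re)) + Real.exp (-(c * ζ.im)) with hE
  have hEr : Real.exp (-(c * ζ.re)) ≤ E := le_add_of_nonneg_right (Real.exp_pos _).le
  have hEi : Real.exp (-(c * ζ.im)) ≤ E := le_add_of_nonneg_left (Real.exp_pos _).le
  have hE0 : 0 < E := by positivity
  -- the terms with a single exponential
  have hterm : ∀ (Δ t : ℝ) (k : ℕ), c ≤ Δ → s ≤ t → Real.exp (-(c * t)) ≤ E → 1 ≤ k → k ≤ 3 →
      1 / (Real.exp (1 / k * Δ * t) - 1) ^ k ≤ 2 * C ^ 3 * E := by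
    intro Δ t k hΔ ht hEt hk1 hk3
    have ht0 : 0 < t := hs.trans_le ht
    have hk1' : (1 : ℝ) ≤ k := by exact_mod_cast hk1
    have hk3' : (k : ℝ) ≤ 3 := by exact_mod_cast hk3
    have hct : c * s ≤ Δ * t := mul_le_mul hΔ ht hs.le (hc.le.trans hΔ)
    have hx : x₀ ≤ 1 / k * Δ * t := by
      rw [hx₀, one_div, mul_assoc, ← div_eq_inv_mul, div_le_div_iff₀ (by norm_num) (by linarith)]
      have : 0 < c * s := by positivity
      nlinarith
    calc 1 / (Real.exp (1 / k * Δ * t) - 1) ^ k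
        ≤ C ^ k * Real.exp (-(k * (1 / k * Δ * t))) := one_div_exp_sub_one_pow_le hx₀pos hx k
      _ ≤ C ^ 3 * E := by
          refine mul_le_mul (pow_le_pow_right₀ hC1 hk3) ?_ (Real.exp_pos _).le (by positivity)
          · refine le_trans (Real.exp_le_exp.2 ?_) hEt
            have : (k : ℝ) * (1 / k * Δ * t) = Δ * t := by field_simp
            rw [this]
            nlinarith
      _ ≤ 2 * C ^ 3 * E := by
          have : 0 ≤ C ^ 3 * E := by positivity
          linarith
  have hden : ∀ (Δ t : ℝ), c ≤ Δ → s ≤ t → 1 / (1 - Real.exp (-(2 * Δ * t))) ≤ C := by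
    intro Δ t hΔ ht
    have hct : c * s ≤ Δ * t := mul_le_mul hΔ ht hs.le (hc.le.trans hΔ)
    have : Real.exp (-(2 * Δ * t)) ≤ Real.exp (-x₀) := by
      refine Real.exp_le_exp.2 ?_
      have : 0 < c * s := by positivity
      rw [hx₀]
      linarith
    exact one_div_le_one_div_of_le (by linarith) (by linarith)
  have hlast : (Real.exp (-(P.Δplus P.κ₁ * ζ.re)) + Real.exp (-(P.Δminus P.κ₂ * ζ.im))) ^ 2 /
      ((1 - Real.exp (-(2 * P.Δplus P.κ₁ * ζ.re))) *
        (1 - Real.exp (-(2 * P.Δminus P.κ₂ * ζ.im))) ^ 2) ≤ 2 * C ^ 3 * E := by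
    have e1 : Real.exp (-(P.Δplus P.κ₁ * ζ.re)) ≤ Real.exp (-(c * ζ.re)) :=
      Real.exp_le_exp.2 (by nlinarith)
    have e2 : Real.exp (-(P.Δminus P.κ₂ * ζ.im)) ≤ Real.exp (-(c * ζ.im)) :=
      Real.exp_le_exp.2 (by nlinarith)
    have e3 : E ≤ 2 := by
      have a1 : Real.exp (-(c * ζ.re)) ≤ 1 := Real.exp_le_one_iff.2 (by nlinarith)
      have a2 : Real.exp (-(c * ζ.im)) ≤ 1 := Real.exp_le_one_iff.2 (by nlinarith)
      linarith
    have d1 := hden _ _ h1p hre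
    have d2 := hden _ _ h2m him
    have p1 : 0 ≤ 1 / (1 - Real.exp (-(2 * P.Δplus P.κ₁ * ζ.re))) := by
      refine one_div_nonneg.2 (sub_nonneg.2 (Real.exp_le_one_iff.2 ?_))
      nlinarith
    have p2 : 0 ≤ 1 / (1 - Real.exp (-(2 * P.Δminus P.κ₂ * ζ.im))) := by
      refine one_div_nonneg.2 (sub_nonneg.2 (Real.exp_le_one_iff.2 ?_))
      nlinarith
    rw [div_eq_mul_one_div, ← one_div_mul_one_div, ← one_div_pow]
    calc _ ≤ E ^ 2 * (C * C ^ 2) := by gcongr; exact add_le_add e1 e2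
      _ = E * (C ^ 3 * E) := by ring
      _ ≤ 2 * (C ^ 3 * E) := by gcongr
      _ = 2 * C ^ 3 * E := by ring
  have hmax : P.layerMax ζ ≤ 2 * C ^ 3 * E := by
    have t1 := hterm _ _ 1 h1m him hEi le_rfl (by norm_num)
    have t4 := hterm _ _ 1 h2p hre hEr le_rfl (by norm_num)
    have t7 := hterm _ _ 1 h2m him hEi le_rfl (by norm_num)
    simp only [Nat.cast_one, div_one, one_mul, pow_one] at t1 t4 t7
    refine max_le t1 <| max_le ?_ <| max_le ?_ <| max_le t4 <| max_le ?_ <| max_le ?_ <|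
      max_le t7 hlast
    · exact_mod_cast hterm _ _ 2 h1m him hEi (by norm_num) (by norm_num)
    · exact_mod_cast hterm _ _ 3 h1m him hEi (by norm_num) (by norm_num)
    · exact_mod_cast hterm _ _ 2 h2p hre hEr (by norm_num) (by norm_num)
    · exact_mod_cast hterm _ _ 3 h2p hre hEr (by norm_num) (by norm_num)
  have hmax0 : 0 ≤ P.layerMax ζ := by
    refine le_trans (one_div_nonneg.2 (sub_nonneg.2 (Real.one_le_exp ?_))) (le_max_left _ _)
    nlinarith
  have hμ := P.μ_pos
  have hκ := P.κ₁_pos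
  have hT : 0 < P.cutoff := by linarith [P.seven_le_cutoff]
  rw [Khat_eq, abs_of_nonneg (by positivity), div_mul_eq_mul_div]
  refine div_le_div_of_nonneg_right ?_ (by positivity)
  rw [mul_assoc _ (2 * C ^ 3)]
  exact mul_le_mul_of_nonneg_left hmax (by positivity)

/-! ### The difference of the boundary symbols -/

lemma β_of_lt {κ : ℝ} {n : ℤ × ℤ} (h : P.αabs n < κ) : P.β κ n = (P.Δ κ n : ℂ) := by
  have h0 := P.αabs_nonneg n
  rw [β, if_pos h, Δ, abs_of_nonneg (by nlinarith)]

lemma β_of_not_lt {κ : ℝ} (hκ : 0 ≤ κ) {n : ℤ × ℤ} (h : ¬ P.αabs n < κ) :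
    P.β κ n = Complex.I * (P.Δ κ n : ℂ) := by
  have h0 := not_lt.1 h
  rw [β, if_neg h, Δ, abs_sub_comm, abs_of_nonneg (by nlinarith)]

lemma norm_β {κ : ℝ} (hκ : 0 ≤ κ) (n : ℤ × ℤ) : ‖P.β κ n‖ = P.Δ κ n := by
  by_cases h : P.αabs n < κ
  · rw [β_of_lt P h, Complex.norm_real, Real.norm_of_nonneg (P.Δ_nonneg κ n)]
  · rw [β_of_not_lt P hκ h, norm_mul, Complex.norm_I, one_mul, Complex.norm_real,
      Real.norm_of_nonneg (P.Δ_nonneg κ n)]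

lemma norm_exp_of_lt {κ : ℝ} {n : ℤ × ℤ} (h : P.αabs n < κ) (ζ : ℂ) :
    ‖Complex.exp (Complex.I * P.β κ n * ζ)‖ = Real.exp (-(P.Δ κ n * ζ.im)) := by
  rw [Complex.norm_exp, β_of_lt P h]
  simp

lemma norm_exp_of_not_lt {κ : ℝ} (hκ : 0 ≤ κ) {n : ℤ × ℤ} (h : ¬ P.αabs n < κ) (ζ : ℂ) :
    ‖Complex.exp (Complex.I * P.β κ n * ζ)‖ = Real.exp (-(P.Δ κ n * ζ.re)) := by
  rw [Complex.norm_exp, β_of_not_lt P hκ h]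
  simp

lemma Δ_sq_of_lt {κ : ℝ} {n : ℤ × ℤ} (h : P.αabs n < κ) :
    P.Δ κ n ^ 2 = κ ^ 2 - P.αabs n ^ 2 := by
  have h0 := P.αabs_nonneg n
  rw [Δ_sq, abs_of_nonneg (by nlinarith)]

lemma Δ_sq_of_not_lt {κ : ℝ} (hκ : 0 ≤ κ) {n : ℤ × ℤ} (h : ¬ P.αabs n < κ) :
    P.Δ κ n ^ 2 = P.αabs n ^ 2 - κ ^ 2 := by
  have h0 := not_lt.1 h
  rw [Δ_sq, abs_sub_comm, abs_of_nonneg (by nlinarith)]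

/-- The denominator `χ⁽ⁿ⁾` of the symbol is bounded away from zero. -/
lemma κ₁_sq_le_norm_χ (n : ℤ × ℤ) : P.κ₁ ^ 2 ≤ ‖P.χ n‖ := by
  have h1 := P.κ₁_pos
  have h2 := P.κ₂_pos
  have h12 := P.κ₁_lt_κ₂
  have h0 := P.αabs_nonneg n
  have hΔ₁ := P.Δ_nonneg P.κ₁ n
  have hΔ₂ := P.Δ_nonneg P.κ₂ n
  unfold χ β₁ β₂
  by_cases c1 : P.αabs n < P.κ₁
  · have c2 := c1.trans h12
    have e1 := P.Δ_sq_of_lt c1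
    have e2 := P.Δ_sq_of_lt c2
    rw [β_of_lt P c1, β_of_lt P c2]
    have hle : P.Δ P.κ₁ n ≤ P.Δ P.κ₂ n := by nlinarith
    have : (P.αabs n : ℂ) ^ 2 + (P.Δ P.κ₁ n : ℂ) * (P.Δ P.κ₂ n : ℂ) =
        ((P.αabs n ^ 2 + P.Δ P.κ₁ n * P.Δ P.κ₂ n : ℝ) : ℂ) := by push_cast; ring
    rw [this, Complex.norm_real]
    refine le_trans ?_ (le_abs_self _)
    nlinarith
  by_cases c2 : P.αabs n < P.κ₂
  · have e1 := P.Δ_sq_of_not_lt h1.le c1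
    have e2 := P.Δ_sq_of_lt c2
    rw [β_of_not_lt P h1.le c1, β_of_lt P c2]
    have : (P.αabs n : ℂ) ^ 2 + Complex.I * (P.Δ P.κ₁ n : ℂ) * (P.Δ P.κ₂ n : ℂ) =
        ((P.αabs n ^ 2 : ℝ) : ℂ) + ((P.Δ P.κ₁ n * P.Δ P.κ₂ n : ℝ) : ℂ) * Complex.I := by
      push_cast; ring
    rw [this]
    refine abs_le_of_sq_le_sq' ?_ (norm_nonneg _) |>.2
    rw [Complex.sq_norm, Complex.normSq_add_mul_I, mul_pow, e1, e2]
    nlinarith [not_lt.1 c1, mul_nonneg (show 0 ≤ P.αabs n ^ 2 - P.κ₁ ^ 2 by nlinarith [not_lt.1 c1])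
      (show 0 ≤ P.κ₂ ^ 2 by positivity), mul_nonneg (show 0 ≤ P.αabs n ^ 2 - P.κ₁ ^ 2 by
      nlinarith [not_lt.1 c1]) (show 0 ≤ P.κ₁ ^ 2 by positivity)]
  · have e1 := P.Δ_sq_of_not_lt h1.le c1
    have e2 := P.Δ_sq_of_not_lt h2.le c2
    rw [β_of_not_lt P h1.le c1, β_of_not_lt P h2.le c2]
    have : (P.αabs n : ℂ) ^ 2 + Complex.I * (P.Δ P.κ₁ n : ℂ) * (Complex.I * (P.Δ P.κ₂ n : ℂ)) =
        ((P.αabs n ^ 2 - P.Δ P.κ₁ n * P.Δ P.κ₂ n : ℝ) : ℂ) := by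
      push_cast
      linear_combination (P.Δ P.κ₁ n : ℂ) * (P.Δ P.κ₂ n : ℂ) * Complex.I_sq
    rw [this, Complex.norm_real]
    refine le_trans ?_ (le_abs_self _)
    nlinarith [sq_nonneg (P.Δ P.κ₁ n - P.Δ P.κ₂ n)]

/-- The estimate of one mode, once the wave numbers and the decay factor of the mode are
controlled by the cutoff and by the maximum in `K`. The assumption `K̂ ≤ 2μ` makes the reflection
coefficient of every mode small. -/
lemma norm_MPML_sub_M_le_of {ζ : ℂ} {n : ℤ × ℤ} {A ε : ℝ} (hK : P.Khat ζ ≤ 2 * P.μ)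
    (hA : 0 ≤ A) (hα : P.αabs n ≤ A) (hβ₁ : P.Δ P.κ₁ n ≤ A) (hβ₂ : P.Δ P.κ₂ n ≤ A)
    (hε : 0 < ε) (hε1 : ε < 1) (h₁ : ‖Complex.exp (Complex.I * P.β₁ n * ζ)‖ ≤ ε)
    (h₂ : ‖Complex.exp (Complex.I * P.β₂ n * ζ)‖ ≤ ε)
    (h4 : A ^ 4 * ε ^ 2 ≤ P.cutoff ^ 4 * P.layerMax ζ)
    (h7 : A ^ 7 * ε ^ 2 ≤ P.cutoff ^ 7 * P.layerMax ζ) (w : Fin 3 → ℂ) :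
    ‖(WithLp.toLp 2 ((P.MPML ζ n - P.M n).mulVec w) : Amp)‖ ≤
      P.Khat ζ * ‖(WithLp.toLp 2 w : Amp)‖ := by
  have hκ := P.κ₁_pos
  have hμ := P.μ_pos
  have hT := P.seven_le_cutoff
  have hκT : P.κ₁ ≤ P.cutoff := P.κ₁_lt_κ₂.le.trans P.κ₂_le_cutoff
  have hχ := P.κ₁_sq_le_norm_χ n
  have hχ0 : 0 < ‖P.χ n‖ := lt_of_lt_of_le (by positivity) hχ
  -- `cutoff ≥ 7` and `cutoff ≥ κ₁` turn `K̂ ≤ 2μ` into `s² ≤ 1/50` for the reflection coefficient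
  rw [Khat_eq, div_le_iff₀ (by positivity)] at hK
  have hK' : 264 * (P.cutoff ^ 7 * P.layerMax ζ) ≤ P.κ₁ ^ 6 := by
    by_contra! hlt
    nlinarith [mul_lt_mul_of_pos_left hlt hμ]
  have hs : 36 * (A ^ 4 * ε ^ 2) ≤ P.κ₁ ^ 4 * (1 / 50) := by
    have hm : 264 * P.cutoff ^ 3 * (P.cutoff ^ 4 * P.layerMax ζ) ≤ P.κ₁ ^ 6 := by
      linarith [hK', show 264 * P.cutoff ^ 3 * (P.cutoff ^ 4 * P.layerMax ζ) =
        264 * (P.cutoff ^ 7 * P.layerMax ζ) by ring]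
    have hT3 : 7 * P.κ₁ ^ 2 ≤ P.cutoff ^ 3 := by
      calc 7 * P.κ₁ ^ 2 ≤ P.cutoff * P.cutoff ^ 2 := by gcongr
        _ = P.cutoff ^ 3 := by ring
    have h0 : 0 ≤ A ^ 4 * ε ^ 2 := by positivity
    have h1 : 264 * (7 * P.κ₁ ^ 2) * (A ^ 4 * ε ^ 2) ≤ P.κ₁ ^ 6 := by
      refine le_trans ?_ hm
      gcongr
    have h2 : 1848 * (A ^ 4 * ε ^ 2) ≤ P.κ₁ ^ 4 := by
      refine le_of_mul_le_mul_left ?_ (show 0 < P.κ₁ ^ 2 by positivity)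
      linarith [show P.κ₁ ^ 2 * P.κ₁ ^ 4 = P.κ₁ ^ 6 by ring]
    linarith
  set s := 6 * A ^ 2 * ε / P.κ₁ ^ 2 with hsdef
  have hs2 : s ^ 2 ≤ 1 / 50 := by
    have : s ^ 2 = 36 * (A ^ 4 * ε ^ 2) / P.κ₁ ^ 4 := by rw [hsdef]; field_simp; ring
    rw [this, div_le_iff₀ (by positivity)]
    linarith
  have hb : P.ModeBounds ζ n A ε s :=
    { A_nonneg := hA
      α_le := pow_le_pow_left₀ (P.αabs_nonneg n) hα 2
      β₁_le := by rw [β₁, norm_β P hκ.le]; exact hβ₁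
      β₂_le := by rw [β₂, norm_β P P.κ₂_pos.le]; exact hβ₂
      χ_pos := hχ0
      ε_pos := hε
      e₁_le := h₁
      e₂_le := h₂
      ε_lt := hε1
      refl_le := by
        rw [hsdef]
        gcongr
      s_lt := by linarith
      κ_ne := by
        have := P.β_sq P.κ₂_pos.le n
        rw [β₂, this]
        have h0 : (P.κ₂ : ℂ) ^ 2 ≠ 0 := by exact_mod_cast (pow_pos P.κ₂_pos 2).ne'
        convert h0 using 1
        ring }
  refine (hb.norm_MPML_sub_M_le w).trans ?_
  rw [Khat_eq]
  gcongr
  calc P.μ * (2 * (6 * A ^ 2 * A / ‖P.χ n‖) * s ^ 2 / (1 - s ^ 2))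
      ≤ P.μ * (2 * (6 * A ^ 2 * A / P.κ₁ ^ 2) * s ^ 2 / (49 / 50)) := by
        gcongr
        linarith
    _ = P.μ * (432 * 50 / 49) * (A ^ 7 * ε ^ 2) / P.κ₁ ^ 6 := by
        rw [hsdef]
        field_simp
        ring
    _ ≤ P.μ * 528 * (P.cutoff ^ 7 * P.layerMax ζ) / P.κ₁ ^ 6 := by
        gcongr
        norm_num
    _ = 528 * P.μ * P.cutoff ^ 7 * P.layerMax ζ / P.κ₁ ^ 6 := by ring

lemma exp_neg_le_one_div {x : ℝ} (hx : 0 < x) :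
    Real.exp (-x) ≤ 1 / (Real.exp x - 1) := by
  rw [Real.exp_neg, ← one_div]
  exact one_div_le_one_div_of_le (sub_pos.2 (Real.one_lt_exp_iff.2 hx)) (by linarith)

/-- The horizontal wave number of an evanescent mode is at most of the order of `exp(Δ/7)`, so that
its seventh power is absorbed by one factor `exp(-Δ Re ζ)` when `Re ζ ≥ 1`. -/
lemma le_cutoff_mul_exp {a Δ : ℝ} (hΔ : 0 ≤ Δ) (ha : a ^ 2 = Δ ^ 2 + P.κ₂ ^ 2) :
    a ≤ P.cutoff * Real.exp (Δ / 7) := by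
  have hT := P.seven_le_cutoff
  have h1 : 1 + Δ / 7 ≤ Real.exp (Δ / 7) := by linarith [Real.add_one_le_exp (Δ / 7)]
  refine (abs_le_of_sq_le_sq' ?_ (by positivity)).2
  calc a ^ 2 ≤ (49 + P.κ₂ ^ 2) * (1 + Δ / 7) ^ 2 := by
        rw [ha]
        nlinarith [sq_nonneg P.κ₂, mul_nonneg (sq_nonneg P.κ₂) hΔ,
          mul_nonneg (sq_nonneg P.κ₂) (sq_nonneg Δ)]
    _ ≤ (49 + P.κ₂ ^ 2) * Real.exp (Δ / 7) ^ 2 := by gcongr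
    _ = (P.cutoff * Real.exp (Δ / 7)) ^ 2 := by rw [mul_pow, cutoff_sq]

/-- Modes for which both kinds of waves propagate. -/
lemma norm_MPML_sub_M_le_of_lt_κ₁ (hres : P.NoResonance) {ζ : ℂ} (hre : 1 ≤ ζ.re) (him : 0 < ζ.im)
    (hK : P.Khat ζ ≤ 2 * P.μ) {n : ℤ × ℤ} (c1 : P.αabs n < P.κ₁) (w : Fin 3 → ℂ) :
    ‖(WithLp.toLp 2 ((P.MPML ζ n - P.M n).mulVec w) : Amp)‖ ≤
      P.Khat ζ * ‖(WithLp.toLp 2 w : Amp)‖ := by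
  obtain ⟨c, hc, h1m, h2m, h1p, h2p⟩ := P.exists_common_gap hres
  have hre0 : 0 < ζ.re := by linarith
  have h1 := P.κ₁_pos
  have h2 := P.κ₂_pos
  have h12 := P.κ₁_lt_κ₂
  have h0 := P.αabs_nonneg n
  have hΔ₁ := P.Δ_nonneg P.κ₁ n
  have hΔ₂ := P.Δ_nonneg P.κ₂ n
  have hT := P.seven_le_cutoff
  have hκT := P.κ₂_le_cutoff
  have c2 := c1.trans h12
  have e1 := P.Δ_sq_of_lt c1
  have e2 := P.Δ_sq_of_lt c2
  have d1 : P.Δ P.κ₁ n ≤ P.κ₂ := by nlinarith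
  have d2 : P.Δ P.κ₂ n ≤ P.κ₂ := by nlinarith
  have d12 : P.Δ P.κ₁ n ≤ P.Δ P.κ₂ n := by nlinarith
  have hm := P.Δminus_le c1
  have hpos : 0 < P.Δminus P.κ₁ := hc.trans_le h1m
  set ε := Real.exp (-(P.Δminus P.κ₁ * ζ.im)) with hε
  have hε0 : 0 < ε := Real.exp_pos _
  have hε1 : ε < 1 := Real.exp_lt_one_iff.2 (neg_neg_of_pos (by positivity))
  have hεm : ε ^ 2 ≤ P.layerMax ζ :=
    calc ε ^ 2 ≤ ε := by nlinarith
      _ ≤ 1 / (Real.exp (P.Δminus P.κ₁ * ζ.im) - 1) := exp_neg_le_one_div (by positivity)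
      _ ≤ P.layerMax ζ := le_max_left _ _
  refine P.norm_MPML_sub_M_le_of hK h2.le c2.le d1 d2 hε0 hε1 ?_ ?_ ?_ ?_ w
  · rw [β₁, norm_exp_of_lt P c1]
    exact Real.exp_le_exp.2 (by gcongr)
  · rw [β₂, norm_exp_of_lt P c2]
    exact Real.exp_le_exp.2 (by gcongr; exact hm.trans d12)
  · gcongr
  · gcongr

/-- Modes with propagating shear waves and evanescent compressional waves. -/
lemma norm_MPML_sub_M_le_of_lt_κ₂ (hres : P.NoResonance) {ζ : ℂ} (hre : 1 ≤ ζ.re) (him : 0 < ζ.im)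
    (hK : P.Khat ζ ≤ 2 * P.μ) {n : ℤ × ℤ} (c1 : ¬ P.αabs n < P.κ₁) (c2 : P.αabs n < P.κ₂) (w : Fin 3 → ℂ) :
    ‖(WithLp.toLp 2 ((P.MPML ζ n - P.M n).mulVec w) : Amp)‖ ≤
      P.Khat ζ * ‖(WithLp.toLp 2 w : Amp)‖ := by
  obtain ⟨c, hc, h1m, h2m, h1p, h2p⟩ := P.exists_common_gap hres
  have hre0 : 0 < ζ.re := by linarith
  have h1 := P.κ₁_pos
  have h2 := P.κ₂_pos
  have h12 := P.κ₁_lt_κ₂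
  have h0 := P.αabs_nonneg n
  have hΔ₁ := P.Δ_nonneg P.κ₁ n
  have hΔ₂ := P.Δ_nonneg P.κ₂ n
  have hT := P.seven_le_cutoff
  have hκT := P.κ₂_le_cutoff
  have e1 := P.Δ_sq_of_not_lt h1.le c1
  have e2 := P.Δ_sq_of_lt c2
  have d1 : P.Δ P.κ₁ n ≤ P.κ₂ := by nlinarith
  have d2 : P.Δ P.κ₂ n ≤ P.κ₂ := by nlinarith
  have hp := P.Δplus_le c1
  have hm := P.Δminus_le c2
  have hppos : 0 < P.Δplus P.κ₁ := hc.trans_le h1p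
  have hmpos : 0 < P.Δminus P.κ₂ := hc.trans_le h2m
  set x := Real.exp (-(P.Δplus P.κ₁ * ζ.re)) with hx
  set y := Real.exp (-(P.Δminus P.κ₂ * ζ.im)) with hy
  have hx0 : 0 < x := Real.exp_pos _
  have hy0 : 0 < y := Real.exp_pos _
  have hx1 : x < 1 := Real.exp_lt_one_iff.2 (neg_neg_of_pos (by positivity))
  have hy1 : y < 1 := Real.exp_lt_one_iff.2 (neg_neg_of_pos (by positivity))
  have hεm : max x y ^ 2 ≤ P.layerMax ζ := by
    have hx2 : Real.exp (-(2 * P.Δplus P.κ₁ * ζ.re)) = x ^ 2 := by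
      rw [hx, ← Real.exp_nat_mul]; congr 1; push_cast; ring
    have hy2 : Real.exp (-(2 * P.Δminus P.κ₂ * ζ.im)) = y ^ 2 := by
      rw [hy, ← Real.exp_nat_mul]; congr 1; push_cast; ring
    have hd1 : 0 < 1 - x ^ 2 := by nlinarith
    have hd2 : 0 < 1 - y ^ 2 := by nlinarith
    calc max x y ^ 2 ≤ (x + y) ^ 2 := by
          gcongr
          exact max_le (by linarith) (by linarith)
      _ ≤ (x + y) ^ 2 / ((1 - x ^ 2) * (1 - y ^ 2) ^ 2) := by
          refine le_div_self (by positivity) (by positivity) ?_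
          exact mul_le_one₀ (by nlinarith) (by positivity) (pow_le_one₀ hd2.le (by nlinarith))
      _ ≤ P.layerMax ζ := by
          rw [← hx2, ← hy2]
          exact le_max_of_le_right <| le_max_of_le_right <| le_max_of_le_right <|
            le_max_of_le_right <| le_max_of_le_right <| le_max_of_le_right <|
            le_max_right _ _
  refine P.norm_MPML_sub_M_le_of hK h2.le c2.le d1 d2 (lt_max_of_lt_left hx0) (max_lt hx1 hy1)
    ?_ ?_ ?_ ?_ w
  · rw [β₁, norm_exp_of_not_lt P h1.le c1]
    exact le_max_of_le_left (Real.exp_le_exp.2 (by gcongr))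
  · rw [β₂, norm_exp_of_lt P c2]
    exact le_max_of_le_right (Real.exp_le_exp.2 (by gcongr))
  · gcongr
  · gcongr

/-- Modes for which both kinds of waves are evanescent. -/
lemma norm_MPML_sub_M_le_of_not_lt (hres : P.NoResonance) {ζ : ℂ} (hre : 1 ≤ ζ.re)
    (hK : P.Khat ζ ≤ 2 * P.μ) {n : ℤ × ℤ} (c1 : ¬ P.αabs n < P.κ₁)
    (c2 : ¬ P.αabs n < P.κ₂) (w : Fin 3 → ℂ) :
    ‖(WithLp.toLp 2 ((P.MPML ζ n - P.M n).mulVec w) : Amp)‖ ≤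
      P.Khat ζ * ‖(WithLp.toLp 2 w : Amp)‖ := by
  obtain ⟨c, hc, h1m, h2m, h1p, h2p⟩ := P.exists_common_gap hres
  have hre0 : 0 < ζ.re := by linarith
  have h1 := P.κ₁_pos
  have h2 := P.κ₂_pos
  have h12 := P.κ₁_lt_κ₂
  have h0 := P.αabs_nonneg n
  have hΔ₁ := P.Δ_nonneg P.κ₁ n
  have hΔ₂ := P.Δ_nonneg P.κ₂ n
  have hT := P.seven_le_cutoff
  have hκT := P.κ₂_le_cutoff
  have e1 := P.Δ_sq_of_not_lt h1.le c1
  have e2 := P.Δ_sq_of_not_lt h2.le c2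
  have d1 : P.Δ P.κ₁ n ≤ P.αabs n := by nlinarith
  have d2 : P.Δ P.κ₂ n ≤ P.αabs n := by nlinarith
  have d12 : P.Δ P.κ₂ n ≤ P.Δ P.κ₁ n := by nlinarith
  have hp := P.Δplus_le c2
  have hppos : 0 < P.Δplus P.κ₂ := hc.trans_le h2p
  set ε := Real.exp (-(P.Δ P.κ₂ n * ζ.re)) with hε
  have hε0 : 0 < ε := Real.exp_pos _
  have hΔpos : 0 < P.Δ P.κ₂ n := hppos.trans_le hp
  have hε1 : ε < 1 := Real.exp_lt_one_iff.2 (neg_neg_of_pos (by positivity))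
  have hεm : ε ≤ P.layerMax ζ :=
    calc ε ≤ Real.exp (-(P.Δplus P.κ₂ * ζ.re)) := Real.exp_le_exp.2 (by gcongr)
      _ ≤ 1 / (Real.exp (P.Δplus P.κ₂ * ζ.re) - 1) := exp_neg_le_one_div (by positivity)
      _ ≤ P.layerMax ζ := le_max_of_le_right <| le_max_of_le_right <| le_max_of_le_right <|
            le_max_left _ _
  have hgrow : P.αabs n ≤ P.cutoff * Real.exp (P.Δ P.κ₂ n / 7) :=
    P.le_cutoff_mul_exp hΔ₂ (by linarith)
  have hpow : ∀ k : ℕ, k ≤ 7 → P.αabs n ^ k * ε ^ 2 ≤ P.cutoff ^ k * P.layerMax ζ := by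
    intro k hk
    have hk' : (k : ℝ) ≤ 7 := by exact_mod_cast hk
    calc P.αabs n ^ k * ε ^ 2 ≤ (P.cutoff * Real.exp (P.Δ P.κ₂ n / 7)) ^ k * ε ^ 2 := by gcongr
      _ = P.cutoff ^ k * (Real.exp (k * (P.Δ P.κ₂ n / 7)) * ε) * ε := by
          rw [mul_pow, ← Real.exp_nat_mul]; ring
      _ ≤ P.cutoff ^ k * 1 * P.layerMax ζ := by
          gcongr
          rw [hε, ← Real.exp_add]
          refine Real.exp_le_one_iff.2 ?_
          nlinarith
      _ = P.cutoff ^ k * P.layerMax ζ := by ring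
  refine P.norm_MPML_sub_M_le_of hK h0 le_rfl d1 d2 hε0 hε1 ?_ ?_ (hpow 4 (by norm_num))
    (hpow 7 le_rfl) w
  · rw [β₁, norm_exp_of_not_lt P h1.le c1]
    exact Real.exp_le_exp.2 (by gcongr)
  · rw [β₂, norm_exp_of_not_lt P h2.le c2]

/-- The symbols of the exact and of the PML boundary operator differ by at most `K̂` if `K̂` is
small. -/
theorem norm_MPML_sub_M_le_Khat (hres : P.NoResonance) {ζ : ℂ} (hre : 1 ≤ ζ.re) (him : 0 < ζ.im)
    (hK : P.Khat ζ ≤ 2 * P.μ) (n : ℤ × ℤ) (w : Fin 3 → ℂ) :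
    ‖(WithLp.toLp 2 ((P.MPML ζ n - P.M n).mulVec w) : Amp)‖ ≤
      P.Khat ζ * ‖(WithLp.toLp 2 w : Amp)‖ := by
  by_cases c1 : P.αabs n < P.κ₁
  · exact P.norm_MPML_sub_M_le_of_lt_κ₁ hres hre him hK c1 w
  by_cases c2 : P.αabs n < P.κ₂
  · exact P.norm_MPML_sub_M_le_of_lt_κ₂ hres hre him hK c1 c2 w
  · exact P.norm_MPML_sub_M_le_of_not_lt hres hre hK c1 c2 w

/-! ### Geometry of the domain -/

lemma continuous_f : Continuous P.f := P.f_lipschitz.choose_spec.continuous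

lemma exists_mem_period_cell (r : ℝ × ℝ) :
    ∃ r' ∈ Set.Icc 0 P.Λ₁ ×ˢ Set.Icc 0 P.Λ₂, P.f r = P.f r' := by
  have h1 : Function.Periodic (fun x => P.f (x, r.2)) P.Λ₁ := fun x => P.f_periodic₁ (x, r.2)
  obtain ⟨x, hx, hfx⟩ := h1.exists_mem_Ico₀ P.Λ₁_pos r.1
  have h2 : Function.Periodic (fun y => P.f (x, y)) P.Λ₂ := fun y => P.f_periodic₂ (x, y)
  obtain ⟨y, hy, hfy⟩ := h2.exists_mem_Ico₀ P.Λ₂_pos r.2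
  exact ⟨(x, y), ⟨Set.Ico_subset_Icc_self hx, Set.Ico_subset_Icc_self hy⟩, hfx.trans hfy⟩

lemma exists_max_f : ∃ m < P.h, ∀ r, P.f r ≤ m := by
  obtain ⟨r₀, -, h⟩ := (isCompact_Icc.prod isCompact_Icc).exists_isMaxOn
    (⟨(0, 0), ⟨le_rfl, P.Λ₁_pos.le⟩, ⟨le_rfl, P.Λ₂_pos.le⟩⟩ :
      (Set.Icc 0 P.Λ₁ ×ˢ Set.Icc 0 P.Λ₂).Nonempty) P.continuous_f.continuousOn
  refine ⟨P.f r₀, P.f_lt_h r₀, fun r => ?_⟩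
  obtain ⟨r', hr', e⟩ := P.exists_mem_period_cell r
  rw [e]
  exact h hr'

lemma exists_min_f : ∃ b, ∀ r, b ≤ P.f r := by
  obtain ⟨r₀, -, h⟩ := (isCompact_Icc.prod isCompact_Icc).exists_isMinOn
    (⟨(0, 0), ⟨le_rfl, P.Λ₁_pos.le⟩, ⟨le_rfl, P.Λ₂_pos.le⟩⟩ :
      (Set.Icc 0 P.Λ₁ ×ˢ Set.Icc 0 P.Λ₂).Nonempty) P.continuous_f.continuousOn
  refine ⟨P.f r₀, fun r => ?_⟩
  obtain ⟨r', hr', e⟩ := P.exists_mem_period_cell r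
  rw [e]
  exact h hr'

lemma bddBelow_f : BddBelow (Set.range P.f) := by
  obtain ⟨b, hb⟩ := P.exists_min_f
  exact ⟨b, by rintro _ ⟨r, rfl⟩; exact hb r⟩

lemma one_le_γ₂ : 1 ≤ P.γ₂ := by
  refine Real.le_sqrt_of_sq_le ?_
  have : 0 ≤ (P.h - ⨅ r, P.f r)⁻¹ :=
    inv_nonneg.2 (sub_nonneg.2 ((ciInf_le P.bddBelow_f (0, 0)).trans (P.f_lt_h _).le))
  linarith

/-- The lower end of a box that contains `Ω`. -/
def bottom : ℝ := P.exists_min_f.choose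

lemma bottom_le (r : ℝ × ℝ) : P.bottom ≤ P.f r := P.exists_min_f.choose_spec r

lemma bottom_lt_h : P.bottom < P.h := (P.bottom_le (0, 0)).trans_lt (P.f_lt_h _)

/-- The area of the period cell. -/
def area : ℝ := P.Λ₁ * P.Λ₂

lemma area_pos : 0 < P.area := mul_pos P.Λ₁_pos P.Λ₂_pos

lemma measurableSet_cell : MeasurableSet P.cell := measurableSet_Ioo.prod measurableSet_Ioo

lemma measurableSet_Ω : MeasurableSet P.Ω :=
  (measurable_fst P.measurableSet_cell).inter
    ((measurableSet_lt (P.continuous_f.measurable.comp measurable_fst) measurable_snd).inter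
      (measurableSet_lt measurable_snd measurable_const))

lemma Ω_subset_box : P.Ω ⊆ P.cell ×ˢ Set.Ioo P.bottom P.h := fun _ hx =>
  ⟨hx.1, (P.bottom_le _).trans_lt hx.2.1, hx.2.2⟩

lemma Ω_subset_cylinder : P.Ω ⊆ P.cell ×ˢ Set.Iic P.h := fun _ hx => ⟨hx.1, hx.2.2.le⟩

lemma restrict_cell : (volume : Measure (ℝ × ℝ)).restrict P.cell =
    (volume.restrict (Set.Ioo 0 P.Λ₁)).prod (volume.restrict (Set.Ioo 0 P.Λ₂)) := by
  rw [Measure.prod_restrict]; rfl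

lemma restrict_cell_prod (s : Set ℝ) : (volume : Measure Space).restrict (P.cell ×ˢ s) =
    (volume.restrict P.cell).prod (volume.restrict s) := by
  rw [Measure.prod_restrict]; rfl

instance : IsFiniteMeasure (volume.restrict P.cell) := by
  rw [restrict_cell]; infer_instance

instance : IsFiniteMeasure (volume.restrict P.Ω) := by
  have : IsFiniteMeasure ((volume : Measure Space).restrict (P.cell ×ˢ Set.Ioo P.bottom P.h)) := by
    rw [restrict_cell_prod]; infer_instance
  exact isFiniteMeasure_of_le _ (Measure.restrict_mono P.Ω_subset_box le_rfl)

lemma real_volume_cell : (volume.restrict P.cell).real Set.univ = P.area := by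
  rw [restrict_cell]
  rw [← Set.univ_prod_univ, measureReal_prod_prod]
  simp [Measure.real, area, P.Λ₁_pos.le, P.Λ₂_pos.le]

/-- Extension by zero does not change integrals. -/
lemma integral_zeroExt {D : Set Space} (hD : P.Ω ⊆ D) (u g : Space → ℂ) :
    ∫ x in D, P.Ω.indicator u x * g x = ∫ x in P.Ω, u x * g x := by
  have : ∀ x, P.Ω.indicator u x * g x = P.Ω.indicator (fun x => u x * g x) x := fun x => by
    by_cases hx : x ∈ P.Ω <;> simp [hx]
  simp_rw [this]
  rw [setIntegral_indicator P.measurableSet_Ω, Set.inter_eq_self_of_subset_right hD]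

lemma integral_norm_sq_zeroExt {D : Set Space} (hD : P.Ω ⊆ D) (u : Space → ℂ) :
    ∫ x in D, ‖P.Ω.indicator u x‖ ^ 2 = ∫ x in P.Ω, ‖u x‖ ^ 2 := by
  have : ∀ x, ‖P.Ω.indicator u x‖ ^ 2 = P.Ω.indicator (fun x => ‖u x‖ ^ 2) x := fun x => by
    by_cases hx : x ∈ P.Ω <;> simp [hx]
  simp_rw [this]
  rw [setIntegral_indicator P.measurableSet_Ω, Set.inter_eq_self_of_subset_right hD]

lemma memLp_zeroExt {D : Set Space} (hD : P.Ω ⊆ D) {u : Space → ℂ}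
    (hu : MemLp u 2 (volume.restrict P.Ω)) : MemLp (P.Ω.indicator u) 2 (volume.restrict D) := by
  rw [memLp_indicator_iff_restrict P.measurableSet_Ω, Measure.restrict_restrict_of_subset hD]
  exact hu

/-! ### Fourier modes on the cell and on boxes -/

/-- The horizontal mode `exp(i α⁽ⁿ⁾·r)`. -/
def mode (n : ℤ × ℤ) (r : ℝ × ℝ) : ℂ :=
  Complex.exp (Complex.I * ((P.αn₁ n * r.1 + P.αn₂ n * r.2 : ℝ) : ℂ))

lemma continuous_mode (n : ℤ × ℤ) : Continuous (P.mode n) := by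
  unfold mode; fun_prop

lemma norm_mode (n : ℤ × ℤ) (r : ℝ × ℝ) : ‖P.mode n r‖ = 1 := by
  rw [mode, mul_comm, Complex.norm_exp_ofReal_mul_I]

lemma conj_mode (n : ℤ × ℤ) (r : ℝ × ℝ) :
    conj (P.mode n r) =
      Complex.exp (-(Complex.I * ((P.αn₁ n * r.1 + P.αn₂ n * r.2 : ℝ) : ℂ))) := by
  rw [mode, ← Complex.exp_conj, map_mul, Complex.conj_I, Complex.conj_ofReal, neg_mul]

lemma mode_mul_conj (n : ℤ × ℤ) (r : ℝ × ℝ) : P.mode n r * conj (P.mode n r) = 1 := by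
  rw [Complex.mul_conj, Complex.normSq_eq_norm_sq, norm_mode]; simp

lemma coeff_eq (w : ℝ × ℝ → ℂ) (n : ℤ × ℤ) :
    (P.area : ℂ) * P.coeff w n = ∫ r in P.cell, w r * conj (P.mode n r) := by
  have := P.area_pos.ne'
  have h : (P.area : ℂ) ≠ 0 := by exact_mod_cast this
  simp_rw [conj_mode]
  rw [coeff, ← mul_assoc]
  have : (P.area : ℂ) * ((1 / (P.Λ₁ * P.Λ₂) : ℝ) : ℂ) = 1 := by
    rw [← Complex.ofReal_mul]
    have : P.area * (1 / (P.Λ₁ * P.Λ₂)) = 1 := mul_one_div_cancel (by assumption)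
    rw [this, Complex.ofReal_one]
  rw [this, one_mul]

/-- Parseval's identity on the period cell. -/
lemma parsevalFrame_mode :
    ParsevalFrame (volume.restrict P.cell) P.mode (ENNReal.ofReal P.area) := by
  have h1 := parsevalFrame_exp P.α₁ 0 P.Λ₁ P.Λ₁_pos
  have h2 := parsevalFrame_exp P.α₂ 0 P.Λ₂ P.Λ₂_pos
  rw [zero_add] at h1 h2
  have h := h1.prod h2 ENNReal.ofReal_ne_top
  rw [← restrict_cell, ← ENNReal.ofReal_mul P.Λ₁_pos.le] at h
  have e : P.mode = fun n r =>
      Complex.exp (Complex.I * (((P.α₁ + 2 * Real.pi * n.1 / P.Λ₁) * r.1 : ℝ) : ℂ)) *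
        Complex.exp (Complex.I * (((P.α₂ + 2 * Real.pi * n.2 / P.Λ₂) * r.2 : ℝ) : ℂ)) := by
    funext n r
    rw [mode, ← Complex.exp_add]
    congr 1
    simp only [αn₁, αn₂]
    push_cast
    ring
  rw [e]
  exact h

lemma hasSum_norm_coeff_sq {w : ℝ × ℝ → ℂ} (hw : MemLp w 2 (volume.restrict P.cell)) :
    HasSum (fun n => P.area * ‖P.coeff w n‖ ^ 2) (∫ r in P.cell, ‖w r‖ ^ 2) := by
  have hA := P.area_pos
  have h := (P.parsevalFrame_mode.hasSum hA.le hw).mul_left P.area⁻¹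
  rw [inv_mul_cancel_left₀ hA.ne'] at h
  refine h.congr_fun fun n => ?_
  rw [← coeff_eq, norm_mul, Complex.norm_real, Real.norm_of_nonneg hA.le]
  field_simp

lemma memLp_of_continuous_bounded {X : Type*} [MeasurableSpace X] [TopologicalSpace X]
    [OpensMeasurableSpace X] [SecondCountableTopology X] {ν : Measure X} [IsFiniteMeasure ν]
    {g : X → ℂ} (hg : Continuous g) {C : ℝ} (hC : ∀ᵐ x ∂ν, ‖g x‖ ≤ C) : MemLp g 2 ν :=
  MemLp.of_bound hg.aestronglyMeasurable C hC

lemma integral_mode_mul_conj (m n : ℤ × ℤ) :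
    ∫ r in P.cell, P.mode m r * conj (P.mode n r) = if m = n then (P.area : ℂ) else 0 := by
  have hself : ∀ m, ∫ r in P.cell, P.mode m r * conj (P.mode m r) = (P.area : ℂ) := fun m => by
    simp_rw [mode_mul_conj]
    rw [integral_const, real_volume_cell]
    simp
  split_ifs with h
  · rw [← h, hself]
  · have hA := P.area_pos
    have hL : MemLp (P.mode m) 2 (volume.restrict P.cell) :=
      memLp_of_continuous_bounded (P.continuous_mode m) (C := 1)
        (Filter.Eventually.of_forall fun r => (P.norm_mode m r).le)
    have hs := P.parsevalFrame_mode.hasSum hA.le hL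
    simp_rw [norm_mode] at hs
    rw [integral_const, real_volume_cell] at hs
    have h2 := sum_le_hasSum {m, n} (fun i _ => by positivity) hs
    rw [Finset.sum_pair h, hself, Complex.norm_real, Real.norm_of_nonneg hA.le] at h2
    simp only [one_pow, smul_eq_mul, mul_one] at h2
    have h3 : ‖∫ r in P.cell, P.mode m r * conj (P.mode n r)‖ ^ 2 ≤ 0 := by nlinarith
    exact norm_eq_zero.1 (pow_eq_zero_iff two_ne_zero |>.1 (le_antisymm h3 (by positivity)))

/-- The vertical exponential `exp(2πi k z / (h - b))`, where `b` is the bottom of the box. -/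
def vmode (k : ℤ) (z : ℝ) : ℂ :=
  Complex.exp (Complex.I * (((2 * Real.pi * k / (P.h - P.bottom)) * z : ℝ) : ℂ))

lemma norm_vmode (k : ℤ) (z : ℝ) : ‖P.vmode k z‖ = 1 := by
  rw [vmode, mul_comm, Complex.norm_exp_ofReal_mul_I]

/-- The volume of the box around `Ω`. -/
def boxVol : ℝ := P.area * (P.h - P.bottom)

lemma boxVol_pos : 0 < P.boxVol := mul_pos P.area_pos (sub_pos.2 P.bottom_lt_h)

/-- Parseval's identity on `Ω` for the exponentials of the box around `Ω`. -/
lemma hasSum_box {u : Space → ℂ} (hu : MemLp u 2 (volume.restrict P.Ω)) :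
    HasSum (fun i : (ℤ × ℤ) × ℤ =>
      ‖∫ x in P.Ω, u x * conj (P.mode i.1 x.1 * P.vmode i.2 x.2)‖ ^ 2)
      (P.boxVol * ∫ x in P.Ω, ‖u x‖ ^ 2) := by
  have hT : 0 < P.h - P.bottom := sub_pos.2 P.bottom_lt_h
  have h1 := parsevalFrame_exp 0 P.bottom (P.h - P.bottom) hT
  rw [add_sub_cancel] at h1
  simp only [zero_add] at h1
  have h := P.parsevalFrame_mode.prod h1 ENNReal.ofReal_ne_top
  rw [← restrict_cell_prod, ← ENNReal.ofReal_mul P.area_pos.le] at h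
  have h2 := h.hasSum P.boxVol_pos.le (P.memLp_zeroExt P.Ω_subset_box hu)
  rw [integral_norm_sq_zeroExt P P.Ω_subset_box] at h2
  simp_rw [integral_zeroExt P P.Ω_subset_box] at h2
  exact h2

/-- Bessel's inequality on `Ω` for functions `exp(i α⁽ⁿ⁾·r) exp(sₙ (x₃ - h))`, which are
orthogonal in the cylinder below `Γ_h`. -/
lemma bessel_exp {s : ℤ × ℤ → ℝ} (hs : ∀ n, 0 < s n) {u : Space → ℂ}
    (hu : MemLp u 2 (volume.restrict P.Ω)) (F : Finset (ℤ × ℤ)) :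
    ∑ n ∈ F, 2 * s n / P.area * ‖∫ x in P.Ω, u x * conj (P.mode n x.1 *
      (Real.exp (s n * (x.2 - P.h)) : ℂ))‖ ^ 2 ≤ ∫ x in P.Ω, ‖u x‖ ^ 2 := by
  have hA := P.area_pos
  set D : Set Space := P.cell ×ˢ Set.Iic P.h with hD
  set φ : ℤ × ℤ → Space → ℂ := fun n x =>
    P.mode n x.1 * (Real.exp (s n * (x.2 - P.h)) : ℂ) with hφ
  have hexpint : ∀ c : ℝ, 0 < c →
      IntegrableOn (fun z => Real.exp (c * (z - P.h))) (Set.Iic P.h) ∧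
      ∫ z in Set.Iic P.h, Real.exp (c * (z - P.h)) = 1 / c := fun c hc => by
    have e : (fun z => Real.exp (c * (z - P.h))) =
        fun z => Real.exp (-(c * P.h)) * Real.exp (c * z) := by
      ext z; rw [← Real.exp_add]; congr 1; ring
    constructor
    · rw [e]
      exact (integrableOn_exp_mul_Iic hc _).const_mul _
    · rw [e, integral_const_mul, integral_exp_mul_Iic hc, ← mul_div_assoc, ← Real.exp_add,
        neg_add_cancel, Real.exp_zero]
  have hinner : ∀ m n, ∫ x in D, φ m x * conj (φ n x) =
      (if m = n then (P.area : ℂ) else 0) * ((1 / (s m + s n) : ℝ) : ℂ) := by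
    intro m n
    rw [hD, restrict_cell_prod]
    have e : ∀ x : Space, φ m x * conj (φ n x) = (P.mode m x.1 * conj (P.mode n x.1)) *
        ((Real.exp ((s m + s n) * (x.2 - P.h)) : ℝ) : ℂ) := fun x => by
      simp only [hφ, map_mul, Complex.conj_ofReal]
      rw [add_mul, Real.exp_add]
      push_cast
      ring
    simp_rw [e]
    rw [integral_prod_mul (fun r => P.mode m r * conj (P.mode n r))
      (fun z : ℝ => ((Real.exp ((s m + s n) * (z - P.h)) : ℝ) : ℂ)), integral_mode_mul_conj,
      integral_complex_ofReal, (hexpint _ (add_pos (hs m) (hs n))).2]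
  have hcont : ∀ n, Continuous (φ n) := fun n => by
    simp only [hφ]
    exact ((P.continuous_mode n).comp continuous_fst).mul (by fun_prop)
  have hmem : ∀ n, MemLp (φ n) 2 (volume.restrict D) := fun n => by
    rw [memLp_two_iff_integrable_sq_norm (hcont n).aestronglyMeasurable]
    have e : (fun x => ‖φ n x‖ ^ 2) =
        fun x : Space => (1 : ℝ) * Real.exp (2 * s n * (x.2 - P.h)) := by
      funext x
      simp only [hφ, norm_mul, norm_mode, one_mul, Complex.norm_real, Real.norm_eq_abs,
        Real.abs_exp]
      rw [← Real.exp_nat_mul]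
      congr 1
      push_cast
      ring
    rw [e, hD, restrict_cell_prod]
    exact (integrable_const (1 : ℝ)).mul_prod (hexpint _ (by linarith [hs n])).1
  set c : ℤ × ℤ → ℝ := fun n => Real.sqrt (2 * s n / P.area) with hc
  have hc2 : ∀ n, c n ^ 2 = 2 * s n / P.area := fun n =>
    Real.sq_sqrt (div_nonneg (by linarith [hs n]) hA.le)
  have hL : ∀ n, MemLp (fun x => (c n : ℂ) * φ n x) 2 (volume.restrict D) := fun n =>
    (hmem n).const_mul _
  have hin : ∀ {f g : Space → ℂ} (hf : MemLp f 2 (volume.restrict D))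
      (hg : MemLp g 2 (volume.restrict D)),
      inner ℂ (hf.toLp f) (hg.toLp g) = ∫ x in D, g x * conj (f x) := fun {f g} hf hg => by
    rw [L2.inner_def]
    refine integral_congr_ae ?_
    filter_upwards [hf.coeFn_toLp, hg.coeFn_toLp] with x h1 h2
    rw [h1, h2, RCLike.inner_apply]
  have horth : Orthonormal ℂ (fun n => (hL n).toLp _) := by
    rw [orthonormal_iff_ite]
    intro m n
    rw [hin]
    have e : ∀ x, (c n : ℂ) * φ n x * conj ((c m : ℂ) * φ m x) =
        ((c n * c m : ℝ) : ℂ) * (φ n x * conj (φ m x)) := fun x => by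
      rw [map_mul, Complex.conj_ofReal]; push_cast; ring
    simp_rw [e]
    rw [integral_const_mul, hinner]
    by_cases hmn : m = n
    · subst hmn
      have : c m * c m * (P.area * (1 / (s m + s m))) = 1 := by
        rw [← sq, hc2]
        have := hs m
        field_simp
        ring
      rw [if_pos rfl, if_pos rfl]
      exact_mod_cast this
    · rw [if_neg (Ne.symm hmn), if_neg hmn, zero_mul, mul_zero]
  have hU := P.memLp_zeroExt P.Ω_subset_cylinder hu
  have key := horth.sum_inner_products_le (hU.toLp _) (s := F)
  have hnorm : ‖hU.toLp _‖ ^ 2 = ∫ x in P.Ω, ‖u x‖ ^ 2 := by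
    rw [← integral_norm_sq_zeroExt P P.Ω_subset_cylinder]
    have h1 : ((‖hU.toLp _‖ ^ 2 : ℝ) : ℂ) = inner ℂ (hU.toLp _) (hU.toLp _) := by
      rw [inner_self_eq_norm_sq_to_K]; norm_cast
    rw [hin] at h1
    have e : ∀ x, P.Ω.indicator u x * conj (P.Ω.indicator u x) =
        ((‖P.Ω.indicator u x‖ ^ 2 : ℝ) : ℂ) := fun x => by
      rw [Complex.mul_conj, Complex.normSq_eq_norm_sq]
    simp_rw [e] at h1
    rw [integral_complex_ofReal] at h1
    exact_mod_cast h1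
  rw [hnorm] at key
  refine le_trans (le_of_eq (Finset.sum_congr rfl fun n _ => ?_)) key
  rw [hin]
  have e : ∀ x, P.Ω.indicator u x * conj ((c n : ℂ) * φ n x) =
      (c n : ℂ) * (P.Ω.indicator u x * conj (φ n x)) := fun x => by
    rw [map_mul, Complex.conj_ofReal]; ring
  simp_rw [e]
  rw [integral_const_mul, integral_zeroExt P P.Ω_subset_cylinder, norm_mul, mul_pow,
    Complex.norm_real, Real.norm_eq_abs, sq_abs, hc2]

/-! ### Green's formula for single modes -/

/-- The separated function `exp(i α⁽ⁿ⁾·r) g(x₃)`. -/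
def sepFun (n : ℤ × ℤ) (g : ℝ → ℂ) (x : Space) : ℂ := P.mode n x.1 * g x.2

lemma contDiff_sepFun (n : ℤ × ℤ) {g : ℝ → ℂ} (hg : ContDiff ℝ (⊤ : ℕ∞) g) :
    ContDiff ℝ (⊤ : ℕ∞) (P.sepFun n g) := by
  refine ContDiff.mul ?_ (hg.comp contDiff_snd)
  have h : ContDiff ℝ (⊤ : ℕ∞) (fun x : Space => P.αn₁ n * x.1.1 + P.αn₂ n * x.1.2) := by fun_prop
  exact Complex.contDiff_exp.comp (contDiff_const.mul (Complex.ofRealCLM.contDiff.comp h))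

lemma mode_translate (n k : ℤ × ℤ) (r : ℝ × ℝ) :
    P.mode n (r.1 + k.1 * P.Λ₁, r.2 + k.2 * P.Λ₂) = P.mode n r * Complex.exp (Complex.I *
      ((k.1 * P.α₁ * P.Λ₁ + k.2 * P.α₂ * P.Λ₂ : ℝ) : ℂ)) := by
  have h1 := P.Λ₁_pos.ne'
  have h2 := P.Λ₂_pos.ne'
  have e : Complex.I * ((P.αn₁ n * (r.1 + k.1 * P.Λ₁) + P.αn₂ n * (r.2 + k.2 * P.Λ₂) : ℝ) : ℂ) =
      Complex.I * ((P.αn₁ n * r.1 + P.αn₂ n * r.2 : ℝ) : ℂ) + Complex.I *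
      ((k.1 * P.α₁ * P.Λ₁ + k.2 * P.α₂ * P.Λ₂ : ℝ) : ℂ) +
      ((n.1 * k.1 + n.2 * k.2 : ℤ) : ℂ) * (2 * Real.pi * Complex.I) := by
    have : P.αn₁ n * (r.1 + k.1 * P.Λ₁) + P.αn₂ n * (r.2 + k.2 * P.Λ₂) =
        (P.αn₁ n * r.1 + P.αn₂ n * r.2) + (k.1 * P.α₁ * P.Λ₁ + k.2 * P.α₂ * P.Λ₂) +
        (n.1 * k.1 + n.2 * k.2) * (2 * Real.pi) := by
      simp only [αn₁, αn₂]
      field_simp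
      ring
    rw [this]
    push_cast
    ring
  simp only [mode]
  rw [e, Complex.exp_add, Complex.exp_int_mul_two_pi_mul_I, mul_one, Complex.exp_add]

lemma isTest_sepFun (n : ℤ × ℤ) {g : ℝ → ℂ} (hg : ContDiff ℝ (⊤ : ℕ∞) g) :
    P.IsTest (P.sepFun n g) := by
  refine ⟨P.contDiff_sepFun n hg, fun x k => ?_⟩
  simp only [sepFun]
  rw [mode_translate]
  ring

lemma hasDerivAt_exp_linear (c d a : ℝ) (t : ℝ) :
    HasDerivAt (fun t : ℝ => Complex.exp (Complex.I * ((c * (a + t) + d : ℝ) : ℂ)))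
      (Complex.I * c * Complex.exp (Complex.I * ((c * (a + t) + d : ℝ) : ℂ))) t := by
  have h1 : HasDerivAt (fun t : ℝ => c * (a + t) + d) c t := by
    simpa using (((hasDerivAt_id t).const_add a).const_mul c).add_const d
  have h2 := (h1.ofReal_comp.const_mul Complex.I).cexp
  convert h2 using 1
  ring

lemma fderiv_sepFun_zero (n : ℤ × ℤ) {g : ℝ → ℂ} (hg : ContDiff ℝ (⊤ : ℕ∞) g) (x : Space) :
    fderiv ℝ (P.sepFun n g) x (unitVec 0) = Complex.I * P.αn₁ n * P.sepFun n g x := by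
  have hd : DifferentiableAt ℝ (P.sepFun n g) x :=
    ((P.contDiff_sepFun n hg).differentiable (by simp)).differentiableAt
  rw [← hd.lineDeriv_eq_fderiv]
  have h := (hasDerivAt_exp_linear (P.αn₁ n) (P.αn₂ n * x.1.2) x.1.1 0).mul_const (g x.2)
  have e : (fun t : ℝ => P.sepFun n g (x + t • unitVec 0)) = fun t : ℝ =>
      Complex.exp (Complex.I * ((P.αn₁ n * (x.1.1 + t) + P.αn₂ n * x.1.2 : ℝ) : ℂ)) * g x.2 := by
    funext t
    simp [sepFun, mode, unitVec]
  rw [lineDeriv, e, h.deriv]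
  simp only [sepFun, mode, add_zero]
  ring

lemma fderiv_sepFun_one (n : ℤ × ℤ) {g : ℝ → ℂ} (hg : ContDiff ℝ (⊤ : ℕ∞) g) (x : Space) :
    fderiv ℝ (P.sepFun n g) x (unitVec 1) = Complex.I * P.αn₂ n * P.sepFun n g x := by
  have hd : DifferentiableAt ℝ (P.sepFun n g) x :=
    ((P.contDiff_sepFun n hg).differentiable (by simp)).differentiableAt
  rw [← hd.lineDeriv_eq_fderiv]
  have h := (hasDerivAt_exp_linear (P.αn₂ n) (P.αn₁ n * x.1.1) x.1.2 0).mul_const (g x.2)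
  have e : (fun t : ℝ => P.sepFun n g (x + t • unitVec 1)) = fun t : ℝ =>
      Complex.exp (Complex.I * ((P.αn₂ n * (x.1.2 + t) + P.αn₁ n * x.1.1 : ℝ) : ℂ)) * g x.2 := by
    funext t
    simp [sepFun, mode, unitVec, add_comm]
  rw [lineDeriv, e, h.deriv]
  simp only [sepFun, mode, add_zero]
  rw [add_comm (P.αn₂ n * x.1.2)]
  ring

lemma fderiv_sepFun_two (n : ℤ × ℤ) {g : ℝ → ℂ} (hg : ContDiff ℝ (⊤ : ℕ∞) g) (x : Space) :
    fderiv ℝ (P.sepFun n g) x (unitVec 2) = P.sepFun n (deriv g) x := by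
  have hd : DifferentiableAt ℝ (P.sepFun n g) x :=
    ((P.contDiff_sepFun n hg).differentiable (by simp)).differentiableAt
  rw [← hd.lineDeriv_eq_fderiv]
  have hg' : HasDerivAt g (deriv g x.2) (x.2 + 0) := by
    rw [add_zero]
    exact ((hg.differentiable (by simp)).differentiableAt).hasDerivAt
  have h := (hg'.comp_const_add x.2 0).const_mul (P.mode n x.1)
  have e : (fun t : ℝ => P.sepFun n g (x + t • unitVec 2)) = fun t : ℝ =>
      P.mode n x.1 * g (x.2 + t) := by
    funext t
    have e0 : x.1 + ((0 : ℝ), (0 : ℝ)) = x.1 := add_zero x.1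
    simp [sepFun, unitVec, e0]
  rw [lineDeriv, e, h.deriv]
  rfl

variable {P} in
lemma green_zero {u : P.Triple} (hu : u ∈ P.H1qp) (n : ℤ × ℤ) {g : ℝ → ℂ}
    (hg : ContDiff ℝ (⊤ : ℕ∞) g) :
    ∫ x in P.Ω, u.2.1 0 x * conj (P.sepFun n g x) =
      Complex.I * P.αn₁ n * ∫ x in P.Ω, u.1 x * conj (P.sepFun n g x) := by
  have h := hu _ (P.isTest_sepFun n hg) 0
  simp_rw [fderiv_sepFun_zero P n hg] at h
  rw [if_neg (by decide), add_zero] at h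
  rw [← integral_const_mul, eq_comm, ← neg_inj, ← h, ← integral_neg]
  congr 1
  funext x
  simp only [map_mul, Complex.conj_I, Complex.conj_ofReal]
  ring

variable {P} in
lemma green_one {u : P.Triple} (hu : u ∈ P.H1qp) (n : ℤ × ℤ) {g : ℝ → ℂ}
    (hg : ContDiff ℝ (⊤ : ℕ∞) g) :
    ∫ x in P.Ω, u.2.1 1 x * conj (P.sepFun n g x) =
      Complex.I * P.αn₂ n * ∫ x in P.Ω, u.1 x * conj (P.sepFun n g x) := by
  have h := hu _ (P.isTest_sepFun n hg) 1
  simp_rw [fderiv_sepFun_one P n hg] at h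
  rw [if_neg (by decide), add_zero] at h
  rw [← integral_const_mul, eq_comm, ← neg_inj, ← h, ← integral_neg]
  congr 1
  funext x
  simp only [map_mul, Complex.conj_I, Complex.conj_ofReal]
  ring

variable {P} in
lemma green_two {u : P.Triple} (hu : u ∈ P.H1qp) (n : ℤ × ℤ) {g : ℝ → ℂ}
    (hg : ContDiff ℝ (⊤ : ℕ∞) g) :
    ∫ x in P.Ω, u.1 x * conj (P.sepFun n (deriv g) x) =
      -(∫ x in P.Ω, u.2.1 2 x * conj (P.sepFun n g x)) +
        conj (g P.h) * (P.area * P.coeff u.2.2 n) := by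
  have h := hu _ (P.isTest_sepFun n hg) 2
  simp_rw [fderiv_sepFun_two P n hg] at h
  rw [if_pos trivial] at h
  rw [h, coeff_eq, ← integral_const_mul]
  congr 2
  funext r
  simp only [sepFun, map_mul]
  ring

/-! ### The trace inequality and compactness -/

/-- The square of the `H¹(Ω)` norm of a scalar function. -/
def energy (u : P.Triple) : ℝ :=
  (∫ x in P.Ω, ‖u.1 x‖ ^ 2) + ∑ j, ∫ x in P.Ω, ‖u.2.1 j x‖ ^ 2

lemma integral_norm_sq_nonneg {X : Type*} [MeasurableSpace X] (ν : Measure X) (g : X → ℂ) :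
    0 ≤ ∫ x, ‖g x‖ ^ 2 ∂ν := integral_nonneg fun x => by positivity

lemma energy_nonneg (u : P.Triple) : 0 ≤ P.energy u :=
  add_nonneg (integral_norm_sq_nonneg _ _)
    (Finset.sum_nonneg fun _ _ => integral_norm_sq_nonneg _ _)

lemma integral_partial_le_energy (u : P.Triple) (j : Fin 3) :
    ∫ x in P.Ω, ‖u.2.1 j x‖ ^ 2 ≤ P.energy u := by
  have h1 := Finset.single_le_sum (f := fun j => ∫ x in P.Ω, ‖u.2.1 j x‖ ^ 2)
    (fun _ _ => integral_norm_sq_nonneg _ _) (Finset.mem_univ j)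
  have h2 := integral_norm_sq_nonneg (volume.restrict P.Ω) u.1
  unfold energy
  linarith

/-- The weight `(1 + |α⁽ⁿ⁾|²)^{1/2}` of the trace space `H^{1/2}`. -/
def weight (n : ℤ × ℤ) : ℝ := Real.sqrt (1 + P.αabs n ^ 2)

lemma weight_sq (n : ℤ × ℤ) : P.weight n ^ 2 = 1 + P.αabs n ^ 2 := Real.sq_sqrt (by positivity)

lemma one_le_weight (n : ℤ × ℤ) : 1 ≤ P.weight n :=
  Real.le_sqrt_of_sq_le (by nlinarith [sq_nonneg (P.αabs n)])

variable {P} in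
/-- The trace inequality `H¹ → H^{1/2}` with constant one. Each Fourier coefficient of the trace is
computed by Green's formula with the test function `exp(i α⁽ⁿ⁾·r) exp(sₙ (x₃ - h))`, where
`sₙ² = 1 + |α⁽ⁿ⁾|²`. -/
theorem sum_weight_coeff_le {u : P.Triple} (hu : u ∈ P.H1qp) (F : Finset (ℤ × ℤ)) :
    ∑ n ∈ F, P.weight n * (P.area * ‖P.coeff u.2.2 n‖ ^ 2) ≤ P.energy u := by
  have hA := P.area_pos
  have hs : ∀ n, 0 < P.weight n := fun n => one_pos.trans_le (P.one_le_weight n)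
  set g : ℤ × ℤ → ℝ → ℂ := fun n z => (Real.exp (P.weight n * (z - P.h)) : ℂ) with hgdef
  have hg : ∀ n, ContDiff ℝ (⊤ : ℕ∞) (g n) := fun n => by
    refine Complex.ofRealCLM.contDiff.comp (Real.contDiff_exp.comp ?_)
    fun_prop
  have hg' : ∀ n, deriv (g n) = fun z => (P.weight n : ℂ) * g n z := fun n => by
    funext z
    have h1 : HasDerivAt (fun z => P.weight n * (z - P.h)) (P.weight n) z := by
      simpa using ((hasDerivAt_id z).sub_const P.h).const_mul (P.weight n)
    have := h1.exp.ofReal_comp.deriv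
    rw [hgdef]
    refine this.trans ?_
    push_cast
    ring
  have hterm : ∀ n, P.weight n * (P.area * ‖P.coeff u.2.2 n‖ ^ 2) ≤ 2 * P.weight n / P.area *
      (‖∫ x in P.Ω, u.1 x * conj (P.sepFun n (g n) x)‖ ^ 2 +
        ∑ j, ‖∫ x in P.Ω, u.2.1 j x * conj (P.sepFun n (g n) x)‖ ^ 2) := by
    intro n
    have h0 := congrArg norm (green_zero hu n (hg n))
    have h1 := congrArg norm (green_one hu n (hg n))
    have h2 := green_two hu n (hg n)
    have e : ∀ x, P.sepFun n (deriv (g n)) x = (P.weight n : ℂ) * P.sepFun n (g n) x := fun x => by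
      simp only [sepFun, hg']; ring
    have e2 : ∀ x, u.1 x * conj ((P.weight n : ℂ) * P.sepFun n (g n) x) =
        (P.weight n : ℂ) * (u.1 x * conj (P.sepFun n (g n) x)) := fun x => by
      rw [map_mul, Complex.conj_ofReal]; ring
    have e3 : conj (g n P.h) = 1 := by simp [hgdef]
    simp_rw [e, e2] at h2
    rw [integral_const_mul, e3, one_mul] at h2
    rw [norm_mul, norm_mul, Complex.norm_I, one_mul, Complex.norm_real, Real.norm_eq_abs] at h0 h1
    rw [Fin.sum_univ_three, h0, h1]
    set X := ∫ x in P.Ω, u.1 x * conj (P.sepFun n (g n) x)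
    set Z := ∫ x in P.Ω, u.2.1 2 x * conj (P.sepFun n (g n) x)
    have h3 : (P.area : ℂ) * P.coeff u.2.2 n = P.weight n * X + Z := by
      rw [h2]; ring
    have h4 : P.area * ‖P.coeff u.2.2 n‖ ≤ P.weight n * ‖X‖ + ‖Z‖ := by
      have := congrArg norm h3
      rw [norm_mul, Complex.norm_real, Real.norm_of_nonneg hA.le] at this
      rw [this]
      refine (norm_add_le _ _).trans_eq ?_
      rw [norm_mul, Complex.norm_real, Real.norm_of_nonneg (hs n).le]
    have h5 : (P.area * ‖P.coeff u.2.2 n‖) ^ 2 ≤ (P.weight n * ‖X‖ + ‖Z‖) ^ 2 := by gcongr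
    have h6 := P.weight_sq n
    have h7 := P.αabs_sq n
    have h8 : (P.area * ‖P.coeff u.2.2 n‖) ^ 2 ≤ 2 * (‖X‖ ^ 2 +
        ((|P.αn₁ n| * ‖X‖) ^ 2 + (|P.αn₂ n| * ‖X‖) ^ 2 + ‖Z‖ ^ 2)) := by
      refine h5.trans ?_
      rw [mul_pow, mul_pow, sq_abs, sq_abs]
      have : (P.weight n * ‖X‖) ^ 2 = ‖X‖ ^ 2 + P.αn₁ n ^ 2 * ‖X‖ ^ 2 + P.αn₂ n ^ 2 * ‖X‖ ^ 2 := by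
        rw [mul_pow, h6, h7]; ring
      nlinarith [sq_nonneg (P.weight n * ‖X‖ - ‖Z‖)]
    calc P.weight n * (P.area * ‖P.coeff u.2.2 n‖ ^ 2)
        = P.weight n / P.area * (P.area * ‖P.coeff u.2.2 n‖) ^ 2 := by field_simp
      _ ≤ P.weight n / P.area * (2 * (‖X‖ ^ 2 +
        ((|P.αn₁ n| * ‖X‖) ^ 2 + (|P.αn₂ n| * ‖X‖) ^ 2 + ‖Z‖ ^ 2))) := by
          have := hs n
          gcongr
      _ = _ := by ring
  have hb : ∀ v : P.L2Ω, ∑ n ∈ F, 2 * P.weight n / P.area *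
      ‖∫ x in P.Ω, v x * conj (P.sepFun n (g n) x)‖ ^ 2 ≤ ∫ x in P.Ω, ‖v x‖ ^ 2 := fun v =>
    P.bessel_exp hs (Lp.memLp v) F
  refine (Finset.sum_le_sum fun n _ => hterm n).trans ?_
  simp_rw [mul_add, Finset.mul_sum]
  rw [Finset.sum_add_distrib, Finset.sum_comm]
  exact add_le_add (hb _) (Finset.sum_le_sum fun j _ => hb _)

variable {P} in
lemma area_coeff_le {u : P.Triple} (hu : u ∈ P.H1qp) (n : ℤ × ℤ) :
    P.area * ‖P.coeff u.2.2 n‖ ^ 2 ≤ P.energy u := by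
  have h := sum_weight_coeff_le hu {n}
  rw [Finset.sum_singleton] at h
  have := P.one_le_weight n
  have h2 : 0 ≤ P.area * ‖P.coeff u.2.2 n‖ ^ 2 := mul_nonneg P.area_pos.le (by positivity)
  nlinarith

/-- The coefficient of `u` with respect to an exponential of the box around `Ω`. -/
def boxCoeff (i : (ℤ × ℤ) × ℤ) (u : Space → ℂ) : ℂ :=
  ∫ x in P.Ω, u x * conj (P.mode i.1 x.1 * P.vmode i.2 x.2)

lemma contDiff_vmode (k : ℤ) : ContDiff ℝ (⊤ : ℕ∞) (P.vmode k) := by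
  have h : ContDiff ℝ (⊤ : ℕ∞) (fun z : ℝ => 2 * Real.pi * k / (P.h - P.bottom) * z) := by fun_prop
  exact Complex.contDiff_exp.comp (contDiff_const.mul (Complex.ofRealCLM.contDiff.comp h))

lemma deriv_vmode (k : ℤ) : deriv (P.vmode k) = fun z =>
    Complex.I * ((2 * Real.pi * k / (P.h - P.bottom) : ℝ) : ℂ) * P.vmode k z := by
  funext z
  have h := hasDerivAt_exp_linear (2 * Real.pi * k / (P.h - P.bottom)) 0 0 z
  simp only [zero_add, add_zero] at h
  exact h.deriv

variable {P} in
/-- Decay of the coefficients in the horizontal frequencies. -/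
lemma boxCoeff_horizontal {u : P.Triple} (hu : u ∈ P.H1qp) (i : (ℤ × ℤ) × ℤ) :
    P.αabs i.1 ^ 2 * ‖P.boxCoeff i u.1‖ ^ 2 =
      ‖P.boxCoeff i (u.2.1 0)‖ ^ 2 + ‖P.boxCoeff i (u.2.1 1)‖ ^ 2 := by
  have h0 : P.boxCoeff i (u.2.1 0) = Complex.I * P.αn₁ i.1 * P.boxCoeff i u.1 :=
    green_zero hu i.1 (P.contDiff_vmode i.2)
  have h1 : P.boxCoeff i (u.2.1 1) = Complex.I * P.αn₂ i.1 * P.boxCoeff i u.1 :=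
    green_one hu i.1 (P.contDiff_vmode i.2)
  rw [h0, h1, norm_mul, norm_mul, norm_mul, norm_mul, Complex.norm_I, one_mul, one_mul,
    Complex.norm_real, Complex.norm_real, Real.norm_eq_abs, Real.norm_eq_abs, mul_pow, mul_pow,
    sq_abs, sq_abs, αabs_sq, add_mul]

lemma boxCoeff_sq_le (v : P.L2Ω) (i : (ℤ × ℤ) × ℤ) :
    ‖P.boxCoeff i v‖ ^ 2 ≤ P.boxVol * ∫ x in P.Ω, ‖v x‖ ^ 2 :=
  le_hasSum (P.hasSum_box (Lp.memLp v)) i fun j _ => by positivity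

variable {P} in
/-- Decay of the coefficients in the vertical frequencies. The exponentials are not adapted to the
boundary values on `Γ_h`, so the coefficients themselves decay only like `1/k`, their squares like
`1/k²`. -/
lemma boxCoeff_vertical {u : P.Triple} (hu : u ∈ P.H1qp) (i : (ℤ × ℤ) × ℤ) :
    (2 * Real.pi * i.2 / (P.h - P.bottom)) ^ 2 * ‖P.boxCoeff i u.1‖ ^ 2 ≤
      2 * (P.boxVol + P.area) * P.energy u := by
  have h := green_two hu i.1 (P.contDiff_vmode i.2)
  have e : ∀ x, u.1 x * conj (P.sepFun i.1 (deriv (P.vmode i.2)) x) =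
      conj (Complex.I * ((2 * Real.pi * i.2 / (P.h - P.bottom) : ℝ) : ℂ)) *
        (u.1 x * conj (P.mode i.1 x.1 * P.vmode i.2 x.2)) := fun x => by
    simp only [sepFun, deriv_vmode, map_mul]; ring
  simp_rw [e] at h
  rw [integral_const_mul] at h
  have h' := congrArg norm h
  rw [norm_mul, RCLike.norm_conj, norm_mul, Complex.norm_I, one_mul, Complex.norm_real,
    Real.norm_eq_abs] at h'
  have h2 := norm_add_le (-(∫ x in P.Ω, u.2.1 2 x * conj (P.sepFun i.1 (P.vmode i.2) x)))
    (conj (P.vmode i.2 P.h) * (P.area * P.coeff u.2.2 i.1))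
  rw [← h', norm_neg, norm_mul, RCLike.norm_conj, norm_vmode, one_mul, norm_mul,
    Complex.norm_real, Real.norm_of_nonneg P.area_pos.le] at h2
  have h3 := area_coeff_le hu i.1
  have h4 : ‖∫ x in P.Ω, u.2.1 2 x * conj (P.sepFun i.1 (P.vmode i.2) x)‖ ^ 2 ≤ _ :=
    P.boxCoeff_sq_le (u.2.1 2) i
  have h5 := mul_le_mul_of_nonneg_left (P.integral_partial_le_energy u 2) P.boxVol_pos.le
  have h6 : (P.area * ‖P.coeff u.2.2 i.1‖) ^ 2 ≤ P.area * P.energy u := by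
    calc (P.area * ‖P.coeff u.2.2 i.1‖) ^ 2 = P.area * (P.area * ‖P.coeff u.2.2 i.1‖ ^ 2) := by ring
      _ ≤ _ := mul_le_mul_of_nonneg_left h3 P.area_pos.le
  have h7 := pow_le_pow_left₀ (by positivity) h2 2
  rw [mul_pow, sq_abs] at h7
  refine h7.trans ?_
  set a := ‖∫ x in P.Ω, u.2.1 2 x * conj (P.sepFun i.1 (P.vmode i.2) x)‖
  set b := P.area * ‖P.coeff u.2.2 i.1‖
  nlinarith [sq_nonneg (a - b)]

/-- Compactness of `H¹(Ω) → L²(Ω)`: up to a small multiple of the energy, the `L²` norm is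
controlled by finitely many coefficients. Horizontal frequencies `|α⁽ⁿ⁾| > R` are controlled by the
horizontal derivatives; for each of the finitely many others the vertical frequencies are summable,
because of the decay like `1/k²`. -/
theorem exists_finset_boxCoeff {ε : ℝ} (hε : 0 < ε) :
    ∃ H : Finset ((ℤ × ℤ) × ℤ), ∀ u ∈ P.H1qp,
      P.boxVol * ∫ x in P.Ω, ‖u.1 x‖ ^ 2 ≤
        ∑ i ∈ H, ‖P.boxCoeff i u.1‖ ^ 2 + ε * P.energy u := by
  have hV := P.boxVol_pos
  have hA := P.area_pos
  have hT : 0 < P.h - P.bottom := sub_pos.2 P.bottom_lt_h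
  have hπ := Real.pi_pos
  set R := Real.sqrt (4 * P.boxVol / ε) with hR
  have hR2 : R ^ 2 = 4 * P.boxVol / ε := Real.sq_sqrt (by positivity)
  have hRpos : 0 < R := Real.sqrt_pos.2 (by positivity)
  set F := (P.finite_αabs_le R).toFinset with hF
  set B := 2 * (P.boxVol + P.area) / (2 * Real.pi / (P.h - P.bottom)) ^ 2 with hB
  have hB0 : 0 < B := by positivity
  have hsum : Summable (fun k : ℤ => 1 / (k : ℝ) ^ 2) := Real.summable_one_div_int_pow.2 one_lt_two
  obtain ⟨I, hI⟩ := summable_iff_vanishing_norm.1 hsum (ε / (2 * (F.card * B + 1)))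
    (by positivity)
  refine ⟨F ×ˢ insert 0 I, fun u hu => ?_⟩
  have hE := P.energy_nonneg u
  refine hasSum_le_of_sum_le (P.hasSum_box (Lp.memLp u.1)) fun S => ?_
  change ∑ i ∈ S, ‖P.boxCoeff i u.1‖ ^ 2 ≤ _
  have hS : S ⊆ (F ×ˢ insert 0 I) ∪ (S.filter (fun i => i.1 ∉ F) ∪
      F ×ˢ ((S.image Prod.snd) \ insert 0 I)) := by
    intro i hi
    simp only [Finset.mem_union, Finset.mem_product, Finset.mem_filter, Finset.mem_sdiff,
      Finset.mem_image]
    by_cases h1 : i.1 ∈ F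
    · by_cases h2 : i.2 ∈ insert 0 I
      · exact Or.inl ⟨h1, h2⟩
      · exact Or.inr (Or.inr ⟨h1, ⟨i, hi, rfl⟩, h2⟩)
    · exact Or.inr (Or.inl ⟨hi, h1⟩)
  have hunion : ∀ S T : Finset ((ℤ × ℤ) × ℤ), ∑ i ∈ S ∪ T, ‖P.boxCoeff i u.1‖ ^ 2 ≤
      ∑ i ∈ S, ‖P.boxCoeff i u.1‖ ^ 2 + ∑ i ∈ T, ‖P.boxCoeff i u.1‖ ^ 2 := fun S T => by
    rw [← Finset.sum_union_inter]
    exact le_add_of_nonneg_right (Finset.sum_nonneg fun i _ => by positivity)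
  have hhor : ∑ i ∈ S.filter (fun i => i.1 ∉ F), ‖P.boxCoeff i u.1‖ ^ 2 ≤
      ε / 2 * P.energy u := by
    have h1 : ∀ i ∈ S.filter (fun i => i.1 ∉ F), ‖P.boxCoeff i u.1‖ ^ 2 ≤
        1 / R ^ 2 * (‖P.boxCoeff i (u.2.1 0)‖ ^ 2 + ‖P.boxCoeff i (u.2.1 1)‖ ^ 2) := by
      intro i hi
      have h2 : R < P.αabs i.1 := by
        have := (Finset.mem_filter.1 hi).2
        simpa [hF] using this
      rw [← boxCoeff_horizontal hu, one_div, ← div_eq_inv_mul, le_div_iff₀ (by positivity),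
        mul_comm]
      gcongr
    refine (Finset.sum_le_sum h1).trans ?_
    rw [← Finset.mul_sum, Finset.sum_add_distrib]
    have h3 : ∀ j, ∑ i ∈ S.filter (fun i => i.1 ∉ F), ‖P.boxCoeff i (u.2.1 j)‖ ^ 2 ≤
        P.boxVol * P.energy u := fun j =>
      (sum_le_hasSum _ (fun i _ => by positivity) (P.hasSum_box (Lp.memLp (u.2.1 j)))).trans
        (mul_le_mul_of_nonneg_left (P.integral_partial_le_energy u j) hV.le)
    calc _ ≤ 1 / R ^ 2 * (P.boxVol * P.energy u + P.boxVol * P.energy u) := by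
          gcongr
          · exact h3 0
          · exact h3 1
      _ = ε / 2 * P.energy u := by
          rw [hR2]; field_simp; ring
  have hver : ∑ i ∈ F ×ˢ ((S.image Prod.snd) \ insert 0 I), ‖P.boxCoeff i u.1‖ ^ 2 ≤
      ε / 2 * P.energy u := by
    set J := (S.image Prod.snd) \ insert 0 I with hJ
    have h1 : ∀ i ∈ F ×ˢ J, ‖P.boxCoeff i u.1‖ ^ 2 ≤ B * P.energy u * (1 / (i.2 : ℝ) ^ 2) := by
      intro i hi
      have h0 : i.2 ≠ 0 := by
        have := (Finset.mem_sdiff.1 (Finset.mem_product.1 hi).2).2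
        simp only [Finset.mem_insert, not_or] at this
        exact this.1
      have h0' : (0 : ℝ) < (i.2 : ℝ) ^ 2 := by positivity
      have h2 := boxCoeff_vertical hu i
      rw [mul_one_div, le_div_iff₀ h0', hB, div_mul_eq_mul_div, le_div_iff₀ (by positivity)]
      refine le_trans (le_of_eq ?_) h2
      field_simp
    have h2 : ∑ k ∈ J, 1 / (k : ℝ) ^ 2 ≤ ε / (2 * (F.card * B + 1)) := by
      have hdisj : Disjoint J I := by
        rw [Finset.disjoint_left]
        intro k hk hkI
        exact (Finset.mem_sdiff.1 hk).2 (Finset.mem_insert_of_mem hkI)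
      exact (le_abs_self _).trans (hI J hdisj).le
    calc _ ≤ ∑ i ∈ F ×ˢ J, B * P.energy u * (1 / (i.2 : ℝ) ^ 2) := Finset.sum_le_sum h1
      _ = F.card * (B * P.energy u * ∑ k ∈ J, 1 / (k : ℝ) ^ 2) := by
          rw [Finset.sum_product]
          simp only [Finset.sum_const, nsmul_eq_mul, Finset.mul_sum]
      _ ≤ F.card * (B * P.energy u * (ε / (2 * (F.card * B + 1)))) := by gcongr
      _ = (F.card * B) / (F.card * B + 1) * (ε / 2 * P.energy u) := by field_simp
      _ ≤ 1 * (ε / 2 * P.energy u) := by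
          gcongr
          rw [div_le_one (by positivity)]
          linarith
      _ = ε / 2 * P.energy u := one_mul _
  calc _ ≤ _ := Finset.sum_le_sum_of_subset_of_nonneg hS fun i _ _ => by positivity
    _ ≤ _ := hunion _ _
    _ ≤ _ := add_le_add_right (hunion _ _) _
    _ ≤ _ := by linarith

end Scattering

/-! ### Coercive operators up to finite rank -/

/-- An injective operator is surjective if it becomes coercive after adding an operator of finite
rank. With `U = T + R` invertible, `T x = g` amounts to `(1 - U⁻¹ R) x = U⁻¹ g`, which is solved in
the finite-dimensional range of `U⁻¹ R`. -/
theorem surjective_of_coercive_add_finiteRank {E : Type*} [NormedAddCommGroup E]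
    [InnerProductSpace ℂ E] [CompleteSpace E] (T R : E →L[ℂ] E)
    (hR : FiniteDimensional ℂ (LinearMap.range (R : E →ₗ[ℂ] E))) {c : ℝ} (hc : 0 < c)
    (h : ∀ x, c * ‖x‖ ^ 2 ≤ RCLike.re (inner ℂ x ((T + R) x))) (hT : ∀ x, T x = 0 → x = 0) :
    Function.Surjective T := by
  have hU : IsUnit (T + R) := by
    refine ContinuousLinearMap.isUnit_of_forall_le_norm_inner_map _ (c := ⟨c, hc.le⟩) hc fun x => ?_
    rw [mul_comm, norm_inner_symm]
    exact (h x).trans (RCLike.re_le_norm _)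
  have hbij := ContinuousLinearMap.isUnit_iff_bijective.1 hU
  set U : E ≃ₗ[ℂ] E := LinearEquiv.ofBijective ((T + R : E →L[ℂ] E) : E →ₗ[ℂ] E) hbij with hUdef
  have hUapp : ∀ x, U x = T x + R x := fun x => rfl
  set Q : E →ₗ[ℂ] E := U.symm.toLinearMap ∘ₗ (R : E →ₗ[ℂ] E) with hQ
  have hUQ : ∀ x, U (Q x) = R x := fun x => U.apply_symm_apply _
  set W := LinearMap.range Q with hW
  have hWfin : FiniteDimensional ℂ W := by
    rw [hW, hQ, LinearMap.range_comp]
    infer_instance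
  set L : W →ₗ[ℂ] W := LinearMap.id - (Q.codRestrict W fun x => ⟨x, rfl⟩) ∘ₗ W.subtype with hL
  have hLapp : ∀ y : W, ((L y : W) : E) = y - Q y := fun y => rfl
  have hLinj : Function.Injective L := by
    rw [← LinearMap.ker_eq_bot, LinearMap.ker_eq_bot']
    intro y hy
    have h1 : (y : E) = Q y := by
      have := hLapp y
      rw [hy] at this
      exact (sub_eq_zero.1 this.symm)
    have h2 := congrArg U h1
    rw [hUQ, hUapp] at h2
    exact Subtype.ext (hT _ (by simpa using h2))
  have hLsurj := LinearMap.injective_iff_surjective.1 hLinj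
  intro g
  obtain ⟨y, hy⟩ := hLsurj ⟨Q (U.symm g), _, rfl⟩
  have hy' : (y : E) - Q y = Q (U.symm g) := by rw [← hLapp, hy]
  refine ⟨U.symm g + y, ?_⟩
  have h3 := congrArg U hy'
  rw [map_sub, hUQ, hUQ, hUapp] at h3
  have h4 := U.apply_symm_apply g
  rw [hUapp] at h4
  rw [map_add]
  have h5 : T y = R (U.symm g) := by simpa using h3
  rw [h5, h4]

/-! ### Boundary pairings -/

/-- The Cauchy--Schwarz bound for a weighted Fourier pairing. -/
lemma summable_inner_symbol {ι : Type*} {a b : ι → Amp} {S : ι → Amp → Amp} {σ : ι → ℝ}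
    {A B C : ℝ} (hσ : ∀ n, 0 ≤ σ n) (hA : 0 ≤ A) (hB : 0 ≤ B) (hC : 0 ≤ C)
    (hS : ∀ n, ‖S n (a n)‖ ≤ C * σ n * ‖a n‖)
    (ha : ∀ F : Finset ι, ∑ n ∈ F, σ n * ‖a n‖ ^ 2 ≤ A ^ 2)
    (hb : ∀ F : Finset ι, ∑ n ∈ F, σ n * ‖b n‖ ^ 2 ≤ B ^ 2) :
    Summable (fun n => inner ℂ (b n) (S n (a n))) ∧
      ‖∑' n, inner ℂ (b n) (S n (a n))‖ ≤ C * (A * B) := by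
  have key : ∀ F : Finset ι, ∑ n ∈ F, ‖inner ℂ (b n) (S n (a n))‖ ≤ C * (A * B) := by
    intro F
    calc ∑ n ∈ F, ‖inner ℂ (b n) (S n (a n))‖
        ≤ ∑ n ∈ F, C * ((Real.sqrt (σ n) * ‖a n‖) * (Real.sqrt (σ n) * ‖b n‖)) := by
          refine Finset.sum_le_sum fun n _ => ?_
          calc ‖inner ℂ (b n) (S n (a n))‖ ≤ ‖b n‖ * ‖S n (a n)‖ := norm_inner_le_norm _ _
            _ ≤ ‖b n‖ * (C * σ n * ‖a n‖) := by gcongr; exact hS n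
            _ = C * ((Real.sqrt (σ n) * Real.sqrt (σ n)) * ‖a n‖ * ‖b n‖) := by
                rw [Real.mul_self_sqrt (hσ n)]; ring
            _ = _ := by ring
      _ = C * ∑ n ∈ F, (Real.sqrt (σ n) * ‖a n‖) * (Real.sqrt (σ n) * ‖b n‖) := by
          rw [Finset.mul_sum]
      _ ≤ C * (Real.sqrt (∑ n ∈ F, (Real.sqrt (σ n) * ‖a n‖) ^ 2) *
            Real.sqrt (∑ n ∈ F, (Real.sqrt (σ n) * ‖b n‖) ^ 2)) := by
          gcongr
          exact Real.sum_mul_le_sqrt_mul_sqrt _ _ _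
      _ ≤ C * (A * B) := by
          simp_rw [mul_pow, Real.sq_sqrt (hσ _)]
          gcongr
          · exact Real.sqrt_le_iff.2 ⟨hA, ha F⟩
          · exact Real.sqrt_le_iff.2 ⟨hB, hb F⟩
  have hs : Summable (fun n => ‖inner ℂ (b n) (S n (a n))‖) :=
    summable_of_sum_le (fun n => norm_nonneg _) key
  exact ⟨hs.of_norm, (norm_tsum_le_tsum_norm hs).trans
    (hs.tsum_le_of_sum_le key)⟩

/-- The action of a matrix on amplitudes. -/
def symbolMap (N : Matrix (Fin 3) (Fin 3) ℂ) : Amp →L[ℂ] Amp := Matrix.toEuclideanCLM (𝕜 := ℂ) N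

lemma symbolMap_apply (N : Matrix (Fin 3) (Fin 3) ℂ) (a : Amp) :
    symbolMap N a = WithLp.toLp 2 (N.mulVec a.ofLp) := rfl

lemma symbolMap_sub (N N' : Matrix (Fin 3) (Fin 3) ℂ) (a : Amp) :
    symbolMap (N - N') a = symbolMap N a - symbolMap N' a := by
  simp [symbolMap]

namespace Scattering

variable (P : Scattering)

/-- The vector of the `n`-th Fourier coefficients. -/
def ampCoeff (w : Fin 3 → ℝ × ℝ → ℂ) (n : ℤ × ℤ) : Amp := WithLp.toLp 2 fun k => P.coeff (w k) n

lemma pairing_eq (S : ℤ × ℤ → Matrix (Fin 3) (Fin 3) ℂ) (w z : Fin 3 → ℝ × ℝ → ℂ) :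
    P.pairing S w z =
      (P.area : ℂ) * ∑' n, inner ℂ (P.ampCoeff z n) (symbolMap (S n) (P.ampCoeff w n)) := by
  rfl

lemma tractionUp_inner {n : ℤ × ℤ} (w : Amp) :
    inner ℂ w (P.tractionUp n w) = -P.β₂ n * (‖w‖ : ℂ) ^ 2 +
      (P.β₂ n - P.β₁ n) / P.χ n * bdot (P.wave n (P.β₂ n)) w * inner ℂ w (P.wave n (-P.β₂ n)) := by
  rw [tractionUp, rankOneUpdate_apply, inner_add_right, inner_smul_right, inner_smul_right,
    inner_self_eq_norm_sq_to_K]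
  rfl

/-- The exact boundary operator is dissipative on evanescent modes. -/
lemma re_inner_M_le {n : ℤ × ℤ} (h : P.κ₂ ≤ P.αabs n) (w : Amp) :
    RCLike.re (inner ℂ w (symbolMap (P.M n) w)) ≤ 0 := by
  have h1 := P.κ₁_pos
  have h2 := P.κ₂_pos
  have h12 := P.κ₁_lt_κ₂
  have c2 := h.not_gt
  have c1 := (h12.le.trans h).not_gt
  have e1 := P.Δ_sq_of_not_lt h1.le c1
  have e2 := P.Δ_sq_of_not_lt h2.le c2
  have hΔ₁ := P.Δ_nonneg P.κ₁ n
  have hΔ₂ := P.Δ_nonneg P.κ₂ n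
  have d12 : P.Δ P.κ₂ n ≤ P.Δ P.κ₁ n := by nlinarith
  have hχ : P.χ n = ((P.αabs n ^ 2 - P.Δ P.κ₁ n * P.Δ P.κ₂ n : ℝ) : ℂ) := by
    rw [χ, β₁, β₂, β_of_not_lt P h1.le c1, β_of_not_lt P h2.le c2]
    push_cast
    linear_combination (P.Δ P.κ₁ n : ℂ) * (P.Δ P.κ₂ n : ℂ) * Complex.I_sq
  have hχ0 : 0 < P.αabs n ^ 2 - P.Δ P.κ₁ n * P.Δ P.κ₂ n := by
    nlinarith [sq_nonneg (P.Δ P.κ₁ n - P.Δ P.κ₂ n)]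
  have hχne : P.χ n ≠ 0 := by rw [hχ]; exact_mod_cast hχ0.ne'
  have hw : inner ℂ w (P.wave n (-P.β₂ n)) = conj (bdot (P.wave n (P.β₂ n)) w) := by
    rw [β₂, β_of_not_lt P h2.le c2]
    simp only [PiLp.inner_apply, RCLike.inner_apply, bdot, Fin.sum_univ_three, wave, amp_zero,
      amp_one, amp_two, map_add, map_mul, Complex.conj_ofReal, Complex.conj_I]
    ring
  set t := bdot (P.wave n (P.β₂ n)) w with ht
  have ht2 : t * conj t = ((‖t‖ ^ 2 : ℝ) : ℂ) := by
    rw [Complex.mul_conj, Complex.normSq_eq_norm_sq]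
  have e : inner ℂ w (symbolMap (P.M n) w) = ((-(P.μ * (P.Δ P.κ₂ n * ‖w‖ ^ 2 +
      (P.Δ P.κ₁ n - P.Δ P.κ₂ n) / (P.αabs n ^ 2 - P.Δ P.κ₁ n * P.Δ P.κ₂ n) * ‖t‖ ^ 2)) : ℝ) : ℂ) := by
    rw [symbolMap_apply, M_mulVec P hχne, map_smul, inner_smul_right, inner_smul_right]
    change (P.μ : ℂ) * (-Complex.I * inner ℂ w (P.tractionUp n w)) = _
    rw [tractionUp_inner, hw, mul_assoc _ t, ht2, hχ, β₁, β₂, β_of_not_lt P h1.le c1,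
      β_of_not_lt P h2.le c2]
    push_cast
    linear_combination ((P.μ : ℂ) * (P.Δ P.κ₂ n * (‖w‖ : ℂ) ^ 2 +
      (P.Δ P.κ₁ n - P.Δ P.κ₂ n) / ((P.αabs n : ℂ) ^ 2 - P.Δ P.κ₁ n * P.Δ P.κ₂ n) *
        (‖t‖ : ℂ) ^ 2)) * Complex.I_sq
  rw [e, RCLike.re_eq_complex_re, Complex.ofReal_re, neg_nonpos]
  have := P.μ_pos
  have : 0 ≤ (P.Δ P.κ₁ n - P.Δ P.κ₂ n) / (P.αabs n ^ 2 - P.Δ P.κ₁ n * P.Δ P.κ₂ n) :=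
    div_nonneg (by linarith) hχ0.le
  positivity

/-- Symbols of order one, which act boundedly from `H^{1/2}` to `H^{-1/2}`. -/
def Admissible (S : ℤ × ℤ → Matrix (Fin 3) (Fin 3) ℂ) : Prop :=
  ∃ C : ℝ, 0 ≤ C ∧ ∀ n (a : Amp), ‖symbolMap (S n) a‖ ≤ C * P.weight n * ‖a‖

variable {P} in
lemma Admissible.of_finite {S : ℤ × ℤ → Matrix (Fin 3) (Fin 3) ℂ} {F : Set (ℤ × ℤ)}
    (hF : F.Finite) {C : ℝ} (hC : 0 ≤ C)
    (h : ∀ n ∉ F, ∀ a : Amp, ‖symbolMap (S n) a‖ ≤ C * P.weight n * ‖a‖) : P.Admissible S := by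
  refine ⟨C + ∑ n ∈ hF.toFinset, ‖symbolMap (S n)‖, by positivity, fun n a => ?_⟩
  have hw := P.one_le_weight n
  have hsum : 0 ≤ ∑ n ∈ hF.toFinset, ‖symbolMap (S n)‖ := by positivity
  by_cases hn : n ∈ F
  · have h1 : ‖symbolMap (S n)‖ ≤ ∑ n ∈ hF.toFinset, ‖symbolMap (S n)‖ :=
      Finset.single_le_sum (f := fun n => ‖symbolMap (S n)‖) (fun _ _ => norm_nonneg _)
        (hF.mem_toFinset.2 hn)
    calc ‖symbolMap (S n) a‖ ≤ ‖symbolMap (S n)‖ * ‖a‖ := ContinuousLinearMap.le_opNorm _ _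
      _ ≤ _ := by
        gcongr
        nlinarith
  · refine (h n hn a).trans ?_
    gcongr
    linarith

lemma admissible_M : P.Admissible P.M := by
  have h1 := P.κ₁_pos
  have h2 := P.κ₂_pos
  have h12 := P.κ₁_lt_κ₂
  have hμ := P.μ_pos
  refine Admissible.of_finite (P.finite_αabs_le (2 * P.κ₂))
    (C := P.μ * (1 + 2 * P.κ₂ ^ 2 / P.κ₁ ^ 2)) (by positivity) fun n hn a => ?_
  have hn' : 2 * P.κ₂ < P.αabs n := not_le.1 hn
  have hα : 0 < P.αabs n := by linarith
  have c2 : ¬ P.αabs n < P.κ₂ := by linarith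
  have c1 : ¬ P.αabs n < P.κ₁ := by linarith
  have e1 := P.Δ_sq_of_not_lt h1.le c1
  have e2 := P.Δ_sq_of_not_lt h2.le c2
  have hΔ₁ := P.Δ_nonneg P.κ₁ n
  have hΔ₂ := P.Δ_nonneg P.κ₂ n
  have d2 : P.Δ P.κ₂ n ≤ P.αabs n := by nlinarith
  have g1 : P.αabs n / 2 ≤ P.Δ P.κ₁ n := by nlinarith
  have g2 : P.αabs n / 2 ≤ P.Δ P.κ₂ n := by nlinarith
  have d12 : P.Δ P.κ₂ n ≤ P.Δ P.κ₁ n := by nlinarith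
  have hχ := P.κ₁_sq_le_norm_χ n
  have hχ0 : 0 < ‖P.χ n‖ := lt_of_lt_of_le (by positivity) hχ
  have hχne : P.χ n ≠ 0 := norm_pos_iff.1 hχ0
  have hdiff : ‖P.β₂ n - P.β₁ n‖ ≤ P.κ₂ ^ 2 / P.αabs n := by
    rw [β₁, β₂, β_of_not_lt P h1.le c1, β_of_not_lt P h2.le c2, ← mul_sub, norm_mul,
      Complex.norm_I, one_mul, ← Complex.ofReal_sub, Complex.norm_real, Real.norm_eq_abs,
      abs_sub_comm, abs_of_nonneg (by linarith), le_div_iff₀ hα]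
    nlinarith
  have hwave : ∀ b : ℂ, ‖b‖ ≤ P.αabs n → ‖P.wave n b‖ ^ 2 ≤ 2 * P.αabs n ^ 2 := fun b hb => by
    rw [wave, norm_amp_sq, Complex.norm_real, Complex.norm_real, Real.norm_eq_abs,
      Real.norm_eq_abs, sq_abs, sq_abs, ← P.αabs_sq]
    nlinarith [norm_nonneg b]
  have hβ₂ : ‖P.β₂ n‖ ≤ P.αabs n := by rw [β₂, norm_β P h2.le]; exact d2
  have hT := norm_rankOneUpdate_le (b := -P.β₂ n) (c := (P.β₂ n - P.β₁ n) / P.χ n)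
    (B := P.αabs n) (C := P.κ₂ ^ 2 / P.αabs n / P.κ₁ ^ 2) (by rw [norm_neg]; exact hβ₂)
    (by rw [norm_div]; gcongr) (hwave _ hβ₂) (hwave (-P.β₂ n) (by rw [norm_neg]; exact hβ₂))
    ((-Complex.I) • a)
  rw [symbolMap_apply, M_mulVec P hχne, norm_smul, Complex.norm_real, Real.norm_of_nonneg hμ.le]
  have hsm : ‖(-Complex.I) • a‖ = ‖a‖ := by rw [norm_smul, norm_neg, Complex.norm_I, one_mul]
  have hαw : P.αabs n ≤ P.weight n := Real.le_sqrt_of_sq_le (by linarith)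
  calc P.μ * ‖P.tractionUp n ((-Complex.I) • a)‖
      ≤ P.μ * ((P.αabs n + P.κ₂ ^ 2 / P.αabs n / P.κ₁ ^ 2 * (2 * P.αabs n ^ 2)) * ‖a‖) := by
        rw [hsm] at hT
        gcongr
        exact hT
    _ = P.μ * (1 + 2 * P.κ₂ ^ 2 / P.κ₁ ^ 2) * P.αabs n * ‖a‖ := by field_simp
    _ ≤ P.μ * (1 + 2 * P.κ₂ ^ 2 / P.κ₁ ^ 2) * P.weight n * ‖a‖ := by gcongr

/-! ### The Hilbert space `H¹_qp(Ω)³` -/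

lemma inner_toLp {X : Type*} [MeasurableSpace X] {ν : Measure X} {g : X → ℂ} (hg : MemLp g 2 ν)
    (u : Lp ℂ 2 ν) : inner ℂ (hg.toLp g) u = ∫ x, u x * conj (g x) ∂ν := by
  rw [L2.inner_def]
  refine integral_congr_ae ?_
  filter_upwards [hg.coeFn_toLp] with x h1
  rw [h1, RCLike.inner_apply]

lemma inner_Lp {X : Type*} [MeasurableSpace X] {ν : Measure X} (v u : Lp ℂ 2 ν) :
    inner ℂ v u = ∫ x, u x * conj (v x) ∂ν := by
  rw [L2.inner_def]
  rfl

lemma norm_sq_Lp {X : Type*} [MeasurableSpace X] {ν : Measure X} (u : Lp ℂ 2 ν) :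
    ‖u‖ ^ 2 = ∫ x, ‖u x‖ ^ 2 ∂ν := by
  have h : ((‖u‖ ^ 2 : ℝ) : ℂ) = inner ℂ u u := by
    rw [inner_self_eq_norm_sq_to_K]; norm_cast
  rw [inner_Lp] at h
  have e : ∀ x, u x * conj (u x) = ((‖u x‖ ^ 2 : ℝ) : ℂ) := fun x => by
    rw [Complex.mul_conj, Complex.normSq_eq_norm_sq]
  simp_rw [e] at h
  rw [integral_complex_ofReal] at h
  exact_mod_cast h

lemma memLp_Ω {g : Space → ℂ} (hg : Continuous g) : MemLp g 2 (volume.restrict P.Ω) := by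
  obtain ⟨C, hC⟩ := ((isCompact_Icc (a := (0 : ℝ)) (b := P.Λ₁)).prod
    (isCompact_Icc (a := (0 : ℝ)) (b := P.Λ₂))).prod
    (isCompact_Icc (a := P.bottom) (b := P.h)) |>.exists_bound_of_continuousOn hg.continuousOn
  refine memLp_of_continuous_bounded hg (C := C) ?_
  refine ae_restrict_of_forall_mem P.measurableSet_Ω fun x hx => hC x ?_
  have := P.Ω_subset_box hx
  exact ⟨⟨Set.Ioo_subset_Icc_self this.1.1, Set.Ioo_subset_Icc_self this.1.2⟩,
    Set.Ioo_subset_Icc_self this.2⟩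

lemma memLp_cell {g : ℝ × ℝ → ℂ} (hg : Continuous g) : MemLp g 2 (volume.restrict P.cell) := by
  obtain ⟨C, hC⟩ := ((isCompact_Icc (a := (0 : ℝ)) (b := P.Λ₁)).prod
    (isCompact_Icc (a := (0 : ℝ)) (b := P.Λ₂))).exists_bound_of_continuousOn hg.continuousOn
  refine memLp_of_continuous_bounded hg (C := C) ?_
  exact ae_restrict_of_forall_mem P.measurableSet_cell fun x hx => hC x
    ⟨Set.Ioo_subset_Icc_self hx.1, Set.Ioo_subset_Icc_self hx.2⟩

/-- `Triple` with the Hilbert norm (the product type itself carries the sup norm). -/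
abbrev HilTriple : Type := WithLp 2 (P.L2Ω × WithLp 2 (PiLp 2 (fun _ : Fin 3 => P.L2Ω) × P.L2Γ))

/-- The trace and the gradient components. -/
abbrev HilPair : Type := WithLp 2 (PiLp 2 (fun _ : Fin 3 => P.L2Ω) × P.L2Γ)

/-- The function of a triple. -/
def tripleVal : P.HilTriple →L[ℂ] P.L2Ω := WithLp.fstL 2 ℂ P.L2Ω P.HilPair

/-- A gradient component of a triple. -/
def triplePartial (j : Fin 3) : P.HilTriple →L[ℂ] P.L2Ω :=
  (PiLp.proj 2 (fun _ : Fin 3 => P.L2Ω) j : PiLp 2 (fun _ : Fin 3 => P.L2Ω) →L[ℂ] P.L2Ω) ∘L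
    (WithLp.fstL 2 ℂ (PiLp 2 (fun _ : Fin 3 => P.L2Ω)) P.L2Γ : P.HilPair →L[ℂ] _) ∘L
      (WithLp.sndL 2 ℂ P.L2Ω P.HilPair)

/-- The trace of a triple. -/
def tripleTrace : P.HilTriple →L[ℂ] P.L2Γ :=
  (WithLp.sndL 2 ℂ (PiLp 2 (fun _ : Fin 3 => P.L2Ω)) P.L2Γ : P.HilPair →L[ℂ] _) ∘L
    (WithLp.sndL 2 ℂ P.L2Ω P.HilPair)

variable {P} in
/-- The underlying triple. -/
def HilTriple.toTriple (x : P.HilTriple) : P.Triple := (x.fst, fun j => x.snd.fst j, x.snd.snd)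

section Green

variable {P} {φ : Space → ℂ} (hφ : P.IsTest φ) (j : Fin 3)

include hφ

lemma IsTest.memLp : MemLp φ 2 (volume.restrict P.Ω) := P.memLp_Ω hφ.1.continuous

lemma IsTest.memLp_fderiv :
    MemLp (fun x => fderiv ℝ φ x (unitVec j)) 2 (volume.restrict P.Ω) :=
  P.memLp_Ω ((hφ.1.continuous_fderiv (by simp)).clm_apply continuous_const)

lemma IsTest.memLp_trace : MemLp (fun r => φ (r, P.h)) 2 (volume.restrict P.cell) :=
  P.memLp_cell (hφ.1.continuous.comp (by fun_prop))

/-- The defect in Green's formula as a continuous linear functional. -/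
def greenFunctional : P.HilTriple →L[ℂ] ℂ :=
  (innerSL ℂ ((hφ.memLp_fderiv j).toLp _)) ∘L P.tripleVal +
    (innerSL ℂ (hφ.memLp.toLp _)) ∘L P.triplePartial j -
    (if j = 2 then (1 : ℂ) else 0) • ((innerSL ℂ (hφ.memLp_trace.toLp _)) ∘L P.tripleTrace)

lemma greenFunctional_apply (x : P.HilTriple) :
    greenFunctional hφ j x =
      (∫ y in P.Ω, x.toTriple.1 y * conj (fderiv ℝ φ y (unitVec j))) +
      (∫ y in P.Ω, x.toTriple.2.1 j y * conj (φ y)) -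
      (if j = 2 then ∫ r in P.cell, x.toTriple.2.2 r * conj (φ (r, P.h)) else 0) := by
  have h1 := inner_toLp (hφ.memLp_fderiv j) (P.tripleVal x)
  have h2 := inner_toLp hφ.memLp (P.triplePartial j x)
  have h3 := inner_toLp hφ.memLp_trace (P.tripleTrace x)
  change inner ℂ _ (P.tripleVal x) + inner ℂ _ (P.triplePartial j x) -
    (if j = 2 then (1 : ℂ) else 0) * inner ℂ _ (P.tripleTrace x) = _
  rw [h1, h2, h3]
  split_ifs
  · rw [one_mul]; rfl
  · rw [zero_mul]; rfl

end Green

/-- `H¹_qp(Ω)` as a closed subspace of a Hilbert space, cut out by Green's formula. -/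
def H : Submodule ℂ P.HilTriple :=
  ⨅ (φ : {φ : Space → ℂ // P.IsTest φ}) (j : Fin 3),
    LinearMap.ker (greenFunctional φ.2 j : P.HilTriple →ₗ[ℂ] ℂ)

lemma mem_H {x : P.HilTriple} : x ∈ P.H ↔ x.toTriple ∈ P.H1qp := by
  simp only [H, Submodule.mem_iInf, LinearMap.mem_ker, Subtype.forall, H1qp, Set.mem_ofPred_eq]
  refine forall_congr' fun φ => forall_congr' fun hφ => forall_congr' fun j => ?_
  change greenFunctional hφ j x = 0 ↔ _
  rw [greenFunctional_apply]
  constructor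
  · intro h
    linear_combination h
  · intro h
    linear_combination h

lemma isClosed_H : IsClosed (P.H : Set P.HilTriple) := by
  simp only [H, Submodule.coe_iInf]
  exact isClosed_iInter fun φ => isClosed_iInter fun j =>
    (greenFunctional φ.2 j).isClosed_ker

instance : CompleteSpace P.H := P.isClosed_H.completeSpace_coe

/-- `H¹_qp(Ω)³` as a Hilbert space; the norm includes the trace on `Γ_h`. -/
def Field : Type := PiLp 2 (fun _ : Fin 3 => P.H)

instance : NormedAddCommGroup P.Field := inferInstanceAs (NormedAddCommGroup (PiLp 2 _))

instance : InnerProductSpace ℂ P.Field := inferInstanceAs (InnerProductSpace ℂ (PiLp 2 _))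

instance : CompleteSpace P.Field := inferInstanceAs (CompleteSpace (PiLp 2 _))

/-- A component of a vector field. -/
def compL (i : Fin 3) : P.Field →L[ℂ] P.HilTriple :=
  P.H.subtypeL ∘L (PiLp.proj 2 (fun _ : Fin 3 => P.H) i)

variable {P} in
/-- The underlying vector field. -/
def Field.toV (x : P.Field) : P.VField := fun i => HilTriple.toTriple (P.compL i x)

lemma Field.toV_mem (x : P.Field) : x.toV ∈ P.V := fun i =>
  P.mem_H.1 ((PiLp.proj 2 (fun _ : Fin 3 => P.H) i : _ →L[ℂ] P.H) x).2

/-- Elements of `V` as elements of the Hilbert space; inverse to `Field.toV`. -/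
def ofV (u : P.VField) (hu : u ∈ P.V) : P.Field :=
  WithLp.toLp 2 fun i => ⟨WithLp.toLp 2 ((u i).1, WithLp.toLp 2 (WithLp.toLp 2 (u i).2.1, (u i).2.2)),
    P.mem_H.2 (hu i)⟩

lemma toV_ofV (u : P.VField) (hu : u ∈ P.V) : (P.ofV u hu).toV = u := rfl

lemma toV_sub (x y : P.Field) : (x - y).toV = x.toV - y.toV := rfl

/-- The component `uᵢ`. -/
def valL (i : Fin 3) : P.Field →L[ℂ] P.L2Ω :=
  P.tripleVal ∘L P.compL i

/-- The partial derivative `∂ⱼuᵢ`. -/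
def partialL (i j : Fin 3) : P.Field →L[ℂ] P.L2Ω :=
  P.triplePartial j ∘L P.compL i

/-- The trace of `uᵢ` on `Γ_h`. -/
def trL (i : Fin 3) : P.Field →L[ℂ] P.L2Γ :=
  P.tripleTrace ∘L P.compL i

/-- The divergence. -/
def divL : P.Field →L[ℂ] P.L2Ω := ∑ i, P.partialL i i

/-- The square of the `H¹(Ω)³` norm. -/
def energyV (u : P.VField) : ℝ := ∑ i, P.energy (u i)

lemma energyV_nonneg (u : P.VField) : 0 ≤ P.energyV u :=
  Finset.sum_nonneg fun i _ => P.energy_nonneg (u i)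

lemma H1norm_sq (u : P.VField) : VField.H1norm u ^ 2 = P.energyV u := by
  have h : VField.H1norm u = Real.sqrt (P.energyV u) := by
    unfold VField.H1norm energyV energy
    rw [Finset.sum_add_distrib]
    rfl
  rw [h, Real.sq_sqrt (P.energyV_nonneg u)]

lemma H1norm_nonneg (u : P.VField) : 0 ≤ VField.H1norm u := Real.sqrt_nonneg _

lemma energyV_eq (x : P.Field) :
    P.energyV x.toV = ∑ i, ‖P.valL i x‖ ^ 2 + ∑ i, ∑ j, ‖P.partialL i j x‖ ^ 2 := by
  simp_rw [norm_sq_Lp]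
  rw [← Finset.sum_add_distrib]
  rfl

lemma norm_sq_field (x : P.Field) :
    ‖x‖ ^ 2 = P.energyV x.toV + ∑ i, ‖P.trL i x‖ ^ 2 := by
  have h : ∀ i, ‖P.compL i x‖ ^ 2 =
      ‖P.valL i x‖ ^ 2 + ((∑ j, ‖P.partialL i j x‖ ^ 2) + ‖P.trL i x‖ ^ 2) := by
    intro i
    rw [WithLp.prod_norm_sq_eq_of_L2, WithLp.prod_norm_sq_eq_of_L2, PiLp.norm_sq_eq_of_L2]
    rfl
  have h2 : ‖x‖ ^ 2 = ∑ i, ‖P.compL i x‖ ^ 2 := PiLp.norm_sq_eq_of_L2 (fun _ : Fin 3 => P.H) x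
  simp_rw [h2, energyV_eq, h, Finset.sum_add_distrib]
  ring

lemma norm_sq_trL_le (x : P.Field) (i : Fin 3) : ‖P.trL i x‖ ^ 2 ≤ P.energy (x.toV i) := by
  rw [norm_sq_Lp]
  refine hasSum_le_of_sum_le (P.hasSum_norm_coeff_sq (Lp.memLp (P.trL i x))) fun F => ?_
  refine le_trans (Finset.sum_le_sum fun n _ => ?_) (sum_weight_coeff_le (x.toV_mem P i) F)
  have h := P.one_le_weight n
  have h2 : 0 ≤ P.area * ‖P.coeff (P.trL i x) n‖ ^ 2 := mul_nonneg P.area_pos.le (by positivity)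
  change _ ≤ P.weight n * (P.area * ‖P.coeff (P.trL i x) n‖ ^ 2)
  nlinarith

/-- The norm of the Hilbert space is equivalent to the `H¹(Ω)³` norm. -/
lemma norm_sq_field_le (x : P.Field) : ‖x‖ ^ 2 ≤ 2 * P.energyV x.toV := by
  have h : ∑ i, ‖P.trL i x‖ ^ 2 ≤ P.energyV x.toV :=
    Finset.sum_le_sum fun i _ => P.norm_sq_trL_le x i
  rw [norm_sq_field]
  linarith

lemma energyV_le_norm_sq (x : P.Field) : P.energyV x.toV ≤ ‖x‖ ^ 2 := by
  rw [norm_sq_field]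
  have : 0 ≤ ∑ i, ‖P.trL i x‖ ^ 2 := by positivity
  linarith

lemma H1norm_le_norm (x : P.Field) : VField.H1norm x.toV ≤ ‖x‖ := by
  refine (abs_le_of_sq_le_sq' ?_ (norm_nonneg x)).2
  rw [H1norm_sq]
  exact P.energyV_le_norm_sq x

lemma eq_zero_of_H1norm {x : P.Field} (h : VField.H1norm x.toV = 0) : x = 0 := by
  have h1 := P.norm_sq_field_le x
  rw [← H1norm_sq, h] at h1
  have h2 : ‖x‖ ^ 2 = 0 := le_antisymm (by simpa using h1) (by positivity)
  exact norm_eq_zero.1 (pow_eq_zero_iff two_ne_zero |>.1 h2)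

/-! ### Fourier coefficients as continuous linear maps -/

lemma memLp_mode (n : ℤ × ℤ) : MemLp (P.mode n) 2 (volume.restrict P.cell) :=
  P.memLp_cell (P.continuous_mode n)

lemma coeff_Lp (w : P.L2Γ) (n : ℤ × ℤ) :
    P.coeff w n = (P.area : ℂ)⁻¹ * inner ℂ ((P.memLp_mode n).toLp _) w := by
  have h : (P.area : ℂ) ≠ 0 := by exact_mod_cast P.area_pos.ne'
  rw [inner_toLp, ← coeff_eq, inv_mul_cancel_left₀ h]

/-- The `n`-th Fourier coefficient of the trace. -/
def coeffL (n : ℤ × ℤ) : P.Field →L[ℂ] Amp :=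
  (PiLp.continuousLinearEquiv 2 ℂ (fun _ : Fin 3 => ℂ)).symm.toContinuousLinearMap ∘L
    ContinuousLinearMap.pi fun k =>
      (P.area : ℂ)⁻¹ • (innerSL ℂ ((P.memLp_mode n).toLp _) ∘L P.trL k)

lemma coeffL_apply (n : ℤ × ℤ) (x : P.Field) : P.coeffL n x = P.ampCoeff (VField.tr x.toV) n := by
  ext k
  exact (P.coeff_Lp (P.trL k x) n).symm

/-- The trace inequality for vector fields. -/
lemma sum_weight_ampCoeff_le {u : P.VField} (hu : u ∈ P.V) (F : Finset (ℤ × ℤ)) :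
    ∑ n ∈ F, P.weight n * ‖P.ampCoeff (VField.tr u) n‖ ^ 2 ≤
      (VField.H1norm u / Real.sqrt P.area) ^ 2 := by
  have hA := P.area_pos
  rw [div_pow, H1norm_sq, Real.sq_sqrt hA.le, le_div_iff₀ hA, energyV, Finset.sum_mul]
  have e : ∀ n, P.weight n * ‖P.ampCoeff (VField.tr u) n‖ ^ 2 * P.area =
      ∑ i, P.weight n * (P.area * ‖P.coeff (u i).2.2 n‖ ^ 2) := fun n => by
    rw [EuclideanSpace.norm_sq_eq, ← Finset.mul_sum, ← Finset.mul_sum]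
    change P.weight n * (∑ i, ‖P.coeff (u i).2.2 n‖ ^ 2) * P.area = _
    ring
  simp_rw [e]
  rw [Finset.sum_comm]
  exact Finset.sum_le_sum fun i _ => sum_weight_coeff_le (hu i) F

/-- The coefficient of `uₖ` with respect to an exponential of the box. -/
def boxL (i : (ℤ × ℤ) × ℤ) (k : Fin 3) : P.Field →L[ℂ] ℂ :=
  innerSL ℂ ((P.memLp_Ω (g := fun x => P.mode i.1 x.1 * P.vmode i.2 x.2)
    (((P.continuous_mode i.1).comp continuous_fst).mul
      ((P.contDiff_vmode i.2).continuous.comp continuous_snd))).toLp _) ∘L P.valL k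

lemma boxL_apply (i : (ℤ × ℤ) × ℤ) (k : Fin 3) (x : P.Field) :
    P.boxL i k x = P.boxCoeff i (x.toV k).1 := by
  change inner ℂ (MemLp.toLp _ _) (P.valL k x) = _
  rw [inner_toLp]
  rfl

/-! ### The sesquilinear forms -/

/-- The part of the form that does not involve the boundary operator. -/
def volumeForm (u v : P.VField) : ℂ :=
  P.μ * (∫ x in P.Ω, ∑ i, ∑ j, VField.partialD u i j x * conj (VField.partialD v i j x)) +
  ((P.lam + P.μ : ℝ) : ℂ) * (∫ x in P.Ω, VField.div u x * conj (VField.div v x)) -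
  (P.ω : ℂ) ^ 2 * (∫ x in P.Ω, ∑ i, VField.val u i x * conj (VField.val v i x))

lemma form_eq (S : ℤ × ℤ → Matrix (Fin 3) (Fin 3) ℂ) (u v : P.VField) :
    P.form S u v = P.volumeForm u v - P.pairing S (VField.tr u) (VField.tr v) := rfl

lemma integrable_mul_conj {X : Type*} [MeasurableSpace X] {ν : Measure X} (u v : Lp ℂ 2 ν) :
    Integrable (fun x => u x * conj (v x)) ν := L2.integrable_inner v u

lemma volumeForm_eq (x y : P.Field) :
    P.volumeForm x.toV y.toV =
      P.μ * (∑ i, ∑ j, inner ℂ (P.partialL i j y) (P.partialL i j x)) +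
      ((P.lam + P.μ : ℝ) : ℂ) * inner ℂ (P.divL y) (P.divL x) -
      (P.ω : ℂ) ^ 2 * (∑ i, inner ℂ (P.valL i y) (P.valL i x)) := by
  have hdiv : ∀ z : P.Field, (P.divL z : Space → ℂ) =ᵐ[volume.restrict P.Ω] VField.div z.toV := by
    intro z
    have e : P.divL z = P.partialL 0 0 z + P.partialL 1 1 z + P.partialL 2 2 z := by
      rw [divL, Fin.sum_univ_three]; rfl
    rw [e]
    filter_upwards [Lp.coeFn_add (P.partialL 0 0 z + P.partialL 1 1 z) (P.partialL 2 2 z),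
      Lp.coeFn_add (P.partialL 0 0 z) (P.partialL 1 1 z)] with t h1 h2
    rw [h1, Pi.add_apply, h2, Pi.add_apply]
    unfold VField.div
    rw [Fin.sum_univ_three]
    rfl
  have h2 : ∫ t in P.Ω, VField.div x.toV t * conj (VField.div y.toV t) =
      inner ℂ (P.divL y) (P.divL x) := by
    rw [inner_Lp]
    refine integral_congr_ae ?_
    filter_upwards [hdiv x, hdiv y] with t h1 h2
    rw [h1, h2]
  have h1 : ∫ t in P.Ω, ∑ i, ∑ j, VField.partialD x.toV i j t * conj (VField.partialD y.toV i j t) =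
      ∑ i, ∑ j, inner ℂ (P.partialL i j y) (P.partialL i j x) := by
    change ∫ t in P.Ω, ∑ i, ∑ j, P.partialL i j x t * conj (P.partialL i j y t) = _
    rw [integral_finsetSum _ fun i _ => integrable_finsetSum _ fun j _ =>
      integrable_mul_conj (P.partialL i j x) (P.partialL i j y)]
    refine Finset.sum_congr rfl fun i _ => ?_
    rw [integral_finsetSum _ fun j _ => integrable_mul_conj (P.partialL i j x) (P.partialL i j y)]
    refine Finset.sum_congr rfl fun j _ => ?_
    rw [inner_Lp]
  have h3 : ∫ t in P.Ω, ∑ i, VField.val x.toV i t * conj (VField.val y.toV i t) =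
      ∑ i, inner ℂ (P.valL i y) (P.valL i x) := by
    change ∫ t in P.Ω, ∑ i, P.valL i x t * conj (P.valL i y t) = _
    rw [integral_finsetSum _ fun i _ => integrable_mul_conj (P.valL i x) (P.valL i y)]
    refine Finset.sum_congr rfl fun i _ => ?_
    rw [inner_Lp]
  rw [volumeForm, h1, h2, h3]

/-- Bounded sesquilinear forms are represented by operators. -/
lemma exists_operator {E : Type*} [NormedAddCommGroup E] [InnerProductSpace ℂ E] [CompleteSpace E]
    (b : E → E → ℂ) (hadd : ∀ x x' y, b (x + x') y = b x y + b x' y)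
    (hsmul : ∀ (c : ℂ) x y, b (c • x) y = c * b x y)
    (hadd' : ∀ x y y', b x (y + y') = b x y + b x y')
    (hsmul' : ∀ (c : ℂ) x y, b x (c • y) = conj c * b x y)
    (C : ℝ) (hC : ∀ x y, ‖b x y‖ ≤ C * ‖x‖ * ‖y‖) :
    ∃ T : E →L[ℂ] E, ∀ x y, inner ℂ y (T x) = b x y := by
  set B : E →L⋆[ℂ] E →L[ℂ] ℂ := LinearMap.mkContinuous₂
    (LinearMap.mk₂'ₛₗ (starRingEnd ℂ) (RingHom.id ℂ) (fun y x => b x y)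
      (fun y y' x => hadd' x y y') (fun c y x => by simpa using hsmul' c x y)
      (fun y x x' => hadd x x' y) (fun c y x => by simpa using hsmul c x y)) C
    (fun y x => by
      have := hC x y
      calc ‖b x y‖ ≤ C * ‖x‖ * ‖y‖ := this
        _ = C * ‖y‖ * ‖x‖ := by ring) with hB
  refine ⟨ContinuousLinearMap.adjoint (InnerProductSpace.continuousLinearMapOfBilin B), fun x y => ?_⟩
  rw [ContinuousLinearMap.adjoint_inner_right,
    InnerProductSpace.continuousLinearMapOfBilin_apply]
  rfl

lemma summable_pairing {S : ℤ × ℤ → Matrix (Fin 3) (Fin 3) ℂ} (hS : P.Admissible S) (x y : P.Field) :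
    Summable (fun n => inner ℂ (P.coeffL n y) (symbolMap (S n) (P.coeffL n x))) := by
  obtain ⟨C, hC, h⟩ := hS
  have hx := P.sum_weight_ampCoeff_le (x.toV_mem P)
  have hy := P.sum_weight_ampCoeff_le (y.toV_mem P)
  simp_rw [← coeffL_apply] at hx hy
  exact (summable_inner_symbol (S := fun n => symbolMap (S n))
    (fun n => zero_le_one.trans (P.one_le_weight n))
    (div_nonneg (P.H1norm_nonneg _) (Real.sqrt_nonneg _))
    (div_nonneg (P.H1norm_nonneg _) (Real.sqrt_nonneg _)) hC (fun n => h n _) hx hy).1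

lemma pairing_toV (S : ℤ × ℤ → Matrix (Fin 3) (Fin 3) ℂ) (x y : P.Field) :
    P.pairing S (VField.tr x.toV) (VField.tr y.toV) =
      (P.area : ℂ) * ∑' n, inner ℂ (P.coeffL n y) (symbolMap (S n) (P.coeffL n x)) := by
  simp_rw [coeffL_apply]
  rfl

/-- Boundedness of the boundary pairing in terms of the `H¹` norms. -/
lemma norm_pairing_le {S : ℤ × ℤ → Matrix (Fin 3) (Fin 3) ℂ} {C : ℝ} (hC : 0 ≤ C)
    (h : ∀ n (a : Amp), ‖symbolMap (S n) a‖ ≤ C * P.weight n * ‖a‖) {u v : P.VField}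
    (hu : u ∈ P.V) (hv : v ∈ P.V) :
    ‖P.pairing S (VField.tr u) (VField.tr v)‖ ≤ C * (VField.H1norm u * VField.H1norm v) := by
  have hA := P.area_pos
  have key := (summable_inner_symbol (S := fun n => symbolMap (S n))
    (fun n => zero_le_one.trans (P.one_le_weight n))
    (div_nonneg (P.H1norm_nonneg _) (Real.sqrt_nonneg _))
    (div_nonneg (P.H1norm_nonneg _) (Real.sqrt_nonneg _)) hC (fun n => h n _)
    (P.sum_weight_ampCoeff_le hu) (P.sum_weight_ampCoeff_le hv)).2
  rw [pairing_eq, norm_mul, Complex.norm_real, Real.norm_of_nonneg hA.le]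
  calc _ ≤ P.area * (C * (VField.H1norm u / Real.sqrt P.area *
        (VField.H1norm v / Real.sqrt P.area))) := by gcongr
    _ = C * (VField.H1norm u * VField.H1norm v) * (P.area / (Real.sqrt P.area * Real.sqrt P.area)) := by
        field_simp
    _ = _ := by rw [Real.mul_self_sqrt hA.le, div_self hA.ne', mul_one]

/-- The form of an admissible symbol is represented by a bounded operator. -/
theorem exists_formOperator {S : ℤ × ℤ → Matrix (Fin 3) (Fin 3) ℂ} (hS : P.Admissible S) :
    ∃ A : P.Field →L[ℂ] P.Field, ∀ x y, inner ℂ y (A x) = P.form S x.toV y.toV := by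
  obtain ⟨C, hC, h⟩ := id hS
  obtain ⟨T, hT⟩ := exists_operator (E := P.Field)
    (fun x y => P.pairing S (VField.tr x.toV) (VField.tr y.toV))
    (fun x x' y => by
      simp only [pairing_toV, map_add, inner_add_right]
      rw [(P.summable_pairing hS x y).tsum_add (P.summable_pairing hS x' y), mul_add])
    (fun c x y => by
      simp only [pairing_toV, map_smul, inner_smul_right]
      rw [tsum_mul_left]
      ring)
    (fun x y y' => by
      simp only [pairing_toV, map_add, inner_add_left]
      rw [(P.summable_pairing hS x y).tsum_add (P.summable_pairing hS x y'), mul_add])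
    (fun c x y => by
      simp only [pairing_toV, map_smul, inner_smul_left]
      rw [tsum_mul_left]
      ring) C
    (fun x y => by
      refine (P.norm_pairing_le hC h (x.toV_mem P) (y.toV_mem P)).trans ?_
      rw [mul_assoc]
      have := P.H1norm_nonneg x.toV
      have := P.H1norm_nonneg y.toV
      gcongr
      · exact P.H1norm_le_norm x
      · exact P.H1norm_le_norm y)
  refine ⟨(P.μ : ℂ) • (∑ i, ∑ j, ContinuousLinearMap.adjoint (P.partialL i j) ∘L P.partialL i j) +
    ((P.lam + P.μ : ℝ) : ℂ) • (ContinuousLinearMap.adjoint P.divL ∘L P.divL) -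
    (P.ω : ℂ) ^ 2 • (∑ i, ContinuousLinearMap.adjoint (P.valL i) ∘L P.valL i) - T, fun x y => ?_⟩
  rw [form_eq, volumeForm_eq, ← hT x y]
  simp only [sub_apply, add_apply, smul_apply, sum_apply,
    ContinuousLinearMap.comp_apply, inner_sub_right, inner_add_right, inner_smul_right, inner_sum,
    ContinuousLinearMap.adjoint_inner_right]

end Scattering

/-! ### Gårding's inequality -/

section FiniteRank

variable {E : Type*} [NormedAddCommGroup E] [InnerProductSpace ℂ E]

lemma finiteRank_add {R R' : E →L[ℂ] E}
    (h : FiniteDimensional ℂ (LinearMap.range (R : E →ₗ[ℂ] E)))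
    (h' : FiniteDimensional ℂ (LinearMap.range (R' : E →ₗ[ℂ] E))) :
    FiniteDimensional ℂ (LinearMap.range ((R + R' : E →L[ℂ] E) : E →ₗ[ℂ] E)) :=
  Submodule.finiteDimensional_of_le (S₂ := LinearMap.range (R : E →ₗ[ℂ] E) ⊔
    LinearMap.range (R' : E →ₗ[ℂ] E)) (LinearMap.range_add_le _ _)

lemma finiteRank_sum {ι : Type*} {R : ι → E →L[ℂ] E} (F : Finset ι)
    (h : ∀ i ∈ F, FiniteDimensional ℂ (LinearMap.range (R i : E →ₗ[ℂ] E))) :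
    FiniteDimensional ℂ (LinearMap.range ((∑ i ∈ F, R i : E →L[ℂ] E) : E →ₗ[ℂ] E)) := by
  refine Finset.sum_induction R (fun T => FiniteDimensional ℂ (LinearMap.range (T : E →ₗ[ℂ] E)))
    (fun _ _ => finiteRank_add) ?_ h
  have : LinearMap.range ((0 : E →L[ℂ] E) : E →ₗ[ℂ] E) = ⊥ := LinearMap.range_zero
  rw [this]
  infer_instance

lemma finiteRank_comp {W : Type*} [NormedAddCommGroup W] [InnerProductSpace ℂ W]
    [FiniteDimensional ℂ W] (G : W →L[ℂ] E) (B : E →L[ℂ] W) :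
    FiniteDimensional ℂ (LinearMap.range ((G ∘L B : E →L[ℂ] E) : E →ₗ[ℂ] E)) :=
  Submodule.finiteDimensional_of_le (S₂ := LinearMap.range (G : W →ₗ[ℂ] E))
    (LinearMap.range_comp_le_range (B : E →ₗ[ℂ] W) (G : W →ₗ[ℂ] E))

end FiniteRank

namespace Scattering

variable (P : Scattering)

lemma αabs_le_weight (n : ℤ × ℤ) : P.αabs n ≤ P.weight n :=
  Real.le_sqrt_of_sq_le (by linarith)

variable {P} in
/-- Bounded perturbations of the exact symbol are admissible. -/
lemma admissible_of_norm_sub_le {S : ℤ × ℤ → Matrix (Fin 3) (Fin 3) ℂ} {C : ℝ} (hC : 0 ≤ C)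
    (hS : ∀ n (a : Amp), ‖symbolMap (S n) a - symbolMap (P.M n) a‖ ≤ C * ‖a‖) :
    P.Admissible S := by
  obtain ⟨D, hD, h⟩ := P.admissible_M
  refine ⟨C + D, by positivity, fun n a => ?_⟩
  have hw := P.one_le_weight n
  have h1 : ‖symbolMap (S n) a‖ ≤ ‖symbolMap (S n) a - symbolMap (P.M n) a‖ +
      ‖symbolMap (P.M n) a‖ := by
    simpa using norm_add_le (symbolMap (S n) a - symbolMap (P.M n) a) (symbolMap (P.M n) a)
  calc _ ≤ C * ‖a‖ + D * P.weight n * ‖a‖ := h1.trans (add_le_add (hS n a) (h n a))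
    _ ≤ C * P.weight n * ‖a‖ + D * P.weight n * ‖a‖ := by
        gcongr
        exact le_mul_of_one_le_right hC hw
    _ = _ := by ring

/-- Up to finitely many modes, the boundary term is bounded by a small multiple of the energy: on
the other modes the exact symbol has the right sign, and the bounded perturbation is small compared
with the weight of `H^{1/2}`. -/
lemma exists_finset_re_tsum_le {S : ℤ × ℤ → Matrix (Fin 3) (Fin 3) ℂ} {C : ℝ} (hC : 0 ≤ C)
    (hS : ∀ n (a : Amp), ‖symbolMap (S n) a - symbolMap (P.M n) a‖ ≤ C * ‖a‖) {ε : ℝ}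
    (hε : 0 < ε) :
    ∃ F : Finset (ℤ × ℤ), ∀ x : P.Field,
      P.area * (∑' n, inner ℂ (P.coeffL n x) (symbolMap (S n) (P.coeffL n x))).re ≤
        P.area * (∑ n ∈ F, inner ℂ (P.coeffL n x) (symbolMap (S n) (P.coeffL n x))).re +
          ε * P.energyV x.toV := by
  classical
  have hA := P.area_pos
  refine ⟨(P.finite_αabs_le (max P.κ₂ (C / ε))).toFinset, fun x => ?_⟩
  set F := (P.finite_αabs_le (max P.κ₂ (C / ε))).toFinset
  set t : ℤ × ℤ → ℂ := fun n => inner ℂ (P.coeffL n x) (symbolMap (S n) (P.coeffL n x)) with ht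
  have hsum : Summable t := P.summable_pairing (admissible_of_norm_sub_le hC hS) x x
  have hoff : ∀ n ∉ F, (t n).re ≤ ε * (P.weight n * ‖P.coeffL n x‖ ^ 2) := by
    intro n hn
    have hn' : max P.κ₂ (C / ε) < P.αabs n := by simpa [F] using hn
    have h1 := P.re_inner_M_le (max_lt_iff.1 hn').1.le (P.coeffL n x)
    have h2 : C ≤ ε * P.weight n := by
      have := ((max_lt_iff.1 hn').2.le.trans (P.αabs_le_weight n))
      rwa [div_le_iff₀' hε] at this
    have e : t n = inner ℂ (P.coeffL n x) (symbolMap (P.M n) (P.coeffL n x)) +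
        inner ℂ (P.coeffL n x) (symbolMap (S n) (P.coeffL n x) - symbolMap (P.M n) (P.coeffL n x)) := by
      rw [← inner_add_right, add_sub_cancel]
    rw [e, Complex.add_re]
    have h3 := (Complex.re_le_norm _).trans (norm_inner_le_norm (𝕜 := ℂ) (P.coeffL n x)
      (symbolMap (S n) (P.coeffL n x) - symbolMap (P.M n) (P.coeffL n x)))
    calc _ ≤ 0 + ‖P.coeffL n x‖ * (C * ‖P.coeffL n x‖) := by
          refine add_le_add h1 (h3.trans ?_)
          gcongr
          exact hS n _
      _ = C * ‖P.coeffL n x‖ ^ 2 := by ring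
      _ ≤ ε * P.weight n * ‖P.coeffL n x‖ ^ 2 := by gcongr
      _ = _ := by ring
  have htr : ∀ G : Finset (ℤ × ℤ), P.area * ∑ n ∈ G, P.weight n * ‖P.coeffL n x‖ ^ 2 ≤
      P.energyV x.toV := fun G => by
    have := P.sum_weight_ampCoeff_le (x.toV_mem P) G
    simp_rw [← coeffL_apply] at this
    rwa [div_pow, H1norm_sq, Real.sq_sqrt hA.le, le_div_iff₀' hA] at this
  have hlim := (((Complex.hasSum_re hsum.hasSum).const_mul P.area :) : Filter.Tendsto _ _ _)
  refine le_of_tendsto hlim ?_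
  filter_upwards [Filter.eventually_ge_atTop F] with G hG
  have hw : ∀ n, 0 ≤ P.weight n * ‖P.coeffL n x‖ ^ 2 := fun n =>
    mul_nonneg (zero_le_one.trans (P.one_le_weight n)) (by positivity)
  rw [← Finset.sum_sdiff hG, Complex.re_sum, mul_add, add_comm]
  change P.area * ∑ n ∈ F, (t n).re + P.area * ∑ n ∈ G \ F, (t n).re ≤ _
  refine add_le_add le_rfl ?_
  calc P.area * ∑ n ∈ G \ F, (t n).re
      ≤ P.area * ∑ n ∈ G \ F, ε * (P.weight n * ‖P.coeffL n x‖ ^ 2) := by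
        gcongr with n hn
        exact hoff n (Finset.mem_sdiff.1 hn).2
    _ = ε * (P.area * ∑ n ∈ G \ F, P.weight n * ‖P.coeffL n x‖ ^ 2) := by
        rw [← Finset.mul_sum]; ring
    _ ≤ _ := by gcongr; exact htr _

/-- Gårding's inequality in operator form: the form is coercive up to finite rank. -/
theorem exists_finiteRank_coercive {S : ℤ × ℤ → Matrix (Fin 3) (Fin 3) ℂ} {C : ℝ} (hC : 0 ≤ C)
    (hS : ∀ n (a : Amp), ‖symbolMap (S n) a - symbolMap (P.M n) a‖ ≤ C * ‖a‖)
    {A : P.Field →L[ℂ] P.Field} (hA : ∀ x y, inner ℂ y (A x) = P.form S x.toV y.toV) :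
    ∃ R : P.Field →L[ℂ] P.Field,
      FiniteDimensional ℂ (LinearMap.range (R : P.Field →ₗ[ℂ] P.Field)) ∧
      ∀ x, P.μ / 4 * ‖x‖ ^ 2 ≤ RCLike.re (inner ℂ x ((A + R) x)) := by
  have hμ := P.μ_pos
  have hlam := P.lam_add_μ_pos
  have hω := P.ω_pos
  have hV := P.boxVol_pos
  set ν := P.ω ^ 2 + P.μ with hν
  have hν0 : 0 < ν := by positivity
  -- the boundary modes in `F` and the box coefficients in `G` are compensated by `R`; the two
  -- remainders cost `μ/4` of the energy each
  obtain ⟨F, hF⟩ := P.exists_finset_re_tsum_le hC hS (ε := P.μ / 4) (by positivity)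
  obtain ⟨G, hG⟩ := P.exists_finset_boxCoeff (ε := P.boxVol * (P.μ / 4) / ν) (by positivity)
  refine ⟨(∑ n ∈ F, (ContinuousLinearMap.adjoint (P.coeffL n) ∘L
      ((P.area : ℂ) • (symbolMap (S n) ∘L P.coeffL n)))) +
    ∑ i ∈ G, ∑ k, (ContinuousLinearMap.adjoint (P.boxL i k) ∘L
      (((ν / P.boxVol : ℝ) : ℂ) • P.boxL i k)),
    finiteRank_add (finiteRank_sum _ fun n _ => finiteRank_comp _ _)
      (finiteRank_sum _ fun i _ => finiteRank_sum _ fun k _ => finiteRank_comp _ _), fun x => ?_⟩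
  have e : RCLike.re (inner ℂ x ((A + ((∑ n ∈ F, (ContinuousLinearMap.adjoint (P.coeffL n) ∘L
      ((P.area : ℂ) • (symbolMap (S n) ∘L P.coeffL n)))) +
    ∑ i ∈ G, ∑ k, (ContinuousLinearMap.adjoint (P.boxL i k) ∘L
      (((ν / P.boxVol : ℝ) : ℂ) • P.boxL i k)))) x)) =
      (P.form S x.toV x.toV).re +
        P.area * (∑ n ∈ F, inner ℂ (P.coeffL n x) (symbolMap (S n) (P.coeffL n x))).re +
        ν / P.boxVol * ∑ i ∈ G, ∑ k, ‖P.boxL i k x‖ ^ 2 := by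
    have e1 : ∀ i k, inner ℂ (P.boxL i k x) (P.boxL i k x) = ((‖P.boxL i k x‖ ^ 2 : ℝ) : ℂ) :=
      fun i k => by rw [inner_self_eq_norm_sq_to_K]; norm_cast
    simp only [add_apply, inner_add_right, hA, sum_apply,
      ContinuousLinearMap.comp_apply, inner_sum, ContinuousLinearMap.adjoint_inner_right,
      smul_apply, inner_smul_right, ← Finset.mul_sum]
    simp only [e1, ← Complex.ofReal_sum, RCLike.re_eq_complex_re, Complex.add_re,
      Complex.re_ofReal_mul, Complex.ofReal_re, add_assoc]
  rw [e, form_eq, volumeForm_eq, pairing_toV]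
  have e2 : ∀ v : P.L2Ω, inner ℂ v v = ((‖v‖ ^ 2 : ℝ) : ℂ) := fun v => by
    rw [inner_self_eq_norm_sq_to_K]; norm_cast
  simp only [e2]
  have e3 : (P.ω : ℂ) ^ 2 = ((P.ω ^ 2 : ℝ) : ℂ) := by push_cast; rfl
  rw [e3]
  simp only [← Complex.ofReal_sum, Complex.sub_re, Complex.add_re, Complex.re_ofReal_mul,
    Complex.ofReal_re]
  have hF' := hF x
  have hE := P.energyV_eq x
  have hx := P.norm_sq_field_le x
  have hd : 0 ≤ (P.lam + P.μ) * ‖P.divL x‖ ^ 2 := by positivity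
  have hbox : P.boxVol * ∑ i, ‖P.valL i x‖ ^ 2 ≤ (∑ i ∈ G, ∑ k, ‖P.boxL i k x‖ ^ 2) +
      P.boxVol * (P.μ / 4) / ν * P.energyV x.toV := by
    have hk : ∀ k, P.boxVol * ‖P.valL k x‖ ^ 2 ≤ (∑ i ∈ G, ‖P.boxL i k x‖ ^ 2) +
        P.boxVol * (P.μ / 4) / ν * P.energy (x.toV k) := fun k => by
      have h0 := hG (x.toV k) (x.toV_mem P k)
      have hv : ‖P.valL k x‖ ^ 2 = ∫ t in P.Ω, ‖(x.toV k).1 t‖ ^ 2 := norm_sq_Lp _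
      simp only [← boxL_apply] at h0
      rw [hv]
      exact h0
    have := Finset.sum_le_sum fun k (_ : k ∈ Finset.univ) => hk k
    rw [Finset.sum_add_distrib, ← Finset.mul_sum, ← Finset.mul_sum, Finset.sum_comm] at this
    exact this
  have hbox' : ν * ∑ i, ‖P.valL i x‖ ^ 2 ≤
      ν / P.boxVol * (∑ i ∈ G, ∑ k, ‖P.boxL i k x‖ ^ 2) + P.μ / 4 * P.energyV x.toV := by
    have := mul_le_mul_of_nonneg_left hbox (show 0 ≤ ν / P.boxVol by positivity)
    have r1 : ν / P.boxVol * (P.boxVol * ∑ i, ‖P.valL i x‖ ^ 2) = ν * ∑ i, ‖P.valL i x‖ ^ 2 := by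
      field_simp
    have r2 : ν / P.boxVol * (P.boxVol * (P.μ / 4) / ν * P.energyV x.toV) =
        P.μ / 4 * P.energyV x.toV := by field_simp
    rw [mul_add, r1, r2] at this
    exact this
  -- the `H¹` energy is at least half the squared norm of `Field`, which includes the trace
  have hx' := mul_le_mul_of_nonneg_left hx (show 0 ≤ P.μ / 4 by positivity)
  set N := ∑ i, ‖P.valL i x‖ ^ 2
  set D := ∑ i, ∑ j, ‖P.partialL i j x‖ ^ 2
  have hE' : P.μ * P.energyV x.toV = P.μ * N + P.μ * D := by rw [hE]; ring
  have hν' : ν * N = P.ω ^ 2 * N + P.μ * N := by rw [hν]; ring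
  linarith

/-- The Fredholm alternative for the variational problems. -/
theorem surjective_of_injective {S : ℤ × ℤ → Matrix (Fin 3) (Fin 3) ℂ} {C : ℝ} (hC : 0 ≤ C)
    (hS : ∀ n (a : Amp), ‖symbolMap (S n) a - symbolMap (P.M n) a‖ ≤ C * ‖a‖)
    {A : P.Field →L[ℂ] P.Field} (hA : ∀ x y, inner ℂ y (A x) = P.form S x.toV y.toV)
    (hinj : ∀ x, A x = 0 → x = 0) : Function.Surjective A := by
  obtain ⟨R, hR, h⟩ := P.exists_finiteRank_coercive hC hS hA
  exact surjective_of_coercive_add_finiteRank A R hR (div_pos P.μ_pos four_pos) h hinj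

end Scattering

/-! ### An upper bound for the inf-sup constant -/

lemma setIntegral_Ioo_deriv_eq_zero {F F' : ℝ → ℂ} {a b : ℝ} (hab : a ≤ b)
    (h : ∀ t, HasDerivAt F (F' t) t) (hc : Continuous F') (he : F b = F a) :
    ∫ t in Set.Ioo a b, F' t = 0 := by
  rw [← integral_Ioc_eq_integral_Ioo, ← intervalIntegral.integral_of_le hab,
    intervalIntegral.integral_eq_sub_of_hasDerivAt (fun t _ => h t) (hc.intervalIntegrable _ _),
    he, sub_self]

namespace Scattering

variable (P : Scattering)

/-- The divergence theorem on `cell × (m, h)` for fields whose fluxes through opposite faces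
cancel. -/
lemma integral_box_fderiv_eq_zero {F : Space → ℂ} (hF : ContDiff ℝ 1 F) {m : ℝ} (hm : m ≤ P.h)
    (h0 : ∀ y z, F ((P.Λ₁, y), z) = F ((0, y), z)) (h1 : ∀ x z, F ((x, P.Λ₂), z) = F ((x, 0), z))
    (h2 : ∀ r, F (r, P.h) = F (r, m)) (j : Fin 3) :
    ∫ x in P.cell ×ˢ Set.Ioo m P.h, fderiv ℝ F x (unitVec j) = 0 := by
  have hd : ∀ x, HasFDerivAt F (fderiv ℝ F x) x := fun x =>
    (hF.differentiable one_ne_zero).differentiableAt.hasFDerivAt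
  have hc : Continuous fun x => fderiv ℝ F x (unitVec j) :=
    (hF.continuous_fderiv one_ne_zero).clm_apply continuous_const
  have hK : IsCompact (Set.Icc 0 P.Λ₁ ×ˢ Set.Icc 0 P.Λ₂) := isCompact_Icc.prod isCompact_Icc
  have hsub : P.cell ⊆ Set.Icc 0 P.Λ₁ ×ˢ Set.Icc 0 P.Λ₂ :=
    Set.prod_mono Set.Ioo_subset_Icc_self Set.Ioo_subset_Icc_self
  have hint : IntegrableOn (fun x => fderiv ℝ F x (unitVec j)) (P.cell ×ˢ Set.Ioo m P.h) :=
    (hc.continuousOn.integrableOn_compact (hK.prod (isCompact_Icc (a := m) (b := P.h)))).mono_set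
      (Set.prod_mono hsub Set.Ioo_subset_Icc_self)
  have hint2 : ∀ z, IntegrableOn (fun r => fderiv ℝ F (r, z) (unitVec j)) P.cell := fun z =>
    ((hc.comp (by fun_prop : Continuous fun r : ℝ × ℝ => (r, z))).continuousOn.integrableOn_compact
      hK).mono_set hsub
  rw [IntegrableOn, restrict_cell_prod] at hint
  rw [restrict_cell_prod]
  fin_cases j
  · rw [integral_prod_symm _ hint]
    refine integral_eq_zero_of_ae (Filter.Eventually.of_forall fun z => ?_)
    have h := hint2 z
    rw [IntegrableOn, restrict_cell] at h
    simp only [Pi.zero_apply]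
    rw [restrict_cell, integral_prod_symm _ h]
    refine integral_eq_zero_of_ae (Filter.Eventually.of_forall fun y => ?_)
    refine setIntegral_Ioo_deriv_eq_zero (F := fun t => F ((t, y), z)) P.Λ₁_pos.le (fun t => ?_)
      (hc.comp (by fun_prop : Continuous fun t : ℝ => ((t, y), z))) (h0 y z)
    exact (hd _).comp_hasDerivAt t
      (((hasDerivAt_id t).prodMk (hasDerivAt_const t y)).prodMk (hasDerivAt_const t z))
  · rw [integral_prod_symm _ hint]
    refine integral_eq_zero_of_ae (Filter.Eventually.of_forall fun z => ?_)
    have h := hint2 z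
    rw [IntegrableOn, restrict_cell] at h
    simp only [Pi.zero_apply]
    rw [restrict_cell, integral_prod _ h]
    refine integral_eq_zero_of_ae (Filter.Eventually.of_forall fun x => ?_)
    refine setIntegral_Ioo_deriv_eq_zero (F := fun t => F ((x, t), z)) P.Λ₂_pos.le (fun t => ?_)
      (hc.comp (by fun_prop : Continuous fun t : ℝ => ((x, t), z))) (h1 x z)
    exact (hd _).comp_hasDerivAt t
      (((hasDerivAt_const t x).prodMk (hasDerivAt_id t)).prodMk (hasDerivAt_const t z))
  · rw [integral_prod _ hint]
    refine integral_eq_zero_of_ae (Filter.Eventually.of_forall fun r => ?_)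
    refine setIntegral_Ioo_deriv_eq_zero (F := fun t => F (r, t)) hm (fun t => ?_)
      (hc.comp (by fun_prop : Continuous fun t : ℝ => (r, t))) (h2 r)
    exact (hd _).comp_hasDerivAt t ((hasDerivAt_const t r).prodMk (hasDerivAt_id t))

/-- Integration by parts on `cell × (m, h)` for a separated function that vanishes at both ends. -/
lemma integral_box_sepFun_mul_conj (n : ℤ × ℤ) {g : ℝ → ℂ} (hg : ContDiff ℝ (⊤ : ℕ∞) g) {m : ℝ}
    (hm : m ≤ P.h) (h0 : g m = 0) (h1 : g P.h = 0) {φ : Space → ℂ} (hφ : P.IsTest φ) (j : Fin 3) :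
    ∫ x in P.cell ×ˢ Set.Ioo m P.h, P.sepFun n g x * conj (fderiv ℝ φ x (unitVec j)) =
      -∫ x in P.cell ×ˢ Set.Ioo m P.h, fderiv ℝ (P.sepFun n g) x (unitVec j) * conj (φ x) := by
  have hψ := P.isTest_sepFun n hg
  have hψ1 : ContDiff ℝ 1 (P.sepFun n g) := hψ.1.of_le (by exact_mod_cast le_top)
  have hφ1 : ContDiff ℝ 1 φ := hφ.1.of_le (by exact_mod_cast le_top)
  have hφ2 : ContDiff ℝ 1 (fun x => conj (φ x)) := Complex.conjCLE.contDiff.comp hφ1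
  have hper : ∀ (x : Space) (k : ℤ × ℤ),
      P.sepFun n g ((x.1.1 + k.1 * P.Λ₁, x.1.2 + k.2 * P.Λ₂), x.2) *
        conj (φ ((x.1.1 + k.1 * P.Λ₁, x.1.2 + k.2 * P.Λ₂), x.2)) =
      P.sepFun n g x * conj (φ x) := fun x k => by
    rw [hψ.2, hφ.2, map_mul, mul_mul_mul_comm, Complex.mul_conj, Complex.normSq_eq_norm_sq,
      mul_comm Complex.I, Complex.norm_exp_ofReal_mul_I]
    simp
  have key := P.integral_box_fderiv_eq_zero (hψ1.mul hφ2) hm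
    (fun y z => by simpa using hper ((0, y), z) (1, 0))
    (fun x z => by simpa using hper ((x, 0), z) (0, 1))
    (fun r => by simp [sepFun, h0, h1]) j
  have hK : ∀ G : Space → ℂ, Continuous G → IntegrableOn G (P.cell ×ˢ Set.Ioo m P.h) :=
    fun G hG => (hG.continuousOn.integrableOn_compact ((isCompact_Icc.prod isCompact_Icc).prod
      (isCompact_Icc (a := m) (b := P.h)))).mono_set
      (Set.prod_mono (Set.prod_mono Set.Ioo_subset_Icc_self Set.Ioo_subset_Icc_self)
        Set.Ioo_subset_Icc_self)
  have e : ∀ x, fderiv ℝ (fun x => P.sepFun n g x * conj (φ x)) x (unitVec j) =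
      P.sepFun n g x * conj (fderiv ℝ φ x (unitVec j)) +
        fderiv ℝ (P.sepFun n g) x (unitVec j) * conj (φ x) := fun x => by
    have d1 := ((hψ1.differentiable one_ne_zero) x).hasFDerivAt
    have d2 := ((hφ1.differentiable one_ne_zero) x).hasFDerivAt
    have d3 : HasFDerivAt (fun x => conj (φ x))
        (((Complex.conjCLE : ℂ ≃L[ℝ] ℂ) : ℂ →L[ℝ] ℂ) ∘L fderiv ℝ φ x) x :=
      ((Complex.conjCLE : ℂ ≃L[ℝ] ℂ) : ℂ →L[ℝ] ℂ).hasFDerivAt.comp x d2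
    have d4 : HasFDerivAt (fun x => P.sepFun n g x * conj (φ x)) _ x := d1.mul d3
    rw [d4.fderiv]
    simp
    ring
  change ∫ x in _, fderiv ℝ (fun x => P.sepFun n g x * conj (φ x)) x (unitVec j) = 0 at key
  simp_rw [e] at key
  rw [integral_add] at key
  · exact eq_neg_of_add_eq_zero_left key
  · exact hK _ (hψ1.continuous.mul (Complex.continuous_conj.comp
      ((hφ1.continuous_fderiv one_ne_zero).clm_apply continuous_const)))
  · exact hK _ (((hψ1.continuous_fderiv one_ne_zero).clm_apply continuous_const).mul
      (Complex.continuous_conj.comp hφ1.continuous))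

/-- There is a nonzero function in `H¹_qp(Ω)` with a single Fourier mode and zero trace. -/
lemma exists_single_mode (n : ℤ × ℤ) : ∃ ψ G : P.L2Ω, ψ ≠ 0 ∧
    ((ψ, ![(Complex.I * P.αn₁ n) • ψ, (Complex.I * P.αn₂ n) • ψ, G], 0) : P.Triple) ∈ P.H1qp := by
  obtain ⟨m, hm, hf⟩ := P.exists_max_f
  -- a profile on `(m, h)`, extended by zero to the region between `Γ_f` and `x₃ = m`
  set g : ℝ → ℂ := fun z => ((z : ℂ) - m) * (P.h - z) with hgdef
  have hg : ContDiff ℝ (⊤ : ℕ∞) g := by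
    have : ContDiff ℝ (⊤ : ℕ∞) (fun z : ℝ => (z : ℂ)) := Complex.ofRealCLM.contDiff
    exact (this.sub contDiff_const).mul (contDiff_const.sub this)
  set B : Set Space := P.cell ×ˢ Set.Ioo m P.h with hB
  have hBm : MeasurableSet B := P.measurableSet_cell.prod measurableSet_Ioo
  have hBΩ : B ⊆ P.Ω := fun x hx => ⟨hx.1, (hf _).trans_lt hx.2.1, hx.2.2⟩
  have hBo : IsOpen B := (isOpen_Ioo.prod isOpen_Ioo).prod isOpen_Ioo
  have hL : ∀ k : Space → ℂ, Continuous k → MemLp (B.indicator k) 2 (volume.restrict P.Ω) :=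
    fun k hk => (P.memLp_Ω hk).indicator hBm
  have hψc : Continuous (P.sepFun n g) := (P.contDiff_sepFun n hg).continuous
  have hg'c : Continuous (deriv g) := hg.continuous_deriv (by simp)
  have hGc : Continuous (P.sepFun n (deriv g)) :=
    ((P.continuous_mode n).comp continuous_fst).mul (hg'c.comp continuous_snd)
  have hint : ∀ (k : Space → ℂ) (hk : Continuous k) (l : Space → ℂ),
      ∫ x in P.Ω, (hL k hk).toLp _ x * l x = ∫ x in B, k x * l x := fun k hk l => by
    have e : ∫ x in P.Ω, (hL k hk).toLp _ x * l x =
        ∫ x in P.Ω, B.indicator (fun x => k x * l x) x := by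
      refine integral_congr_ae ?_
      filter_upwards [(hL k hk).coeFn_toLp] with x hx
      rw [hx]
      by_cases h : x ∈ B <;> simp [h]
    rw [e, setIntegral_indicator hBm, Set.inter_eq_self_of_subset_right hBΩ]
  refine ⟨(hL _ hψc).toLp _, (hL _ hGc).toLp _, fun h0 => ?_, fun φ hφ j => ?_⟩
  · have h1 := (hL _ hψc).coeFn_toLp
    rw [h0] at h1
    have h2 : ∀ᵐ x ∂volume.restrict P.Ω, x ∉ B := by
      filter_upwards [h1, Lp.coeFn_zero ℂ 2 (volume.restrict P.Ω)] with x hx hx' hxB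
      rw [hx', Set.indicator_of_mem hxB] at hx
      have e1 : ((x.2 : ℂ) - m) ≠ 0 := by
        rw [← Complex.ofReal_sub]; exact_mod_cast (sub_pos.2 hxB.2.1).ne'
      have e2 : ((P.h : ℂ) - x.2) ≠ 0 := by
        rw [← Complex.ofReal_sub]; exact_mod_cast (sub_pos.2 hxB.2.2).ne'
      have e3 : P.mode n x.1 ≠ 0 := norm_ne_zero_iff.1 (by rw [norm_mode]; exact one_ne_zero)
      exact mul_ne_zero e3 (mul_ne_zero e1 e2) hx.symm
    have h3 : volume.restrict P.Ω B = 0 := by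
      have := ae_iff.1 h2
      simpa using this
    rw [Measure.restrict_apply hBm, Set.inter_eq_self_of_subset_left hBΩ] at h3
    refine hBo.measure_ne_zero volume ⟨((P.Λ₁ / 2, P.Λ₂ / 2), (m + P.h) / 2), ?_⟩ h3
    have := P.Λ₁_pos
    have := P.Λ₂_pos
    refine ⟨⟨⟨?_, ?_⟩, ⟨?_, ?_⟩⟩, ⟨?_, ?_⟩⟩ <;> dsimp only <;> linarith
  · have key := P.integral_box_sepFun_mul_conj n hg hm.le (by simp [hgdef]) (by simp [hgdef]) hφ j
    have htr : ∫ r in P.cell, ((0 : P.L2Γ) : ℝ × ℝ → ℂ) r * conj (φ (r, P.h)) = 0 := by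
      refine integral_eq_zero_of_ae ?_
      filter_upwards [Lp.coeFn_zero ℂ 2 (volume.restrict P.cell)] with r hr
      change ((0 : P.L2Γ) : ℝ × ℝ → ℂ) r * _ = 0
      rw [hr, Pi.zero_apply, zero_mul]
    have hs : ∀ c : ℂ, ∫ x in P.Ω, (c • (hL _ hψc).toLp _ : P.L2Ω) x * conj (φ x) =
        ∫ x in B, c * P.sepFun n g x * conj (φ x) := fun c => by
      rw [← inner_toLp hφ.memLp, inner_smul_right, inner_toLp, hint _ hψc, ← integral_const_mul]
      simp_rw [mul_assoc]
    dsimp only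
    rw [htr, ite_self, add_zero, hint _ hψc, key]
    congr 1
    fin_cases j
    · refine Eq.trans ?_ (hs _).symm
      exact integral_congr_ae (Filter.Eventually.of_forall fun x => by
        dsimp only; rw [← fderiv_sepFun_zero P n hg]; rfl)
    · refine Eq.trans ?_ (hs _).symm
      exact integral_congr_ae (Filter.Eventually.of_forall fun x => by
        dsimp only; rw [← fderiv_sepFun_one P n hg]; rfl)
    · refine Eq.trans ?_ (hint _ hGc _).symm
      exact integral_congr_ae (Filter.Eventually.of_forall fun x => by
        dsimp only; rw [← fderiv_sepFun_two P n hg]; rfl)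

variable {P} in
/-- A bound of the dual norm. Fields with vanishing `H¹` norm cause no harm, since the quotient is
then `0`. -/
lemma dualSup_le {F : P.VField → ℂ} {C : ℝ} (hC : 0 ≤ C)
    (h : ∀ v ∈ P.V, ‖F v‖ ≤ C * VField.H1norm v) : P.dualSup F ≤ ENNReal.ofReal C :=
  iSup₂_le fun v hv => iSup_le fun _ =>
    ENNReal.ofReal_le_ofReal (div_le_of_le_mul₀ (P.H1norm_nonneg v) hC (h v hv))

lemma norm_sum_inner_le {ι E : Type*} [NormedAddCommGroup E] [InnerProductSpace ℂ E]
    (s : Finset ι) (a b : ι → E) :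
    ‖∑ i ∈ s, inner ℂ (a i) (b i)‖ ≤
      Real.sqrt (∑ i ∈ s, ‖a i‖ ^ 2) * Real.sqrt (∑ i ∈ s, ‖b i‖ ^ 2) :=
  (norm_sum_le _ _).trans ((Finset.sum_le_sum fun _ _ => norm_inner_le_norm _ _).trans
    (Real.sum_mul_le_sqrt_mul_sqrt _ _ _))

/-- On divergence-free fields with zero trace and a high Fourier mode, the form is bounded by `2μ`;
this limits the inf-sup constant. -/
theorem le_of_infSup {γ₁ : ℝ} (h : P.InfSup γ₁) : γ₁ ≤ 2 * P.μ := by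
  have hμ := P.μ_pos
  obtain ⟨n, hn⟩ := P.exists_lt_αabs (P.κ₂ ^ 2)
  have hκ := P.κ₂_pos
  have hα : 0 < P.αabs n := lt_of_le_of_lt (by positivity) hn
  obtain ⟨ψ, G, hψ0, hψ⟩ := P.exists_single_mode n
  set a : ℂ := (P.αn₁ n : ℂ) with ha
  set b : ℂ := (P.αn₂ n : ℂ) with hb
  set t : P.H := ⟨WithLp.toLp 2 (ψ, WithLp.toLp 2 (WithLp.toLp 2
    ![(Complex.I * a) • ψ, (Complex.I * b) • ψ, G], 0)), P.mem_H.2 hψ⟩ with ht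
  -- the field `(-α₂, α₁, 0) ψ` is divergence free
  set c : Fin 3 → ℂ := ![-b, a, 0] with hc
  set x : P.Field := WithLp.toLp 2 fun i => c i • t with hx
  have hval : ∀ i, P.valL i x = c i • ψ := fun i => rfl
  have hpar : ∀ i j, P.partialL i j x =
      c i • (![(Complex.I * a) • ψ, (Complex.I * b) • ψ, G] : Fin 3 → P.L2Ω) j := fun i j => rfl
  have htr : ∀ i, P.trL i x = 0 := fun i => smul_zero (A := P.L2Γ) (c i)
  have hdiv : P.divL x = 0 := by
    have e : P.divL x = P.partialL 0 0 x + P.partialL 1 1 x + P.partialL 2 2 x := by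
      rw [divL, Fin.sum_univ_three]; rfl
    rw [e, hpar, hpar, hpar]
    simp only [hc, Matrix.cons_val_zero, Matrix.cons_val_one, Matrix.cons_val, zero_smul, add_zero,
      smul_smul, ← add_smul]
    rw [show -b * (Complex.I * a) + a * (Complex.I * b) = 0 by ring, zero_smul]
  have hcoeff : ∀ k, P.coeffL k x = 0 := fun k => by
    rw [coeffL_apply]
    ext i
    refine (P.coeff_Lp (P.trL i x) k).trans ?_
    rw [htr, inner_zero_right, mul_zero]
    rfl
  set N : P.Field → ℝ := fun y => ∑ i, ‖P.valL i y‖ ^ 2 with hN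
  set D : P.Field → ℝ := fun y => ∑ p : Fin 3 × Fin 3, ‖P.partialL p.1 p.2 y‖ ^ 2 with hD
  have hD' : ∀ y, D y = ∑ i, ∑ j, ‖P.partialL i j y‖ ^ 2 := fun y => Fintype.sum_prod_type _
  have hE : ∀ y, VField.H1norm y.toV ^ 2 = N y + D y := fun y => by
    rw [H1norm_sq, energyV_eq, hD']
  have hN0 : ∀ y, 0 ≤ N y := fun y => by positivity
  have hD0 : ∀ y, 0 ≤ D y := fun y => by positivity
  -- the tangential derivatives make the gradient large compared with the field
  have hND : P.αabs n ^ 2 * N x ≤ D x := by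
    have h1 : ∀ i, P.αabs n ^ 2 * ‖P.valL i x‖ ^ 2 ≤ ∑ j, ‖P.partialL i j x‖ ^ 2 := fun i => by
      rw [hval, Fin.sum_univ_three, hpar, hpar, P.αabs_sq]
      simp only [Matrix.cons_val_zero, Matrix.cons_val_one, norm_smul, norm_mul, Complex.norm_I,
        one_mul, ha, hb, Complex.norm_real, Real.norm_eq_abs, mul_pow, sq_abs]
      have : 0 ≤ ‖P.partialL i 2 x‖ ^ 2 := by positivity
      linarith
    rw [hD', Finset.mul_sum]
    exact Finset.sum_le_sum fun i _ => h1 i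
  have hκN : P.κ₂ ^ 2 * Real.sqrt (N x) ≤ Real.sqrt (D x) := by
    have h1 : P.αabs n * Real.sqrt (N x) ≤ Real.sqrt (D x) := by
      refine Real.le_sqrt_of_sq_le ?_
      rwa [mul_pow, Real.sq_sqrt (hN0 x)]
    exact (mul_le_mul_of_nonneg_right hn.le (Real.sqrt_nonneg _)).trans h1
  have hω : P.ω ^ 2 = P.μ * P.κ₂ ^ 2 := by
    rw [κ₂, div_pow, Real.sq_sqrt hμ.le]; field_simp
  have hform : ∀ v ∈ P.V, ‖P.form P.M x.toV v‖ ≤ (2 * P.μ * VField.H1norm x.toV) * VField.H1norm v := by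
    intro v hv
    rw [← P.toV_ofV v hv]
    set y := P.ofV v hv
    rw [form_eq, volumeForm_eq, pairing_toV]
    simp only [hdiv, hcoeff, map_zero, inner_zero_right, tsum_zero, mul_zero, add_zero, sub_zero]
    rw [← Fintype.sum_prod_type' (f := fun i j => inner ℂ (P.partialL i j y) (P.partialL i j x))]
    have b1 := norm_sum_inner_le Finset.univ (fun p : Fin 3 × Fin 3 => P.partialL p.1 p.2 y)
      (fun p : Fin 3 × Fin 3 => P.partialL p.1 p.2 x)
    have b2 := norm_sum_inner_le Finset.univ (fun i => P.valL i y) (fun i => P.valL i x)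
    have hDx : Real.sqrt (D x) ≤ VField.H1norm x.toV :=
      Real.sqrt_le_iff.2 ⟨P.H1norm_nonneg _, by rw [hE]; linarith [hN0 x]⟩
    have hDy : Real.sqrt (D y) ≤ VField.H1norm y.toV :=
      Real.sqrt_le_iff.2 ⟨P.H1norm_nonneg _, by rw [hE]; linarith [hN0 y]⟩
    have hNy : Real.sqrt (N y) ≤ VField.H1norm y.toV :=
      Real.sqrt_le_iff.2 ⟨P.H1norm_nonneg _, by rw [hE]; linarith [hD0 y]⟩
    have hxn := P.H1norm_nonneg x.toV
    refine (norm_sub_le _ _).trans ?_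
    rw [norm_mul, norm_mul, norm_pow, Complex.norm_real, Complex.norm_real, Real.norm_eq_abs,
      Real.norm_eq_abs, sq_abs, abs_of_pos hμ, hω]
    calc _ ≤ P.μ * (Real.sqrt (D y) * Real.sqrt (D x)) +
          P.μ * P.κ₂ ^ 2 * (Real.sqrt (N y) * Real.sqrt (N x)) := by gcongr
      _ = P.μ * (Real.sqrt (D y) * Real.sqrt (D x)) +
          P.μ * (Real.sqrt (N y) * (P.κ₂ ^ 2 * Real.sqrt (N x))) := by ring
      _ ≤ P.μ * (VField.H1norm y.toV * VField.H1norm x.toV) +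
          P.μ * (VField.H1norm y.toV * VField.H1norm x.toV) := by
          have := P.H1norm_nonneg y.toV
          gcongr
          exact hκN.trans hDx
      _ = _ := by ring
  have hx0 : 0 < VField.H1norm x.toV := by
    refine lt_of_le_of_ne (P.H1norm_nonneg _) fun h0 => ?_
    have hx' := P.eq_zero_of_H1norm h0.symm
    have hv : ∀ i, c i = 0 := fun i => by
      have := hval i
      rw [hx', map_zero] at this
      exact (smul_eq_zero.1 this.symm).resolve_right hψ0
    have ha0 : P.αn₁ n = 0 := Complex.ofReal_eq_zero.1 (hv 1)
    have hb0 : P.αn₂ n = 0 := Complex.ofReal_eq_zero.1 (neg_eq_zero.1 (hv 0))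
    have := P.αabs_sq n
    rw [ha0, hb0] at this
    nlinarith
  have h1 := (h x.toV (x.toV_mem P)).trans (dualSup_le (by positivity) hform)
  rw [ENNReal.ofReal_le_ofReal_iff (by positivity)] at h1
  exact le_of_mul_le_mul_right h1 hx0

/-! ### The incident field and the load functional -/

lemma continuous_uInc_deriv (i j : Fin 3) :
    Continuous fun x => fderiv ℝ (fun y => P.uInc y i) x (unitVec j) := by
  have h : ContDiff ℝ 1 (fun y : Space => P.uInc y i) := by
    have h1 : ContDiff ℝ 1 (fun x : Space =>
        P.κ₁ * (x.1.1 * P.q 0 + x.1.2 * P.q 1 + x.2 * P.q 2)) := by fun_prop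
    exact contDiff_const.mul (Complex.contDiff_exp.comp
      (contDiff_const.mul (Complex.ofRealCLM.contDiff.comp h1)))
  exact (h.continuous_fderiv one_ne_zero).clm_apply continuous_const

lemma memLp_traction (i : Fin 3) :
    MemLp (fun r => P.traction P.uInc (r, P.h) i) 2 (volume.restrict P.cell) := by
  refine P.memLp_cell ?_
  have h : Continuous fun x => P.traction P.uInc x i := by
    unfold traction
    refine (continuous_const.mul (P.continuous_uInc_deriv i 2)).add ?_
    split_ifs
    · exact continuous_const.mul (continuous_finsetSum _ fun j _ => P.continuous_uInc_deriv j j)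
    · exact continuous_const
  exact h.comp (by fun_prop)

lemma uIncΓ_eq (i : Fin 3) (r : ℝ × ℝ) :
    P.uIncΓ i r = (P.q i * Complex.exp (Complex.I * ((P.κ₁ * P.h * P.q 2 : ℝ) : ℂ))) *
      P.mode 0 r := by
  have e : P.κ₁ * (r.1 * P.q 0 + r.2 * P.q 1 + P.h * P.q 2) =
      P.κ₁ * P.h * P.q 2 + (P.αn₁ 0 * r.1 + P.αn₂ 0 * r.2) := by
    simp only [q, αn₁, αn₂, α₁, α₂, Matrix.cons_val_zero, Matrix.cons_val_one, Prod.fst_zero,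
      Prod.snd_zero, Int.cast_zero, mul_zero, zero_div, add_zero]
    ring
  rw [uIncΓ, uInc, mode]
  dsimp only
  rw [e, Complex.ofReal_add, mul_add, Complex.exp_add, ← mul_assoc]

lemma memLp_uIncΓ (i : Fin 3) : MemLp (P.uIncΓ i) 2 (volume.restrict P.cell) := by
  rw [show P.uIncΓ i = fun r => _ from funext (P.uIncΓ_eq i)]
  exact P.memLp_cell (continuous_const.mul (P.continuous_mode 0))

/-- The incident field consists of a single Fourier mode. -/
lemma ampCoeff_uIncΓ_of_ne {n : ℤ × ℤ} (hn : n ≠ 0) : P.ampCoeff P.uIncΓ n = 0 := by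
  ext i
  change P.coeff (P.uIncΓ i) n = 0
  have hA : (P.area : ℂ) ≠ 0 := by exact_mod_cast P.area_pos.ne'
  refine (mul_eq_zero.1 ?_).resolve_left hA
  rw [coeff_eq]
  simp_rw [uIncΓ_eq, mul_assoc]
  rw [integral_const_mul, integral_const_mul, integral_mode_mul_conj, if_neg hn.symm]
  simp

lemma hasSum_pairing_uIncΓ (S : ℤ × ℤ → Matrix (Fin 3) (Fin 3) ℂ) (b : ℤ × ℤ → Amp) :
    HasSum (fun n => inner ℂ (b n) (symbolMap (S n) (P.ampCoeff P.uIncΓ n)))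
      (inner ℂ (b 0) (symbolMap (S 0) (P.ampCoeff P.uIncΓ 0))) :=
  hasSum_single 0 fun n hn => by rw [P.ampCoeff_uIncΓ_of_ne hn, map_zero, inner_zero_right]

lemma integrable_mul_conj_memLp {X : Type*} [MeasurableSpace X] {ν : Measure X} {f g : X → ℂ}
    (hf : MemLp f 2 ν) (hg : MemLp g 2 ν) : Integrable (fun x => f x * conj (g x)) ν :=
  hf.integrable_mul hg.star

/-- The load is a bounded antilinear functional of the test field. -/
lemma exists_load (S : ℤ × ℤ → Matrix (Fin 3) (Fin 3) ℂ) :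
    ∃ l : P.Field, ∀ y : P.Field, inner ℂ y l = P.load S y.toV := by
  refine ⟨(∑ i, ContinuousLinearMap.adjoint (P.trL i) ((P.memLp_traction i).toLp _)) -
    ContinuousLinearMap.adjoint (P.coeffL 0)
      ((P.area : ℂ) • symbolMap (S 0) (P.ampCoeff P.uIncΓ 0)), fun y => ?_⟩
  have h1 : ∫ r in P.cell, ∑ i, P.traction P.uInc (r, P.h) i * conj (VField.tr y.toV i r) =
      ∑ i, inner ℂ (P.trL i y) ((P.memLp_traction i).toLp _) := by
    change ∫ r in P.cell, ∑ i, P.traction P.uInc (r, P.h) i * conj (P.trL i y r) = _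
    rw [integral_finsetSum _ fun i _ => integrable_mul_conj_memLp (P.memLp_traction i)
      (Lp.memLp (P.trL i y))]
    refine Finset.sum_congr rfl fun i _ => ?_
    rw [inner_Lp]
    refine integral_congr_ae ?_
    filter_upwards [(P.memLp_traction i).coeFn_toLp] with r hr
    rw [hr]
  have h2 : P.pairing S P.uIncΓ (VField.tr y.toV) =
      inner ℂ (P.coeffL 0 y) ((P.area : ℂ) • symbolMap (S 0) (P.ampCoeff P.uIncΓ 0)) := by
    rw [pairing_eq, (P.hasSum_pairing_uIncΓ S _).tsum_eq, inner_smul_right, coeffL_apply]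
  rw [load, h1, h2, inner_sub_right, inner_sum]
  simp only [ContinuousLinearMap.adjoint_inner_right]

/-! ### Solvability and the error estimate -/

/-- If the form has trivial kernel, the variational problem is uniquely solvable. -/
theorem existsUnique_weakSolution {S : ℤ × ℤ → Matrix (Fin 3) (Fin 3) ℂ} {C : ℝ} (hC : 0 ≤ C)
    (hS : ∀ n (a : Amp), ‖symbolMap (S n) a - symbolMap (P.M n) a‖ ≤ C * ‖a‖)
    (hker : ∀ u ∈ P.V, (∀ v ∈ P.V, P.form S u v = 0) → VField.H1norm u = 0) :
    ∃! u : P.VField, P.IsWeakSolution S u := by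
  obtain ⟨A, hA⟩ := P.exists_formOperator (admissible_of_norm_sub_le hC hS)
  obtain ⟨l, hl⟩ := P.exists_load S
  have hinj : ∀ x, A x = 0 → x = 0 := fun x hx => by
    refine P.eq_zero_of_H1norm (hker _ (x.toV_mem P) fun v hv => ?_)
    rw [← P.toV_ofV v hv, ← hA, hx, inner_zero_right]
  obtain ⟨x, hx⟩ := P.surjective_of_injective hC hS hA hinj l
  refine ⟨x.toV, ⟨x.toV_mem P, fun v hv => ?_⟩, fun u hu => ?_⟩
  · rw [← P.toV_ofV v hv, ← hA, hx, hl]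
  · have h1 : A (P.ofV u hu.1) = l := by
      refine ext_inner_left ℂ fun y => ?_
      rw [hA, hl, toV_ofV]
      exact hu.2 _ (y.toV_mem P)
    have h2 : P.ofV u hu.1 - x = 0 := hinj _ (by rw [map_sub, h1, hx, sub_self])
    rw [← sub_eq_zero.1 h2, toV_ofV]

/-- The effect of a change of the symbol on the form. -/
lemma form_eq_form_add_pairing {S T : ℤ × ℤ → Matrix (Fin 3) (Fin 3) ℂ} (hS : P.Admissible S)
    (hT : P.Admissible T) {u v : P.VField} (hu : u ∈ P.V) (hv : v ∈ P.V) :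
    P.form T u v =
      P.form S u v + P.pairing (fun n => S n - T n) (VField.tr u) (VField.tr v) := by
  rw [← P.toV_ofV u hu, ← P.toV_ofV v hv]
  rw [form_eq, form_eq, pairing_toV, pairing_toV, pairing_toV]
  simp_rw [symbolMap_sub, inner_sub_right]
  rw [(P.summable_pairing hS _ _).tsum_sub (P.summable_pairing hT _ _)]
  ring

lemma coeff_sub {w z : ℝ × ℝ → ℂ} (hw : MemLp w 2 (volume.restrict P.cell))
    (hz : MemLp z 2 (volume.restrict P.cell)) (n : ℤ × ℤ) :
    P.coeff (fun r => w r - z r) n = P.coeff w n - P.coeff z n := by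
  have hA : (P.area : ℂ) ≠ 0 := by exact_mod_cast P.area_pos.ne'
  refine mul_left_cancel₀ hA ?_
  rw [mul_sub, coeff_eq, coeff_eq, coeff_eq, ← integral_sub
    (integrable_mul_conj_memLp hw (P.memLp_mode n)) (integrable_mul_conj_memLp hz (P.memLp_mode n))]
  simp_rw [sub_mul]

/-- Bessel's inequality on `Γ_h`. -/
lemma sum_ampCoeff_le {w : Fin 3 → ℝ × ℝ → ℂ} (hw : ∀ i, MemLp (w i) 2 (volume.restrict P.cell))
    (F : Finset (ℤ × ℤ)) :
    ∑ n ∈ F, 1 * ‖P.ampCoeff w n‖ ^ 2 ≤ (P.normΓ w / Real.sqrt P.area) ^ 2 := by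
  have hA := P.area_pos
  have h0 : 0 ≤ ∑ i, ∫ r in P.cell, ‖w i r‖ ^ 2 :=
    Finset.sum_nonneg fun i _ => integral_norm_sq_nonneg _ _
  rw [div_pow, normΓ, Real.sq_sqrt h0, Real.sq_sqrt hA.le, le_div_iff₀ hA, Finset.sum_mul]
  have e : ∀ n, 1 * ‖P.ampCoeff w n‖ ^ 2 * P.area = ∑ i, P.area * ‖P.coeff (w i) n‖ ^ 2 :=
    fun n => by
      rw [EuclideanSpace.norm_sq_eq, ← Finset.mul_sum, one_mul, mul_comm]
      rfl
  simp_rw [e]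
  rw [Finset.sum_comm]
  refine Finset.sum_le_sum fun i _ => ?_
  exact sum_le_hasSum F (fun n _ => mul_nonneg hA.le (by positivity))
    (P.hasSum_norm_coeff_sq (hw i))

/-- Bounded symbols act on `L²(Γ_h)³`. -/
lemma norm_pairing_le_normΓ {D : ℤ × ℤ → Matrix (Fin 3) (Fin 3) ℂ} {C : ℝ} (hC : 0 ≤ C)
    (h : ∀ n (a : Amp), ‖symbolMap (D n) a‖ ≤ C * ‖a‖) {w : Fin 3 → ℝ × ℝ → ℂ}
    (hw : ∀ i, MemLp (w i) 2 (volume.restrict P.cell)) {v : P.VField} (hv : v ∈ P.V) :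
    ‖P.pairing D w (VField.tr v)‖ ≤ C * P.normΓ w * VField.H1norm v := by
  have hA := P.area_pos
  have hv' : ∀ F : Finset (ℤ × ℤ), ∑ n ∈ F, 1 * ‖P.ampCoeff (VField.tr v) n‖ ^ 2 ≤
      (VField.H1norm v / Real.sqrt P.area) ^ 2 := fun F =>
    (Finset.sum_le_sum fun n _ => mul_le_mul_of_nonneg_right (P.one_le_weight n)
      (by positivity)).trans (P.sum_weight_ampCoeff_le hv F)
  have key := (summable_inner_symbol (S := fun n => symbolMap (D n)) (σ := fun _ => 1)
    (fun _ => zero_le_one) (div_nonneg (Real.sqrt_nonneg _) (Real.sqrt_nonneg _))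
    (div_nonneg (P.H1norm_nonneg _) (Real.sqrt_nonneg _)) hC
    (fun n => by rw [mul_one]; exact h n _) (P.sum_ampCoeff_le hw) hv').2
  rw [pairing_eq, norm_mul, Complex.norm_real, Real.norm_of_nonneg hA.le]
  calc _ ≤ P.area * (C * (P.normΓ w / Real.sqrt P.area *
        (VField.H1norm v / Real.sqrt P.area))) := mul_le_mul_of_nonneg_left key hA.le
    _ = C * P.normΓ w * VField.H1norm v * (P.area / (Real.sqrt P.area * Real.sqrt P.area)) := by
        field_simp
    _ = _ := by rw [Real.mul_self_sqrt hA.le, div_self hA.ne', mul_one]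

/-- The consistency error of two weak solutions for different symbols. -/
lemma form_sub_eq {S : ℤ × ℤ → Matrix (Fin 3) (Fin 3) ℂ} (hS : P.Admissible S) {u u' : P.VField}
    (hu : P.IsWeakSolution P.M u) (hu' : P.IsWeakSolution S u') {v : P.VField} (hv : v ∈ P.V) :
    P.form P.M (u - u') v = -P.pairing (fun n => S n - P.M n)
      (fun i r => VField.tr u' i r - P.uIncΓ i r) (VField.tr v) := by
  obtain ⟨A, hA⟩ := P.exists_formOperator P.admissible_M
  have h1 : P.form P.M (u - u') v = P.form P.M u v - P.form P.M u' v := by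
    rw [← P.toV_ofV u hu.1, ← P.toV_ofV u' hu'.1, ← P.toV_ofV v hv, ← toV_sub, ← hA, ← hA, ← hA,
      map_sub, inner_sub_right]
  rw [h1, hu.2 v hv, P.form_eq_form_add_pairing hS P.admissible_M hu'.1 hv, hu'.2 v hv, load, load]
  set b : ℤ × ℤ → Amp := fun n => P.ampCoeff (VField.tr v) n
  set D : ℤ × ℤ → Matrix (Fin 3) (Fin 3) ℂ := fun n => S n - P.M n with hD
  have e : ∀ n, P.ampCoeff (fun i r => VField.tr u' i r - P.uIncΓ i r) n =
      P.ampCoeff (VField.tr u') n - P.ampCoeff P.uIncΓ n := fun n => by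
    ext i
    exact P.coeff_sub (Lp.memLp (u' i).2.2) (P.memLp_uIncΓ i) n
  have s1 : Summable fun n => inner ℂ (b n) (symbolMap (D n) (P.ampCoeff (VField.tr u') n)) := by
    have hx := (P.summable_pairing hS (P.ofV u' hu'.1) (P.ofV v hv)).sub
      (P.summable_pairing P.admissible_M (P.ofV u' hu'.1) (P.ofV v hv))
    refine hx.congr fun n => ?_
    rw [hD, symbolMap_sub, inner_sub_right, coeffL_apply, coeffL_apply]
    rfl
  have s2 := P.hasSum_pairing_uIncΓ D b
  have s3 := P.hasSum_pairing_uIncΓ S b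
  have s4 := P.hasSum_pairing_uIncΓ P.M b
  rw [pairing_eq P D (fun i r => VField.tr u' i r - P.uIncΓ i r), pairing_eq P D (VField.tr u'),
    pairing_eq P S, pairing_eq P P.M]
  simp_rw [e, map_sub, inner_sub_right]
  rw [s1.tsum_sub s2.summable, s2.tsum_eq, s3.tsum_eq, s4.tsum_eq, hD, symbolMap_sub,
    inner_sub_right]
  ring

lemma zeta_im_pos {ρ : ℝ → ℂ} (hρ : P.IsPMLProfile ρ) {δ : ℝ} (hδ : 0 < δ) :
    0 < (P.zeta ρ δ).im := by
  have h : (P.zeta ρ δ).im = ∫ τ in P.h..(P.h + δ), (ρ τ).im :=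
    (intervalIntegral.intervalIntegral_im (𝕜 := ℂ) (hρ.continuous.intervalIntegrable _ _)).symm
  rw [h]
  exact intervalIntegral.intervalIntegral_pos_of_pos_on
    ((Complex.continuous_im.comp hρ.continuous).intervalIntegrable _ _)
    (fun τ hτ => hρ.im_pos τ hτ.1) (by linarith)

end Scattering

end ElasticGrating

end

theorem theorem3p1 (P : ElasticGrating.Scattering) (hres : P.NoResonance) :
    (∃ c : ℝ, 0 < c ∧ ∀ s : ℝ, 0 < s → ∃ C : ℝ, ∀ ζ : ℂ, s ≤ ζ.re → s ≤ ζ.im →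
      |P.Khat ζ| ≤ C * (Real.exp (-(c * ζ.re)) + Real.exp (-(c * ζ.im)))) ∧
    ∀ (ρ : ℝ → ℂ) (δ : ℝ), P.IsPMLProfile ρ → 0 < δ → 1 ≤ (P.zeta ρ δ).re →
      ∀ γ₁ : ℝ, 0 < γ₁ → P.InfSup γ₁ → P.Khat (P.zeta ρ δ) * P.γ₂ ^ 2 < γ₁ →
        (∃! uPML : P.VField, P.IsWeakSolution (P.MPML (P.zeta ρ δ)) uPML) ∧
        ∀ u uPML : P.VField, P.IsWeakSolution P.M u →
          P.IsWeakSolution (P.MPML (P.zeta ρ δ)) uPML →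
          P.dualSup (P.form P.M (u - uPML)) ≤
            ENNReal.ofReal (P.γ₂ * P.Khat (P.zeta ρ δ) *
              P.normΓ (fun i r => ElasticGrating.Scattering.VField.tr uPML i r - P.uIncΓ i r)) := by
  refine ⟨P.Khat_decay hres, fun ρ δ hρ hδ hre γ₁ hγ₁ hinf hK => ?_⟩
  have him := P.zeta_im_pos hρ hδ
  set ζ := P.zeta ρ δ
  have hγ₂ := P.one_le_γ₂
  have hμ := P.μ_pos
  have hγμ := P.le_of_infSup hinf
  have hKγ : P.Khat ζ < γ₁ := by
    rcases le_or_gt (P.Khat ζ) 0 with h | h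
    · exact h.trans_lt hγ₁
    · exact (le_mul_of_one_le_right h.le (one_le_pow₀ hγ₂)).trans_lt hK
  have hD : ∀ n (a : ElasticGrating.Amp), ‖ElasticGrating.symbolMap (P.MPML ζ n - P.M n) a‖ ≤ P.Khat ζ * ‖a‖ := fun n a =>
    P.norm_MPML_sub_M_le_Khat hres hre him (hKγ.le.trans hγμ) n a.ofLp
  have hK0 : 0 ≤ P.Khat ζ := by
    have h := (norm_nonneg _).trans (hD 0 (EuclideanSpace.single 0 1))
    simpa using h
  -- the symbol of the layer is a bounded perturbation of the exact one
  have hS : ∀ n (a : ElasticGrating.Amp), ‖ElasticGrating.symbolMap (P.MPML ζ n) a - ElasticGrating.symbolMap (P.M n) a‖ ≤ P.Khat ζ * ‖a‖ :=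
    fun n a => by rw [← ElasticGrating.symbolMap_sub]; exact hD n a
  have hadm := ElasticGrating.Scattering.admissible_of_norm_sub_le hK0 hS
  refine ⟨P.existsUnique_weakSolution hK0 hS fun u hu h0 => ?_, fun u uPML hu huPML => ?_⟩
  -- on the kernel of the perturbed form, the inf-sup condition gives `γ₁ ‖u‖ ≤ K̂ ‖u‖`
  · have hle : ∀ v ∈ P.V, ‖P.form P.M u v‖ ≤
        (P.Khat ζ * ElasticGrating.Scattering.VField.H1norm u) * ElasticGrating.Scattering.VField.H1norm v := fun v hv => by
      rw [P.form_eq_form_add_pairing hadm P.admissible_M hu hv, h0 v hv, zero_add, mul_assoc]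
      refine P.norm_pairing_le hK0 (fun n a => (hD n a).trans ?_) hu hv
      have := P.one_le_weight n
      gcongr
      exact le_mul_of_one_le_right hK0 this
    have hn := P.H1norm_nonneg u
    have h1 := (hinf u hu).trans (ElasticGrating.Scattering.dualSup_le (by positivity) hle)
    rw [ENNReal.ofReal_le_ofReal_iff (by positivity)] at h1
    nlinarith
  · have hw : ∀ i, MemLp (fun r => ElasticGrating.Scattering.VField.tr uPML i r - P.uIncΓ i r) 2
        (volume.restrict P.cell) := fun i =>
      (Lp.memLp (uPML i).2.2).sub (P.memLp_uIncΓ i)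
    have hn : 0 ≤ P.normΓ
        (fun i r => ElasticGrating.Scattering.VField.tr uPML i r - P.uIncΓ i r) := Real.sqrt_nonneg _
    refine ElasticGrating.Scattering.dualSup_le (by positivity) fun v hv => ?_
    rw [P.form_sub_eq hadm hu huPML hv, norm_neg]
    refine (P.norm_pairing_le_normΓ hK0 hD hw hv).trans ?_
    exact mul_le_mul_of_nonneg_right (mul_le_mul_of_nonneg_right
      (le_mul_of_one_le_left hK0 hγ₂) hn) (P.H1norm_nonneg v)
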